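/- Let $m,n\ge 0$ and $\mathbf a=(a_1,\dots,a_m)\in\mathbb C^m$. Let $A=\mathbb C[t_1,\dots,t_m]\otimes\Lambda(\xi_1,\dots,\xi_n)$ ($t_i$ even, $\xi_j$ odd), let $W$ be the Lie superalgebra of superderivations of $A$, and $\widetilde W=W\ltimes A$ with $A$ abelian. All modules are $\mathbb Z_2$-graded over $\mathbb C$ and morphisms are even. A $\widetilde W$-module is an $AW$-module if $A$ acts on it as an associative unital algebra; equivalently it is a module over $\bar U$, the quotient of the enveloping superalgebra $\mathcal U(\widetilde W)$ by the ideal identifying the products $a\cdot b$ ($a,b\in A$) with $ab$ and $1_A$ with $1$. For $\alpha\in\mathbb Z_{\ge 0}^m$, $I\subseteq\{1,\dots,n\}$ and $\partial\in\{\frac{\partial}{\partial t_1},\dots,\frac{\partial}{\partial t_m},\frac{\partial}{\partial \xi_1},\dots,\frac{\partial}{\partial \xi_n}\}$ put $$X_{\alpha,I,\partial}=\sum_{0\le\beta\le\alpha,\ J\subseteq I}(-1)^{|\beta|+|J|+\tau(J,I\setminus J)}\binom{\alpha}{\beta}\,t^\beta\xi_J\cdot t^{\alpha-\beta}\xi_{I\setminus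 J}\partial\ \in\bar U,$$ where $\xi_J$ is the product of the $\xi_j$, $j\in J$, in increasing order and $\tau(J,K)$ is the number of pairs $(j,k)\in J\times K$ with $k<j$. Let $T\subset\bar U$ be the span of the $X_{\alpha,I,\partial}$ with $|\alpha|+|I|>0$, where $X_{\alpha,I,\partial}$ has the parity of $\xi_I\partial$. Let $\triangle=\mathrm{span}\{\frac{\partial}{\partial t_i},\frac{\partial}{\partial\xi_j}\}\subset W$ and let $\phi_{\mathbf a}:\triangle\to\mathbb C$ be the linear map with $\frac{\partial}{\partial t_i}\mapsto a_i$, $\frac{\partial}{\partial \xi_j}\mapsto 0$. Let $\Omega_{\mathbf a}^{\widetilde W}$ be the category of $AW$-modules $M$ such that $\triangle$ acts locally finitely on $M$; for every $v\in M$ there is $k\in\mathbb N$ with $(x-\phi_{\mathbf a}(x))^kv=0$ for all $x\in\triangle$; and the space $\mathrm{Wh}_{\mathbf a}(M)=\{v\in M: xv=\phi_{\mathbf a}(x)v\ \ \forall x\in\triangle\}$ is finite-dimensional. Then $T$ is closed under the supercommutator of $\bar U$, hence a Lie superalgebra, and there is a functor $$\mathcal F:\{\text{finite-dimensional } T\text{-modules}\}\to\Omega_{\mathbf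 a}^{\widetilde W},\qquad V\mapsto T(A^{\mathbf a},V)=A^{\mathbf a}\otimes V,\quad f\mapsto \mathrm{id}\otimes f,$$ which is an equivalence of categories. Here $A^{\mathbf a}\otimes V$ is $A\otimes V$ as a superspace, with the $AW$-module structure in which, for $b,p\in A$ and $v\in V$ (with $p$ homogeneous in the last formula), $$b(p\otimes v)=bp\otimes v,\qquad \tfrac{\partial}{\partial t_i}(p\otimes v)=\bigl(\tfrac{\partial p}{\partial t_i}+a_ip\bigr)\otimes v,\qquad \tfrac{\partial}{\partial \xi_j}(p\otimes v)=\tfrac{\partial p}{\partial \xi_j}\otimes v,$$ $$x(p\otimes v)=(-1)^{|x||p|}p\otimes xv\quad\text{for homogeneous } x\in T.$$ Moreover, for all finite-dimensional $T$-modules $V,V'$, the map $f\mapsto\mathrm{id}\otimes f$ is also a bijection from the set of all linear maps $V\to V'$ commuting with $T$ (not necessarily parity preserving) onto the set of all linear maps $A^{\mathbf a}\otimes V\to A^{\mathbf a}\otimes V'$ commuting with $\widetilde W$. -/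

import Mathlib

open scoped TensorProduct

universe u

namespace SuperWitt

noncomputable section

/-! ### The supercommutative algebra `A = ℂ[t₁,…,t_m] ⊗ Λ(ξ₁,…,ξ_n)` -/

/-- The Koszul sign `(-1)^{ij}` for parities `i`, `j`. -/
def sgn (i j : ZMod 2) : ℂ := (-1) ^ (i.val * j.val)

/-- The exterior algebra `Λ(n)` in `n` variables. -/
abbrev Lam (n : ℕ) : Type := ExteriorAlgebra ℂ (Fin n → ℂ)

/-- The algebra `A_{m,n}`. The polynomial factor is purely even, so that the super tensor product
is the ordinary tensor product of algebras. -/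
abbrev A (m n : ℕ) : Type := MvPolynomial (Fin m) ℂ ⊗[ℂ] Lam n

/-- The even (`i = 0`) and odd (`i = 1`) part of `Λ(n)`. -/
abbrev lamGr (n : ℕ) (i : ZMod 2) : Submodule ℂ (Lam n) :=
  CliffordAlgebra.evenOdd (0 : QuadraticForm ℂ (Fin n → ℂ)) i

/-- The even and odd part of `A_{m,n}`: all of `ℂ[t]` is even, each `ξ_j` is odd. -/
def aGr (m n : ℕ) (i : ZMod 2) : Submodule ℂ (A m n) :=
  Submodule.span ℂ {z | ∃ (p : MvPolynomial (Fin m) ℂ) (x : Lam n), x ∈ lamGr n i ∧ z = p ⊗ₜ[ℂ] x}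

/-- The variable `ξ_j` in `Λ(n)`. -/
def xi {n : ℕ} (j : Fin n) : Lam n := ExteriorAlgebra.ι ℂ (Pi.single j 1)

/-- `ξ_I = ξ_{l₁} ⋯ ξ_{l_k}` for `I = {l₁ < ⋯ < l_k}`. -/
def xiProd {n : ℕ} (I : Finset (Fin n)) : Lam n := ((I.sort (· ≤ ·)).map xi).prod

/-- The monomial `t^α ξ_I` in `A_{m,n}`. -/
def mono {m n : ℕ} (α : Fin m →₀ ℕ) (I : Finset (Fin n)) : A m n :=
  MvPolynomial.monomial α (1 : ℂ) ⊗ₜ[ℂ] xiProd I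

/-! ### The Witt superalgebra `W_{m,n}` -/

/-- The homogeneous superderivations of `A_{m,n}` of parity `i`. -/
def wGr (m n : ℕ) (i : ZMod 2) : Submodule ℂ (Module.End ℂ (A m n)) where
  carrier := {D | (∀ j, ∀ x ∈ aGr m n j, D x ∈ aGr m n (i + j)) ∧
    ∀ j, ∀ x ∈ aGr m n j, ∀ y, D (x * y) = D x * y + sgn i j • (x * D y)}
  add_mem' := by
    rintro D E ⟨hD, hD'⟩ ⟨hE, hE'⟩
    refine ⟨fun j x hx => Submodule.add_mem _ (hD j x hx) (hE j x hx), fun j x hx y => ?_⟩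
    simp only [LinearMap.add_apply, hD' j x hx y, hE' j x hx y, add_mul, mul_add, smul_add]
    abel
  zero_mem' := by
    refine ⟨fun j x _ => Submodule.zero_mem _, fun j x _ y => ?_⟩
    simp
  smul_mem' := by
    rintro c D ⟨hD, hD'⟩
    refine ⟨fun j x hx => Submodule.smul_mem _ _ (hD j x hx), fun j x hx y => ?_⟩
    simp only [LinearMap.smul_apply, hD' j x hx y, smul_add, smul_mul_assoc, mul_smul_comm]
    rw [smul_comm c]

/-- `W_{m,n}`, the space of all superderivations of `A_{m,n}`. -/
def wTotal (m n : ℕ) : Submodule ℂ (Module.End ℂ (A m n)) := wGr m n 0 ⊔ wGr m n 1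

/-- The partial derivatives: `Sum.inl i` stands for `∂/∂t_i` and `Sum.inr j` for the left
derivative `∂/∂ξ_j`. -/
def pd {m n : ℕ} : Fin m ⊕ Fin n → Module.End ℂ (A m n)
  | Sum.inl i => TensorProduct.map (MvPolynomial.pderiv i).toLinearMap LinearMap.id
  | Sum.inr j => TensorProduct.map LinearMap.id
      (CliffordAlgebra.contractLeft (Q := (0 : QuadraticForm ℂ (Fin n → ℂ))) (LinearMap.proj j))

/-- The parity of a partial derivative. -/
def pdPar {m n : ℕ} : Fin m ⊕ Fin n → ZMod 2
  | Sum.inl _ => 0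
  | Sum.inr _ => 1

/-- The operator `t^α ξ_I ∂` on `A_{m,n}`. -/
def monoPd {m n : ℕ} (α : Fin m →₀ ℕ) (I : Finset (Fin n)) (d : Fin m ⊕ Fin n) :
    Module.End ℂ (A m n) :=
  LinearMap.mulLeft ℂ (mono α I) ∘ₗ pd d

/-! ### Helper facts: `t^α ξ_I ∂` is a superderivation -/

theorem sgn_zero_left (j : ZMod 2) : sgn 0 j = 1 := by simp [sgn]

theorem sgn_add_left (i i' j : ZMod 2) : sgn (i + i') j = sgn i j * sgn i' j := by
  have h : ∀ i i' j : ZMod 2, (-1 : ℤ) ^ ((i + i').val * j.val) =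
      (-1) ^ (i.val * j.val) * (-1) ^ (i'.val * j.val) := by decide
  have := congrArg (Int.cast : ℤ → ℂ) (h i i' j)
  push_cast at this
  exact this

theorem tmul_mem_aGr {m n : ℕ} {i : ZMod 2} (p : MvPolynomial (Fin m) ℂ) {x : Lam n}
    (hx : x ∈ lamGr n i) : p ⊗ₜ[ℂ] x ∈ aGr m n i :=
  Submodule.subset_span ⟨p, x, hx, rfl⟩

theorem aGr_induction {m n : ℕ} {i : ZMod 2} {P : A m n → Prop}
    (h : ∀ p x, x ∈ lamGr n i → P (p ⊗ₜ[ℂ] x)) (h0 : P 0)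
    (ha : ∀ x y, P x → P y → P (x + y)) (hs : ∀ (c : ℂ) x, P x → P (c • x))
    {z : A m n} (hz : z ∈ aGr m n i) : P z := by
  refine Submodule.span_induction (p := fun z _ => P z) ?_ h0
    (fun x y _ _ => ha x y) (fun c x _ => hs c x) hz
  rintro _ ⟨p, x, hx, rfl⟩
  exact h p x hx

theorem aGr_mul {m n : ℕ} {i j : ZMod 2} {x y : A m n} (hx : x ∈ aGr m n i)
    (hy : y ∈ aGr m n j) : x * y ∈ aGr m n (i + j) := by
  refine aGr_induction (P := fun x => x * y ∈ aGr m n (i + j)) ?_ ?_ ?_ ?_ hx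
  · intro p a ha
    refine aGr_induction (P := fun y => p ⊗ₜ[ℂ] a * y ∈ aGr m n (i + j)) ?_ ?_ ?_ ?_ hy
    · intro q b hb
      rw [Algebra.TensorProduct.tmul_mul_tmul]
      exact tmul_mem_aGr _ (SetLike.mul_mem_graded ha hb)
    · simp
    · intro u v hu hv
      rw [mul_add]
      exact Submodule.add_mem _ hu hv
    · intro c u hu
      rw [mul_smul_comm]
      exact Submodule.smul_mem _ _ hu
  · simp
  · intro u v hu hv
    rw [add_mul]
    exact Submodule.add_mem _ hu hv
  · intro c u hu
    rw [smul_mul_assoc]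
    exact Submodule.smul_mem _ _ hu

theorem involute_of_mem {n : ℕ} {i : ZMod 2} {x : Lam n} (hx : x ∈ lamGr n i) :
    CliffordAlgebra.involute x = sgn 1 i • x := by
  have h2 : ∀ i : ZMod 2, i = 0 ∨ i = 1 := by decide
  rcases h2 i with rfl | rfl
  · have h : sgn 1 0 = 1 := by simp [sgn]
    rw [CliffordAlgebra.involute_eq_of_mem_even hx, h, one_smul]
  · have h : sgn 1 1 = -1 := by simp [sgn, ZMod.val_one]
    rw [CliffordAlgebra.involute_eq_of_mem_odd hx, h, neg_smul, one_smul]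

theorem contractLeft_mul {n : ℕ} (d : Module.Dual ℂ (Fin n → ℂ)) (x y : Lam n) :
    CliffordAlgebra.contractLeft d (x * y) =
      CliffordAlgebra.contractLeft d x * y +
        CliffordAlgebra.involute x * CliffordAlgebra.contractLeft d y := by
  induction x using CliffordAlgebra.left_induction with
  | algebraMap r =>
    simp [CliffordAlgebra.contractLeft_algebraMap_mul, CliffordAlgebra.contractLeft_algebraMap]
  | add a b ha hb => simp only [add_mul, map_add, ha, hb]; abel
  | ι_mul a v ha =>
    rw [mul_assoc, CliffordAlgebra.contractLeft_ι_mul, ha, CliffordAlgebra.contractLeft_ι_mul,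
      map_mul, CliffordAlgebra.involute_ι]
    simp only [mul_add, sub_mul, smul_mul_assoc, mul_assoc, neg_mul]
    abel

theorem contractLeft_mem {n : ℕ} (d : Module.Dual ℂ (Fin n → ℂ)) {i : ZMod 2} {x : Lam n}
    (hx : x ∈ lamGr n i) : CliffordAlgebra.contractLeft d x ∈ lamGr n (1 + i) := by
  induction x, hx using CliffordAlgebra.evenOdd_induction with
  | range_ι_pow v h =>
    fin_cases i
    · obtain ⟨r, rfl⟩ := Submodule.mem_one.mp h
      rw [CliffordAlgebra.contractLeft_algebraMap]
      exact Submodule.zero_mem _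
    · have h' : v ∈ LinearMap.range (CliffordAlgebra.ι (0 : QuadraticForm ℂ (Fin n → ℂ))) := by
        have h2 : v ∈ LinearMap.range
          (CliffordAlgebra.ι (0 : QuadraticForm ℂ (Fin n → ℂ))) ^ 1 := h
        rwa [pow_one] at h2
      obtain ⟨w, rfl⟩ := h'
      rw [CliffordAlgebra.contractLeft_ι]
      exact SetLike.algebraMap_mem_graded
        (CliffordAlgebra.evenOdd (0 : QuadraticForm ℂ (Fin n → ℂ))) _
  | add a b ha hb iha ihb =>
    rw [map_add]
    exact Submodule.add_mem _ iha ihb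
  | ι_mul_ι_mul u v a ha ih =>
    rw [mul_assoc, CliffordAlgebra.contractLeft_ι_mul, CliffordAlgebra.contractLeft_ι_mul]
    have key : ∀ (w : Fin n → ℂ) {k : ZMod 2} {b : Lam n}, b ∈ lamGr n k →
        CliffordAlgebra.ι (0 : QuadraticForm ℂ (Fin n → ℂ)) w * b ∈ lamGr n (1 + k) :=
      fun w k b hb => SetLike.mul_mem_graded (CliffordAlgebra.ι_mem_evenOdd_one _ w) hb
    refine Submodule.sub_mem _ (Submodule.smul_mem _ _ (key v ha)) ?_
    have e : ∀ k : ZMod 2, 1 + k = 1 + (1 + (1 + k)) := by decide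
    rw [e i]
    refine key u (Submodule.sub_mem _ (Submodule.smul_mem _ _ ?_) (key v ih))
    have e' : ∀ k : ZMod 2, 1 + (1 + k) = k := by decide
    rwa [e' i]

theorem pd_mem {m n : ℕ} (d : Fin m ⊕ Fin n) : pd d ∈ wGr m n (pdPar d) := by
  rcases d with i | j
  · refine ⟨fun j x hx => ?_, fun j x hx y => ?_⟩
    · refine aGr_induction (P := fun x => pd (Sum.inl i) x ∈ aGr m n (0 + j)) ?_ ?_ ?_ ?_ hx
      · intro p x hx
        rw [zero_add]
        exact tmul_mem_aGr _ hx
      · simp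
      · intro u v hu hv
        rw [map_add]
        exact Submodule.add_mem _ hu hv
      · intro c u hu
        rw [map_smul]
        exact Submodule.smul_mem _ _ hu
    · have hs : sgn (pdPar (Sum.inl i : Fin m ⊕ Fin n)) j = 1 := sgn_zero_left j
      rw [hs, one_smul]
      clear hx
      induction x using TensorProduct.induction_on with
      | zero => simp
      | add a b ha hb => simp only [add_mul, map_add, ha, hb]; abel
      | tmul p a =>
        induction y using TensorProduct.induction_on with
        | zero => simp
        | add a b ha hb => simp only [mul_add, map_add, ha, hb]; abel
        | tmul q b =>
          simp only [pd, Algebra.TensorProduct.tmul_mul_tmul, TensorProduct.map_tmul,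
            Derivation.coeFn_coe, Derivation.leibniz,
            LinearMap.id_apply, smul_eq_mul, TensorProduct.add_tmul]
          rw [add_comm, mul_comm q]
  · refine ⟨fun k x hx => ?_, fun k x hx y => ?_⟩
    · refine aGr_induction (P := fun x => pd (Sum.inr j) x ∈ aGr m n (1 + k)) ?_ ?_ ?_ ?_ hx
      · intro p x hx
        exact tmul_mem_aGr _ (contractLeft_mem _ hx)
      · simp
      · intro u v hu hv
        rw [map_add]
        exact Submodule.add_mem _ hu hv
      · intro c u hu
        rw [map_smul]
        exact Submodule.smul_mem _ _ hu
    · have hs : sgn (pdPar (Sum.inr j : Fin m ⊕ Fin n)) k = sgn 1 k := rfl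
      rw [hs]
      refine aGr_induction (P := fun x => pd (Sum.inr j) (x * y) = pd (Sum.inr j) x * y +
        sgn 1 k • (x * pd (Sum.inr j) y)) ?_ ?_ ?_ ?_ hx
      · intro p a ha
        induction y using TensorProduct.induction_on with
        | zero => simp
        | add a b ha hb => simp only [mul_add, map_add, ha, hb, smul_add]; abel
        | tmul q b =>
          simp only [pd, Algebra.TensorProduct.tmul_mul_tmul, TensorProduct.map_tmul,
            LinearMap.id_apply]
          rw [contractLeft_mul, involute_of_mem ha, TensorProduct.tmul_add, smul_mul_assoc,
            TensorProduct.tmul_smul]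
      · simp
      · intro u v hu hv
        simp only [add_mul, map_add, hu, hv, smul_add]; abel
      · intro c u hu
        simp only [smul_mul_assoc, map_smul, hu, smul_add]
        rw [smul_comm c]

theorem xi_mul_comm {n : ℕ} (j : Fin n) {k : ZMod 2} {x : Lam n} (hx : x ∈ lamGr n k) :
    xi j * x = sgn 1 k • (x * xi j) := by
  have h : ∀ x : Lam n, xi j * x = CliffordAlgebra.involute x * xi j := by
    intro x
    induction x using CliffordAlgebra.left_induction with
    | algebraMap r => rw [AlgHom.commutes, Algebra.commutes]
    | add a b ha hb => simp only [mul_add, map_add, add_mul, ha, hb]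
    | ι_mul a v ha =>
      rw [map_mul, CliffordAlgebra.involute_ι, mul_assoc, ← ha, ← mul_assoc, ← mul_assoc, neg_mul]
      congr 1
      have := ExteriorAlgebra.ι_add_mul_swap (R := ℂ) (Pi.single j (1 : ℂ)) v
      exact eq_neg_of_add_eq_zero_left this
  rw [h, involute_of_mem hx, smul_mul_assoc]

theorem xiList_mem {n : ℕ} (l : List (Fin n)) :
    (l.map xi).prod ∈ lamGr n (l.length : ZMod 2) := by
  induction l with
  | nil =>
    simpa using SetLike.GradedOne.one_mem
      (A := CliffordAlgebra.evenOdd (0 : QuadraticForm ℂ (Fin n → ℂ)))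
  | cons j l ih =>
    rw [List.map_cons, List.prod_cons, List.length_cons, Nat.cast_succ, add_comm]
    exact SetLike.mul_mem_graded (CliffordAlgebra.ι_mem_evenOdd_one _ _) ih

theorem xiList_mul_comm {n : ℕ} (l : List (Fin n)) {k : ZMod 2} {x : Lam n}
    (hx : x ∈ lamGr n k) :
    (l.map xi).prod * x = sgn (l.length : ZMod 2) k • (x * (l.map xi).prod) := by
  induction l with
  | nil => simp [sgn_zero_left]
  | cons j l ih =>
    rw [List.map_cons, List.prod_cons, List.length_cons, Nat.cast_succ, sgn_add_left, mul_assoc,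
      ih, mul_smul_comm, ← mul_assoc, xi_mul_comm j hx, smul_mul_assoc, smul_smul, mul_assoc]

theorem mono_mem {m n : ℕ} (α : Fin m →₀ ℕ) (I : Finset (Fin n)) :
    mono α I ∈ aGr m n (I.card : ZMod 2) := by
  have := xiList_mem (I.sort (· ≤ ·))
  rw [Finset.length_sort] at this
  exact tmul_mem_aGr _ this

theorem mono_mul_comm {m n : ℕ} (α : Fin m →₀ ℕ) (I : Finset (Fin n)) {k : ZMod 2} {x : A m n}
    (hx : x ∈ aGr m n k) : mono α I * x = sgn (I.card : ZMod 2) k • (x * mono α I) := by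
  refine aGr_induction (P := fun x => mono α I * x = sgn (I.card : ZMod 2) k • (x * mono α I))
    ?_ ?_ ?_ ?_ hx
  · intro p x hx
    have := xiList_mul_comm (I.sort (· ≤ ·)) hx
    rw [Finset.length_sort] at this
    rw [mono, xiProd, Algebra.TensorProduct.tmul_mul_tmul, Algebra.TensorProduct.tmul_mul_tmul,
      this, TensorProduct.tmul_smul, mul_comm p]
  · simp
  · intro u v hu hv
    rw [mul_add, add_mul, hu, hv, smul_add]
  · intro c u hu
    rw [mul_smul_comm, smul_mul_assoc, hu, smul_comm]

theorem monoPd_mem {m n : ℕ} (α : Fin m →₀ ℕ) (I : Finset (Fin n)) (d : Fin m ⊕ Fin n) :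
    monoPd α I d ∈ wGr m n ((I.card : ZMod 2) + pdPar d) := by
  obtain ⟨h1, h2⟩ := pd_mem d
  refine ⟨fun j x hx => ?_, fun j x hx y => ?_⟩
  · rw [add_assoc]
    exact aGr_mul (mono_mem α I) (h1 j x hx)
  · simp only [monoPd, LinearMap.comp_apply, LinearMap.mulLeft_apply, h2 j x hx y, mul_add,
      mul_smul_comm, sgn_add_left]
    rw [← mul_assoc, ← mul_assoc, mono_mul_comm α I hx, smul_mul_assoc, smul_smul, mul_assoc x,
      mul_comm (sgn _ _)]

theorem wGr_le (m n : ℕ) (i : ZMod 2) : wGr m n i ≤ wTotal m n := by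
  fin_cases i
  · exact le_sup_left
  · exact le_sup_right

/-! ### Lie superalgebras and their modules -/

/-- A way of writing down a Lie superalgebra `𝔤`: it is the subspace `total` of an ambient space
`L`, with even and odd part `gr 0` and `gr 1`, and `br i j x y` is the bracket of `x` of parity `i`
and `y` of parity `j`. It is only used for the two Lie superalgebras `wTilde` and `tAlg` below. -/
structure LieSuperData where
  L : Type
  [acg : AddCommGroup L]
  [mod : Module ℂ L]
  total : Submodule ℂ L
  gr : ZMod 2 → Submodule ℂ L
  br : ZMod 2 → ZMod 2 → L → L → L

attribute [instance] LieSuperData.acg LieSuperData.mod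

/-- The graded part `𝔤_i` and the bracket satisfy `[𝔤_i, 𝔤_j] ⊆ 𝔤_{i+j}`. -/
def LieSuperData.Closed (S : LieSuperData) : Prop :=
  ∀ i j, ∀ x ∈ S.gr i, ∀ y ∈ S.gr j, S.br i j x y ∈ S.gr (i + j)

/-- A (`ℤ/2`-graded) module over a Lie superalgebra. -/
structure SuperModule (S : LieSuperData) where
  carrier : Type u
  [acg : AddCommGroup carrier]
  [mod : Module ℂ carrier]
  /-- the even and the odd part -/
  gr : ZMod 2 → Submodule ℂ carrier
  isInternal : DirectSum.IsInternal gr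
  /-- the action -/
  ρ : S.total →ₗ[ℂ] Module.End ℂ carrier
  ρ_mem : ∀ (i j : ZMod 2) (x : S.total), (x : S.L) ∈ S.gr i → ∀ v ∈ gr j, ρ x v ∈ gr (i + j)
  ρ_br : ∀ (i j : ZMod 2) (x y z : S.total), (x : S.L) ∈ S.gr i → (y : S.L) ∈ S.gr j →
    (z : S.L) = S.br i j x y → ρ z = ρ x * ρ y - sgn i j • (ρ y * ρ x)

attribute [instance] SuperModule.acg SuperModule.mod

/-- A morphism of modules: an even linear map that commutes with the action. -/
@[ext]
structure SuperModule.Hom {S : LieSuperData} (M N : SuperModule.{u} S) where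
  toLin : M.carrier →ₗ[ℂ] N.carrier
  map_gr : ∀ i, ∀ v ∈ M.gr i, toLin v ∈ N.gr i
  map_ρ : ∀ x v, toLin (M.ρ x v) = N.ρ x (toLin v)

instance (S : LieSuperData) : CategoryTheory.Category (SuperModule.{u} S) where
  Hom M N := SuperModule.Hom M N
  id M := ⟨LinearMap.id, fun _ _ h => h, fun _ _ => rfl⟩
  comp f g := ⟨g.toLin ∘ₗ f.toLin, fun i v h => g.map_gr i _ (f.map_gr i v h), fun x v => by
    simp [f.map_ρ, g.map_ρ]⟩

/-! ### The extended Witt superalgebra and `AW`-modules -/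

/-- `W̃ = W ⋉ A`: pairs `(D, a)` with `D ∈ W`, `a ∈ A`, where
`[(D, a), (E, b)] = ([D, E], D(b) - (-1)^{|a||E|} E(a))` and
`[D, E] = D E - (-1)^{|D||E|} E D`. -/
abbrev wTilde (m n : ℕ) : LieSuperData where
  L := Module.End ℂ (A m n) × A m n
  total := (wTotal m n).prod ⊤
  gr i := (wGr m n i).prod (aGr m n i)
  br i j x y := (x.1 * y.1 - sgn i j • (y.1 * x.1), x.1 y.2 - sgn i j • y.1 x.2)

/-- The inclusion `W → W̃`. -/
def inW {m n : ℕ} : wTotal m n →ₗ[ℂ] (wTilde m n).total where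
  toFun D := ⟨((D : Module.End ℂ (A m n)), (0 : A m n)), ⟨D.2, trivial⟩⟩
  map_add' _ _ := Subtype.ext (Prod.ext rfl (add_zero _).symm)
  map_smul' _ _ := Subtype.ext (Prod.ext rfl (smul_zero _).symm)

/-- The inclusion `A → W̃`. -/
def inA {m n : ℕ} : A m n →ₗ[ℂ] (wTilde m n).total where
  toFun a := ⟨((0 : Module.End ℂ (A m n)), a), ⟨Submodule.zero_mem _, trivial⟩⟩
  map_add' _ _ := Subtype.ext (Prod.ext (add_zero _).symm rfl)
  map_smul' _ _ := Subtype.ext (Prod.ext (smul_zero _).symm rfl)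

/-- A `W̃`-module is an `AW`-module if `A` acts on it as an associative unital algebra. -/
def IsAW {m n : ℕ} (M : SuperModule.{u} (wTilde m n)) : Prop :=
  M.ρ (inA 1) = 1 ∧ ∀ a b, M.ρ (inA (a * b)) = M.ρ (inA a) * M.ρ (inA b)

/-- The element `t^α ξ_I ∂` of `W`. -/
def wMono {m n : ℕ} (α : Fin m →₀ ℕ) (I : Finset (Fin n)) (d : Fin m ⊕ Fin n) : wTotal m n :=
  ⟨monoPd α I d, wGr_le m n _ (monoPd_mem α I d)⟩

/-- The element `∂` of `W`, for a partial derivative `∂`. -/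
def wPd {m n : ℕ} (d : Fin m ⊕ Fin n) : wTotal m n := ⟨pd d, wGr_le m n _ (pd_mem d)⟩

/-! ### The algebra `Ū` and the Lie superalgebra `T` -/

/-- The relations that present `Ū = U(W̃)/J` as a quotient of the tensor algebra of `W̃`: those of
the enveloping superalgebra `U(W̃)`, and those that identify the product of elements of `A` in
`U(W̃)` with their product in `A`. -/
inductive UbarRel (m n : ℕ) :
    TensorAlgebra ℂ (wTilde m n).total → TensorAlgebra ℂ (wTilde m n).total → Prop
  | lie (i j : ZMod 2) (x y z : (wTilde m n).total)
      (hx : (x : (wTilde m n).L) ∈ (wTilde m n).gr i)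
      (hy : (y : (wTilde m n).L) ∈ (wTilde m n).gr j)
      (hz : (z : (wTilde m n).L) = (wTilde m n).br i j x y) :
      UbarRel m n (TensorAlgebra.ι ℂ z)
        (TensorAlgebra.ι ℂ x * TensorAlgebra.ι ℂ y -
          sgn i j • (TensorAlgebra.ι ℂ y * TensorAlgebra.ι ℂ x))
  | one : UbarRel m n (TensorAlgebra.ι ℂ (inA 1)) 1
  | mul (a b : A m n) : UbarRel m n (TensorAlgebra.ι ℂ (inA (a * b)))
      (TensorAlgebra.ι ℂ (inA a) * TensorAlgebra.ι ℂ (inA b))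

/-- The associative algebra `Ū = U(W̃)/J`. -/
abbrev Ubar (m n : ℕ) : Type := RingQuot (UbarRel m n)

/-- The canonical map `W̃ → Ū`. -/
def toUbar {m n : ℕ} : (wTilde m n).total →ₗ[ℂ] Ubar m n :=
  (RingQuot.mkAlgHom ℂ (UbarRel m n)).toLinearMap ∘ₗ TensorAlgebra.ι ℂ

/-- The action of `Ū` on an `AW`-module. -/
def ubarAct {m n : ℕ} (M : SuperModule.{u} (wTilde m n)) (hM : IsAW M) :
    Ubar m n →ₐ[ℂ] Module.End ℂ M.carrier :=
  RingQuot.liftAlgHom ℂ ⟨TensorAlgebra.lift ℂ M.ρ, by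
    intro x y h
    induction h with
    | lie i j x y z hx hy hz => simpa using M.ρ_br i j x y z hx hy hz
    | one => simpa using hM.1
    | mul a b => simpa using hM.2 a b⟩

/-- `τ(J, K)`, the number of inversions between `J` and `K`, so that
`ξ_J ξ_K = (-1)^{τ(J,K)} ξ_{J ∪ K}` for disjoint `J`, `K`. -/
def tau {n : ℕ} (J K : Finset (Fin n)) : ℕ := ((J ×ˢ K).filter fun p => p.2 < p.1).card

/-- The element `X_{α,I,∂}` of `AW ⊆ Ū`. -/
def X {m n : ℕ} (α : Fin m →₀ ℕ) (I : Finset (Fin n)) (d : Fin m ⊕ Fin n) : Ubar m n :=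
  ∑ β ∈ Finset.Iic α, ∑ J ∈ I.powerset,
    ((-1 : ℂ) ^ ((∑ k, β k) + J.card + tau J (I \ J)) * ((∏ k, (α k).choose (β k) : ℕ) : ℂ)) •
      (toUbar (inA (mono β J)) * toUbar (inW (wMono (α - β) (I \ J) d)))

/-- The Lie superalgebra `T`, spanned by the `X_{α,I,∂}` with `|α| + |I| > 0` (where `X_{α,I,∂}` has
the parity of `ξ_I ∂`), with the supercommutator of `Ū`. -/
abbrev tAlg (m n : ℕ) : LieSuperData where
  L := Ubar m n
  total := Submodule.span ℂ {x | ∃ (α : Fin m →₀ ℕ) (I : Finset (Fin n)) (d : Fin m ⊕ Fin n),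
    (α ≠ 0 ∨ I ≠ ∅) ∧ x = X α I d}
  gr i := Submodule.span ℂ {x | ∃ (α : Fin m →₀ ℕ) (I : Finset (Fin n)) (d : Fin m ⊕ Fin n),
    (α ≠ 0 ∨ I ≠ ∅) ∧ (I.card : ZMod 2) + pdPar d = i ∧ x = X α I d}
  br i j x y := x * y - sgn i j • (y * x)

/-- The inclusion `T → Ū`. -/
def tVal {m n : ℕ} (x : (tAlg m n).total) : Ubar m n := x.1

/-- The category of finite-dimensional `T`-modules. -/
abbrev TMod (m n : ℕ) : Type (u + 1) :=
  CategoryTheory.ObjectProperty.FullSubcategory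
    (fun V : SuperModule.{u} (tAlg m n) => FiniteDimensional ℂ V.carrier)

/-! ### Whittaker modules -/

/-- The element `∑_d c_d ∂_d` of `△ = span {∂/∂t_i, ∂/∂ξ_j}`, in `W̃`. -/
def delta {m n : ℕ} (c : Fin m ⊕ Fin n → ℂ) : (wTilde m n).total := ∑ d, c d • inW (wPd d)

/-- The value at `∑_d c_d ∂_d` of the homomorphism `φ_a : △ → ℂ` with `∂/∂t_i ↦ a_i` and
`∂/∂ξ_j ↦ 0`. -/
def phi {m n : ℕ} (a : Fin m → ℂ) (c : Fin m ⊕ Fin n → ℂ) : ℂ := ∑ i, c (Sum.inl i) * a i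

/-- `M` is a Whittaker module: `△` acts locally finitely. -/
def IsWhittaker {m n : ℕ} (M : SuperModule.{u} (wTilde m n)) : Prop :=
  ∀ v : M.carrier, ∃ N : Submodule ℂ M.carrier, FiniteDimensional ℂ N ∧ v ∈ N ∧
    ∀ c, ∀ w ∈ N, M.ρ (delta c) w ∈ N

/-- `M` is of type `a`: for each `v` there is `k` with `(x - φ_a(x))^k v = 0` for all `x ∈ △`. -/
def IsOfType {m n : ℕ} (a : Fin m → ℂ) (M : SuperModule.{u} (wTilde m n)) : Prop :=
  ∀ v : M.carrier, ∃ k : ℕ, ∀ c, ((M.ρ (delta c) - phi a c • 1) ^ k) v = 0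

/-- The space `Wh_a(M)` of Whittaker vectors. -/
def Wh {m n : ℕ} (a : Fin m → ℂ) (M : SuperModule.{u} (wTilde m n)) : Submodule ℂ M.carrier :=
  ⨅ c, LinearMap.ker (M.ρ (delta c) - phi a c • 1)

/-- Membership in `Ω_a`: Whittaker `AW`-modules of type `a` with finite-dimensional space of
Whittaker vectors. -/
structure IsOmega {m n : ℕ} (a : Fin m → ℂ) (M : SuperModule.{u} (wTilde m n)) : Prop where
  isAW : IsAW M
  isWhittaker : IsWhittaker M
  isOfType : IsOfType a M
  finite : FiniteDimensional ℂ (Wh a M)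

/-- The category `Ω_a`. -/
abbrev Omega (m n : ℕ) (a : Fin m → ℂ) : Type (u + 1) :=
  CategoryTheory.ObjectProperty.FullSubcategory
    (fun M : SuperModule.{u} (wTilde m n) => IsOmega a M)

/-! ### The modules `T(A^a, V)` -/

/-- The action of `∂_d` on the module `A^a` over the Weyl superalgebra, that is, on `A` twisted by
the automorphism with `∂/∂t_i ↦ ∂/∂t_i + a_i` that fixes all `t_i`, `ξ_j`, `∂/∂ξ_j`. -/
def twistedPd {m n : ℕ} (a : Fin m → ℂ) (d : Fin m ⊕ Fin n) : Module.End ℂ (A m n) :=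
  pd d + (Sum.elim a 0 d) • 1

/-- `M` is the `AW`-module `T(A^a, V)`, through the identification `e` of its underlying space with
`A ⊗ V`: it is graded as the tensor product of `A` and `V`, the Weyl superalgebra (generated by `A`
and the `∂_d`) acts on the first factor as on `A^a`, and `T ⊆ Ū` acts on the second factor as on
`V`, with the Koszul sign. As `Ū` is generated by `A`, the `∂_d` and `T`, this determines the
action of `Ū`. -/
structure IsTensorModule {m n : ℕ} (a : Fin m → ℂ) (V : SuperModule.{u} (tAlg m n))
    (M : SuperModule.{u} (wTilde m n)) (hM : IsAW M) (e : A m n ⊗[ℂ] V.carrier ≃ₗ[ℂ] M.carrier) :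
    Prop where
  gr_mem : ∀ i j, ∀ p ∈ aGr m n i, ∀ v ∈ V.gr j, e (p ⊗ₜ v) ∈ M.gr (i + j)
  act_A : ∀ b p v, M.ρ (inA b) (e (p ⊗ₜ v)) = e ((b * p) ⊗ₜ v)
  act_pd : ∀ d p v, M.ρ (inW (wPd d)) (e (p ⊗ₜ v)) = e (twistedPd a d p ⊗ₜ v)
  act_T : ∀ i j, ∀ x : (tAlg m n).total, tVal x ∈ (tAlg m n).gr i → ∀ p ∈ aGr m n j, ∀ v,
    ubarAct M hM (tVal x) (e (p ⊗ₜ v)) = sgn i j • e (p ⊗ₜ V.ρ x v)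

end

end SuperWitt

open scoped TensorProduct

namespace SuperWitt

noncomputable section

variable {m n : ℕ}

/-! ### Signs -/

/-! Let `K` be the Weyl superalgebra generated by `A` and the partial derivatives. The point is that
`T` supercommutes with `K` inside `Ū` and that `K` and `T` together generate `Ū`, so that `Ū`
behaves like `K ⊗ U(T)`. A module in `Ω_a` is, over `K`, a sum of copies of `A^a`, with multiplicity
space `Wh_a(M)`; what remains of the action is an action of `T` on `Wh_a(M)`. Thus `V ↦ A^a ⊗ V` and
`M ↦ Wh_a(M)` are inverse to each other.

Commutation. The coefficients of `X_{α,I,∂}` expand a product of factors `1 ⊗ x_d - x_d ⊗ 1` in the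
super tensor square of `A` (`zX`, `X_eq_bU`). Each factor is killed by multiplication `A ⊗ A → A`
and by the diagonal action of the partial derivatives. The first fact makes `X_{α,I,∂}` supercommute
with `A` as soon as there is a factor, the second makes it supercommute with every `∂_d`
(`tAlg_mul_iA`, `dU_mul_tAlg`).

Structure of `Ū`. The formula for `X_{α,I,∂}` is triangular in the degree of `t^α ξ_I`, so the image
of `W̃` lies in the `A`-span of `1`, the `∂_d` and `T` (`toUbar_mem_aSpan`). No PBW theorem is used:
freeness of this span over `A` follows from the supercommutators with the `∂_d`, which differentiate
the coefficients (`actMap_injective`), together with the action of `Ū` on `A`, in which `T` acts by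
zero while `1` and the `∂_d` stay independent (`eq_zero_of_mem_aTotal`). Closure of `T` is a
consequence: a bracket of elements of `T` lies in the `A`-span, supercommutes with all `∂_d`, hence
has constant coefficients, and acts by zero on `A` (`tAlg_closed`).

Construction of modules. Operators satisfying the relations of `K` and `T` and the supercommutation
between them extend to `Ū` (`UbarRep.exists_hom`). The homomorphism is found as a graph: the
`A`-span of the pairs (generator, operator) in `Ū × B` projects injectively to `Ū`. This gives the
action on `A ⊗ V`.

Equivalence. An element of `A ⊗ V` killed by all partial derivatives is `1 ⊗ v` (`exists_one_tmul`),
by diagonalizing the Euler operator. Hence `Wh_a(A^a ⊗ V) = 1 ⊗ V`, which gives full faithfulness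
(`exists_lTensor_eq`). For `M` in `Ω_a` the map `A ⊗ Wh_a(M) → M` is injective by induction on the
degree, and surjective because the operators `∂_d - φ_a(∂_d)` are locally nilpotent, so the
variables can be split off one at a time (`mem_span_of_locally_nilpotent`, `whMap_bijective`). -/

theorem sgn_comm (i j : ZMod 2) : sgn i j = sgn j i := by rw [sgn, sgn, mul_comm]

theorem sgn_add_right (i j k : ZMod 2) : sgn i (j + k) = sgn i j * sgn i k := by
  rw [sgn_comm, sgn_add_left, sgn_comm j, sgn_comm k]

theorem sgn_zero_right (j : ZMod 2) : sgn j 0 = 1 := by rw [sgn_comm, sgn_zero_left]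

theorem sgn_one_one : sgn 1 1 = -1 := by simp [sgn, ZMod.val_one]

theorem sgn_mul_self (i j : ZMod 2) : sgn i j * sgn i j = 1 := by
  rw [← sgn_add_left, CharTwo.add_self_eq_zero, sgn_zero_left]

theorem parity_cases (i : ZMod 2) : i = 0 ∨ i = 1 := by
  revert i; decide

theorem sgn_smul_smul {N : Type*} [AddCommMonoid N] [Module ℂ N] (i j : ZMod 2) (v : N) :
    sgn i j • sgn i j • v = v := by
  rw [smul_smul, sgn_mul_self, one_smul]

theorem eq_zero_of_eq_neg {N : Type*} [AddCommGroup N] [Module ℂ N] {v : N} (h : v = -v) :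
    v = 0 := by
  have : (2 : ℂ) • v = 0 := by
    rw [two_smul]; nth_rewrite 1 [h]; simp
  simpa using this

/-! ### Homogeneous elements and generators of `A` -/


theorem exists_add_homogeneous (p : A m n) :
    ∃ p₀ ∈ aGr m n 0, ∃ p₁ ∈ aGr m n 1, p = p₀ + p₁ := by
  induction p using TensorProduct.induction_on with
  | zero => exact ⟨0, Submodule.zero_mem _, 0, Submodule.zero_mem _, by simp⟩
  | tmul p x =>
    have h := (CliffordAlgebra.evenOdd_isCompl (0 : QuadraticForm ℂ (Fin n → ℂ))).sup_eq_top
    obtain ⟨y, hy, z, hz, rfl⟩ := Submodule.mem_sup.1 (h ▸ Submodule.mem_top (x := x))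
    exact ⟨_, tmul_mem_aGr p hy, _, tmul_mem_aGr p hz, TensorProduct.tmul_add _ _ _⟩
  | add p q hp hq =>
    obtain ⟨p₀, h₀, p₁, h₁, rfl⟩ := hp
    obtain ⟨q₀, h₂, q₁, h₃, rfl⟩ := hq
    exact ⟨_, Submodule.add_mem _ h₀ h₂, _, Submodule.add_mem _ h₁ h₃, by abel⟩

theorem homogeneous_induction {P : A m n → Prop} (h : ∀ i, ∀ p ∈ aGr m n i, P p)
    (ha : ∀ p q, P p → P q → P (p + q)) (p : A m n) : P p := by
  obtain ⟨p₀, h₀, p₁, h₁, rfl⟩ := exists_add_homogeneous p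
  exact ha _ _ (h _ _ h₀) (h _ _ h₁)

/-- The automorphism of `A` that multiplies elements of parity `j` by `sgn i j`. -/
def sigma (i : ZMod 2) : A m n →ₐ[ℂ] A m n :=
  if i = 0 then AlgHom.id ℂ _ else
    Algebra.TensorProduct.map (AlgHom.id ℂ _) CliffordAlgebra.involute

theorem sigma_apply {i j : ZMod 2} {p : A m n} (hp : p ∈ aGr m n j) :
    sigma i p = sgn i j • p := by
  rcases parity_cases i with rfl | rfl
  · simp [sigma, sgn_zero_left]
  · refine aGr_induction (P := fun p => sigma 1 p = sgn 1 j • p) ?_ ?_ ?_ ?_ hp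
    · intro p x hx
      simp [sigma, involute_of_mem hx]
    · simp
    · intro p q hp hq
      rw [map_add, hp, hq, smul_add]
    · intro c p hp
      rw [map_smul, hp, smul_comm]

theorem sigma_zero : sigma (m := m) (n := n) 0 = AlgHom.id ℂ _ := by simp [sigma]

theorem sigma_sigma (i : ZMod 2) (p : A m n) : sigma i (sigma i p) = p := by
  induction p using homogeneous_induction with | h j p hp => ?_ | ha p q hp hq => ?_
  · rw [sigma_apply hp, map_smul, sigma_apply hp, sgn_smul_smul]
  · rw [map_add, map_add, hp, hq]

theorem sigma_add (i j : ZMod 2) (p : A m n) : sigma (i + j) p = sigma i (sigma j p) := by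
  induction p using homogeneous_induction with | h k p hp => ?_ | ha p q hp hq => ?_
  · rw [sigma_apply hp, sigma_apply hp, map_smul, sigma_apply hp, smul_smul, sgn_add_left,
      mul_comm]
  · rw [map_add, map_add, map_add, hp, hq]

theorem mem_aGr_iff {j : ZMod 2} {p : A m n} : p ∈ aGr m n j ↔ sigma 1 p = sgn 1 j • p := by
  refine ⟨sigma_apply, fun h => ?_⟩
  obtain ⟨p₀, h₀, p₁, h₁, rfl⟩ := exists_add_homogeneous p
  rw [map_add, sigma_apply h₀, sigma_apply h₁, sgn_zero_right, sgn_one_one] at h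
  rcases parity_cases j with rfl | rfl
  · have : p₁ = 0 := by
      rw [sgn_zero_right, one_smul, one_smul] at h
      have h' := add_left_cancel h
      exact eq_zero_of_eq_neg (by
        rw [show -p₁ = (-1 : ℂ) • p₁ by module, h'])
    rwa [this, add_zero]
  · have : p₀ = 0 := by
      rw [sgn_one_one, one_smul, smul_add] at h
      have h' := add_right_cancel h
      exact eq_zero_of_eq_neg (by simpa using h')
    rwa [this, zero_add]

theorem one_mem_aGr : (1 : A m n) ∈ aGr m n 0 :=
  mem_aGr_iff.2 (by rw [map_one, sgn_zero_right, one_smul])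

/-- The generators `t_i`, `ξ_j` of `A`. -/
def gen : Fin m ⊕ Fin n → A m n
  | Sum.inl i => MvPolynomial.X i ⊗ₜ 1
  | Sum.inr j => 1 ⊗ₜ xi j

theorem gen_mem (d : Fin m ⊕ Fin n) : gen d ∈ aGr m n (pdPar d) := by
  rcases d with i | j
  · refine tmul_mem_aGr _ ?_
    exact SetLike.GradedOne.one_mem
      (A := CliffordAlgebra.evenOdd (0 : QuadraticForm ℂ (Fin n → ℂ)))
  · exact tmul_mem_aGr _ (CliffordAlgebra.ι_mem_evenOdd_one _ _)

theorem ι_eq_sum (v : Fin n → ℂ) : ExteriorAlgebra.ι ℂ v = ∑ j, v j • xi j := by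
  conv_lhs => rw [← Finset.univ_sum_single v]
  rw [map_sum]
  refine Finset.sum_congr rfl fun j _ => ?_
  rw [xi, ← map_smul]
  congr 1
  rw [← Pi.single_smul, smul_eq_mul, mul_one]

theorem lam_induction {P : Lam n → Prop} (h1 : ∀ r : ℂ, P (algebraMap ℂ _ r))
    (ha : ∀ x y, P x → P y → P (x + y)) (hs : ∀ (c : ℂ) x, P x → P (c • x))
    (hm : ∀ j x, P x → P (xi j * x)) (x : Lam n) : P x := by
  induction x using CliffordAlgebra.left_induction with
  | algebraMap r => exact h1 r
  | add x y hx hy => exact ha _ _ hx hy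
  | ι_mul x v hx =>
    have : CliffordAlgebra.ι (0 : QuadraticForm ℂ (Fin n → ℂ)) v = ∑ j, v j • xi j := ι_eq_sum v
    rw [this, Finset.sum_mul]
    have h0 : P 0 := by simpa using h1 0
    refine Finset.sum_induction _ P ha h0 fun j _ => ?_
    rw [smul_mul_assoc]
    exact hs _ _ (hm _ _ hx)

theorem adjoin_gen : Algebra.adjoin ℂ (Set.range (gen (m := m) (n := n))) = ⊤ := by
  rw [eq_top_iff]
  rintro p -
  set S := Algebra.adjoin ℂ (Set.range (gen (m := m) (n := n))) with hS
  have hg : ∀ d, gen d ∈ S := fun d => Algebra.subset_adjoin ⟨d, rfl⟩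
  have h1 : ∀ q : MvPolynomial (Fin m) ℂ, q ⊗ₜ[ℂ] (1 : Lam n) ∈ S := by
    intro q
    induction q using MvPolynomial.induction_on with
    | C a => exact S.algebraMap_mem a
    | add q r hq hr => rw [TensorProduct.add_tmul]; exact S.add_mem hq hr
    | mul_X q i hq =>
      have := S.mul_mem hq (hg (Sum.inl i))
      simpa [gen] using this
  have h2 : ∀ x : Lam n, (1 : MvPolynomial (Fin m) ℂ) ⊗ₜ[ℂ] x ∈ S := by
    intro x
    induction x using lam_induction with
    | h1 r =>
      have := S.algebraMap_mem r
      rwa [← Algebra.TensorProduct.includeRight.commutes r] at this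
    | ha x y hx hy => rw [TensorProduct.tmul_add]; exact S.add_mem hx hy
    | hs c x hx => rw [TensorProduct.tmul_smul]; exact S.smul_mem hx c
    | hm j x hx =>
      have := S.mul_mem (hg (Sum.inr j)) hx
      simpa [gen] using this
  induction p using TensorProduct.induction_on with
  | zero => exact S.zero_mem
  | add p q hp hq => exact S.add_mem hp hq
  | tmul q x => simpa using S.mul_mem (h1 q) (h2 x)

theorem gen_induction {P : A m n → Prop} (h1 : ∀ c : ℂ, P (algebraMap ℂ _ c))
    (hg : ∀ d, P (gen d)) (ha : ∀ p q, P p → P q → P (p + q))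
    (hm : ∀ p q, P p → P q → P (p * q)) (p : A m n) : P p := by
  have hp : p ∈ Algebra.adjoin ℂ (Set.range (gen (m := m) (n := n))) :=
    adjoin_gen ▸ Algebra.mem_top
  refine Algebra.adjoin_induction (p := fun p _ => P p) ?_ h1 (fun p q _ _ => ha p q)
    (fun p q _ _ => hm p q) hp
  rintro _ ⟨d, rfl⟩
  exact hg d

theorem gen_mul (d : Fin m ⊕ Fin n) (p : A m n) : gen d * p = sigma (pdPar d) p * gen d := by
  induction p using homogeneous_induction with | h k p hp => ?_ | ha p q hp hq => ?_
  · rw [sigma_apply hp]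
    refine aGr_induction (P := fun p => gen d * p = (sgn (pdPar d) k • p) * gen d) ?_ ?_ ?_ ?_ hp
    · intro q x hx
      rcases d with i | j
      · simp [gen, pdPar, sgn_zero_left, mul_comm]
      · simp [gen, pdPar, xi_mul_comm j hx, TensorProduct.smul_tmul']
    · simp
    · intro p q hp hq
      rw [mul_add, hp, hq, smul_add, add_mul]
    · intro c p hp
      simp only [smul_mul_assoc, mul_smul_comm] at hp ⊢
      rw [hp, smul_comm]
  · rw [mul_add, hp, hq, map_add, add_mul]

/-- Since `sigma k` is an algebra homomorphism, supercommutativity has to be checked only when `p`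
is a generator. -/
theorem mul_homogeneous {k : ZMod 2} {q : A m n} (hq : q ∈ aGr m n k) (p : A m n) :
    p * q = q * sigma k p := by
  induction p using gen_induction with
  | h1 c => rw [AlgHom.commutes, Algebra.commutes]
  | hg d =>
    rw [gen_mul, sigma_apply hq, sigma_apply (gen_mem d), sgn_comm, smul_mul_assoc, mul_smul_comm]
  | ha p q hp hq => rw [add_mul, map_add, mul_add, hp, hq]
  | hm p p' hp hp' => rw [mul_assoc, hp', ← mul_assoc, hp, map_mul, mul_assoc]

theorem aGr_mul_comm {i j : ZMod 2} {p q : A m n} (hp : p ∈ aGr m n i) (hq : q ∈ aGr m n j) :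
    p * q = sgn i j • (q * p) := by
  rw [mul_homogeneous hq, sigma_apply hp, mul_smul_comm, sgn_comm]

/-! ### Superderivations -/

theorem wGr_map_one {i : ZMod 2} {D : Module.End ℂ (A m n)} (hD : D ∈ wGr m n i) : D 1 = 0 := by
  have := hD.2 0 1 one_mem_aGr 1
  rw [mul_one, mul_one, one_mul, sgn_zero_right, one_smul] at this
  exact left_eq_add.1 this

theorem wGr_mul {i : ZMod 2} {D : Module.End ℂ (A m n)} (hD : D ∈ wGr m n i) (p q : A m n) :
    D (p * q) = D p * q + sigma i p * D q := by
  induction p using homogeneous_induction with | h j p hp => ?_ | ha p p' hp hp' => ?_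
  · rw [hD.2 j p hp q, sigma_apply hp, smul_mul_assoc]
  · rw [add_mul, map_add, hp, hp', map_add, map_add, add_mul, add_mul]; abel

/-- The super Leibniz rule propagates agreement from generators to products, and superderivations
vanish on constants. -/
theorem wGr_ext {i : ZMod 2} {D E : Module.End ℂ (A m n)} (hD : D ∈ wGr m n i)
    (hE : E ∈ wGr m n i) (h : ∀ d, D (gen d) = E (gen d)) : D = E := by
  refine LinearMap.ext fun p => ?_
  induction p using gen_induction with
  | h1 c => rw [Algebra.algebraMap_eq_smul_one, map_smul, map_smul, wGr_map_one hD, wGr_map_one hE]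
  | hg d => exact h d
  | ha p q hp hq => rw [map_add, map_add, hp, hq]
  | hm p q hp hq => rw [wGr_mul hD, wGr_mul hE, hp, hq]

theorem sigma_wGr {i j : ZMod 2} {D : Module.End ℂ (A m n)} (hD : D ∈ wGr m n i) (p : A m n) :
    sigma j (D p) = sgn j i • D (sigma j p) := by
  induction p using homogeneous_induction with | h k p hp => ?_ | ha p q hp hq => ?_
  · rw [sigma_apply hp, sigma_apply (hD.1 k p hp), map_smul, smul_smul, sgn_add_right]
  · simp only [map_add, hp, hq, smul_add]

theorem wGr_bracket {i j : ZMod 2} {D E : Module.End ℂ (A m n)} (hD : D ∈ wGr m n i)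
    (hE : E ∈ wGr m n j) : D * E - sgn i j • (E * D) ∈ wGr m n (i + j) := by
  refine ⟨fun k p hp => ?_, fun k p hp q => ?_⟩
  · refine Submodule.sub_mem _ ?_ (Submodule.smul_mem _ _ ?_)
    · rw [add_assoc]; exact hD.1 _ _ (hE.1 _ _ hp)
    · rw [add_comm i, add_assoc]; exact hE.1 _ _ (hD.1 _ _ hp)
  · have e1 : D (p * q) = D p * q + sgn i k • (p * D q) := hD.2 k p hp q
    have e2 : E (p * q) = E p * q + sgn j k • (p * E q) := hE.2 k p hp q
    have e3 := hD.2 _ _ (hE.1 k p hp) q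
    have e4 := hE.2 _ _ (hD.1 k p hp) q
    have e5 := hD.2 k p hp (E q)
    have e6 := hE.2 k p hp (D q)
    simp only [LinearMap.sub_apply, Module.End.mul_apply, LinearMap.smul_apply, e1, e2, map_add,
      map_smul, e3, e4, e5, e6, smul_add, smul_smul, sgn_add_right, sgn_add_left, sub_mul, mul_sub,
      smul_sub, smul_mul_assoc, mul_smul_comm]
    rw [sgn_comm j i]
    have h : sgn i j * (sgn i j * sgn j k) = sgn j k := by
      rw [← mul_assoc, sgn_mul_self, one_mul]
    rw [h]
    module

/-! ### The partial derivatives -/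

theorem pd_gen (d d' : Fin m ⊕ Fin n) : pd d (gen d') = if d = d' then 1 else 0 := by
  rcases d with i | i <;> rcases d' with j | j
  · rw [pd, gen, TensorProduct.map_tmul, LinearMap.id_apply, Derivation.coeFn_coe,
      MvPolynomial.pderiv_X]
    by_cases h : i = j
    · subst h; simp [Algebra.TensorProduct.one_def]
    · simp [h, Ne.symm h]
  · simp [pd, gen]
  · rw [pd, gen, TensorProduct.map_tmul, ← map_one (algebraMap ℂ (Lam n))]
    rw [CliffordAlgebra.contractLeft_algebraMap]
    simp
  · rw [pd, gen, TensorProduct.map_tmul, LinearMap.id_apply, xi]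
    erw [CliffordAlgebra.contractLeft_ι]
    by_cases h : i = j
    · subst h; simp [Algebra.TensorProduct.one_def]
    · simp [h]

theorem pd_one (d : Fin m ⊕ Fin n) : pd d 1 = 0 := wGr_map_one (pd_mem d)

theorem pd_algebraMap (d : Fin m ⊕ Fin n) (c : ℂ) : pd d (algebraMap ℂ _ c) = 0 := by
  rw [Algebra.algebraMap_eq_smul_one, map_smul, pd_one, smul_zero]

theorem pd_mul (d : Fin m ⊕ Fin n) (p q : A m n) :
    pd d (p * q) = pd d p * q + sigma (pdPar d) p * pd d q := wGr_mul (pd_mem d) p q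

/-- The supercommutator is again a superderivation, and it kills the generators because their first
derivatives are constants. -/
theorem pd_pd (d e : Fin m ⊕ Fin n) (p : A m n) :
    pd d (pd e p) = sgn (pdPar d) (pdPar e) • pd e (pd d p) := by
  have h : pd d * pd e - sgn (pdPar d) (pdPar e) • (pd e * pd d) = (0 : Module.End ℂ (A m n)) := by
    refine wGr_ext (wGr_bracket (pd_mem d) (pd_mem e)) (Submodule.zero_mem _) fun c => ?_
    have hz : ∀ d e c : Fin m ⊕ Fin n, pd d (pd e (gen c)) = (0 : A m n) := by
      intro d e c
      rw [pd_gen]; split_ifs <;> simp [pd_one]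
    simp [hz]
  have h' := LinearMap.congr_fun h p
  simp only [LinearMap.sub_apply, Module.End.mul_apply, LinearMap.smul_apply,
    LinearMap.zero_apply] at h'
  exact sub_eq_zero.1 h'

theorem sigma_pd (i : ZMod 2) (d : Fin m ⊕ Fin n) (p : A m n) :
    sigma i (pd d p) = sgn i (pdPar d) • pd d (sigma i p) := sigma_wGr (pd_mem d) p

/-! ### The augmentation -/

/-- Evaluation at the origin. -/
def aug : A m n →ₐ[ℂ] ℂ :=
  Algebra.TensorProduct.lift (MvPolynomial.aeval 0) ExteriorAlgebra.algebraMapInv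
    fun _ _ => Commute.all _ _

/-! ### The filtration of `A` by degree -/

/-- The subspace spanned by `1` and the generators. -/
def degOne (m n : ℕ) : Submodule ℂ (A m n) := Submodule.span ℂ (insert 1 (Set.range gen))

/-- The elements of `A` of degree at most `k`. -/
def degLE (m n k : ℕ) : Submodule ℂ (A m n) := degOne m n ^ k

theorem one_le_degOne : 1 ≤ degOne m n := by
  rw [Submodule.one_le]; exact Submodule.subset_span (Set.mem_insert _ _)

theorem degLE_zero : degLE m n 0 = 1 := pow_zero (degOne m n)

theorem degLE_one : degLE m n 1 = degOne m n := pow_one (degOne m n)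

theorem degLE_add (k l : ℕ) : degLE m n (k + l) = degLE m n k * degLE m n l :=
  pow_add (degOne m n) k l

theorem degLE_succ (k : ℕ) : degLE m n (k + 1) = degOne m n * degLE m n k :=
  pow_succ' (degOne m n) k

theorem degLE_mono {k l : ℕ} (h : k ≤ l) : degLE m n k ≤ degLE m n l := by
  induction h with
  | refl => exact le_rfl
  | step _ ih =>
    refine ih.trans fun p hp => ?_
    rw [degLE_succ, ← one_mul p]
    exact Submodule.mul_mem_mul (Submodule.one_le.1 one_le_degOne) hp

theorem degLE_fg (k : ℕ) : (degLE m n k).FG :=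
  Submodule.FG.pow (Submodule.fg_span ((Set.finite_range _).insert _)) k

theorem exists_mem_degLE (p : A m n) : ∃ k, p ∈ degLE m n k := by
  induction p using gen_induction with
  | h1 c => exact ⟨0, by rw [degLE_zero]; exact Submodule.mem_one.2 ⟨c, rfl⟩⟩
  | hg d => exact ⟨1, by rw [degLE_one]; exact Submodule.subset_span (Or.inr ⟨d, rfl⟩)⟩
  | ha p q hp hq =>
    obtain ⟨k, hk⟩ := hp
    obtain ⟨l, hl⟩ := hq
    exact ⟨max k l, Submodule.add_mem _ (degLE_mono (le_max_left k l) hk)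
      (degLE_mono (le_max_right k l) hl)⟩
  | hm p q hp hq =>
    obtain ⟨k, hk⟩ := hp
    obtain ⟨l, hl⟩ := hq
    exact ⟨k + l, by rw [degLE_add]; exact Submodule.mul_mem_mul hk hl⟩

theorem pd_degLE_zero (d : Fin m ⊕ Fin n) {p : A m n} (hp : p ∈ degLE m n 0) : pd d p = 0 := by
  rw [degLE_zero] at hp
  obtain ⟨c, rfl⟩ := Submodule.mem_one.1 hp
  exact pd_algebraMap d c

theorem pd_degLE_succ (d : Fin m ⊕ Fin n) (k : ℕ) : ∀ {p : A m n}, p ∈ degLE m n (k + 1) →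
    pd d p ∈ degLE m n k := by
  have h1 : ∀ x ∈ degOne m n, ∃ c : ℂ, pd d x = algebraMap ℂ _ c := by
    intro x hx
    induction hx using Submodule.span_induction with
    | mem x hx =>
      rcases hx with rfl | ⟨e, rfl⟩
      · exact ⟨0, by rw [pd_one, map_zero]⟩
      · rw [pd_gen]
        split_ifs
        · exact ⟨1, (map_one _).symm⟩
        · exact ⟨0, (map_zero _).symm⟩
    | zero => exact ⟨0, by rw [map_zero, map_zero]⟩
    | add x y _ _ hx hy =>
      obtain ⟨a, ha⟩ := hx
      obtain ⟨b, hb⟩ := hy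
      exact ⟨a + b, by rw [map_add, map_add, ha, hb]⟩
    | smul c x _ hx =>
      obtain ⟨a, ha⟩ := hx
      exact ⟨c * a, by rw [map_smul, ha, map_mul]; exact Algebra.smul_def (A := A m n) _ _⟩
  have h2 : ∀ x ∈ degOne m n, sigma (pdPar d) x ∈ degOne m n := by
    intro x hx
    induction hx using Submodule.span_induction with
    | mem x hx =>
      rcases hx with rfl | ⟨e, rfl⟩
      · rw [map_one]; exact Submodule.subset_span (Or.inl rfl)
      · rw [sigma_apply (gen_mem e)]
        exact Submodule.smul_mem _ _ (Submodule.subset_span (Or.inr ⟨e, rfl⟩))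
    | zero => rw [map_zero]; exact Submodule.zero_mem _
    | add x y _ _ hx hy => rw [map_add]; exact Submodule.add_mem _ hx hy
    | smul c x _ hx => rw [map_smul]; exact Submodule.smul_mem _ _ hx
  -- For `k = 0` the truncated `k - 1` is again `0`, which is too weak; the last assumption supplies
  -- that constants have derivative zero.
  have h3 : ∀ (k : ℕ), ∀ x ∈ degOne m n, ∀ f ∈ degLE m n k, pd d f ∈ degLE m n (k - 1) →
      (k = 0 → pd d f = 0) → pd d (x * f) ∈ degLE m n k := by
    intro k x hx f hf hf' h0
    rw [pd_mul]
    obtain ⟨c, hc⟩ := h1 x hx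
    refine Submodule.add_mem _ ?_ ?_
    · have e : algebraMap ℂ (A m n) c * f = c • f := (Algebra.smul_def c f).symm
      rw [hc, e]; exact Submodule.smul_mem _ _ hf
    · rcases k with _ | k
      · rw [h0 rfl, mul_zero]; exact Submodule.zero_mem _
      · rw [degLE_succ]
        exact Submodule.mul_mem_mul (h2 x hx) hf'
  induction k with
  | zero =>
    intro p hp
    rw [degLE_succ] at hp
    refine Submodule.mul_induction_on hp (fun x hx f hf => ?_) fun p q hp hq => ?_
    · have := pd_degLE_zero d hf
      exact h3 _ x hx f hf (by rw [this]; exact Submodule.zero_mem _) fun _ => this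
    · rw [map_add]; exact Submodule.add_mem _ hp hq
  | succ k ih =>
    intro p hp
    rw [degLE_succ] at hp
    refine Submodule.mul_induction_on hp (fun x hx f hf => ?_) fun p q hp hq => ?_
    · exact h3 _ x hx f hf (ih hf) fun h => absurd h (Nat.succ_ne_zero _)
    · rw [map_add]; exact Submodule.add_mem _ hp hq

/-! ### The Euler operator and the invariants of the partial derivatives -/

/-- The Euler operator `∑ x_d ∂_d`. -/
def euler (m n : ℕ) : Module.End ℂ (A m n) := ∑ d, LinearMap.mulLeft ℂ (gen d) ∘ₗ pd d

theorem euler_apply (p : A m n) : euler m n p = ∑ d, gen d * pd d p := by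
  simp [euler]

/-- Moving `x_d` past `sigma p` cancels the sign in the super Leibniz rule for `∂_d`, so the Euler
operator is an ordinary derivation and eigenvalues add under multiplication. -/
theorem euler_mul (p q : A m n) : euler m n (p * q) = euler m n p * q + p * euler m n q := by
  rw [euler_apply, euler_apply, euler_apply, Finset.sum_mul, Finset.mul_sum,
    ← Finset.sum_add_distrib]
  refine Finset.sum_congr rfl fun d _ => ?_
  rw [pd_mul, mul_add, ← mul_assoc, ← mul_assoc _ (sigma _ p), gen_mul d (sigma _ p), sigma_sigma,
    mul_assoc p]

theorem euler_gen (d : Fin m ⊕ Fin n) : euler m n (gen d) = gen d := by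
  rw [euler_apply, Finset.sum_eq_single d]
  · rw [pd_gen, if_pos rfl, mul_one]
  · intro e _ he
    rw [pd_gen, if_neg he, mul_zero]
  · intro h
    exact absurd (Finset.mem_univ d) h

/-- `A` is the sum of the eigenspaces of the Euler operator with eigenvalues in `ℕ`, and the
eigenspace with eigenvalue `0` is `ℂ`. -/
theorem mem_span_euler (p : A m n) : p ∈ Submodule.span ℂ
    {q : A m n | ∃ k : ℕ, euler m n q = (k : ℂ) • q ∧ (k = 0 → ∃ c : ℂ, q = algebraMap ℂ _ c)} := by
  induction p using gen_induction with
  | h1 c =>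
    refine Submodule.subset_span ⟨0, ?_, fun _ => ⟨c, rfl⟩⟩
    rw [euler_apply, Nat.cast_zero, zero_smul]
    exact Finset.sum_eq_zero fun d _ => by rw [pd_algebraMap, mul_zero]
  | hg d =>
    exact Submodule.subset_span ⟨1, by rw [euler_gen, Nat.cast_one, one_smul],
      fun h => absurd h one_ne_zero⟩
  | ha p q hp hq => exact Submodule.add_mem _ hp hq
  | hm p q hp hq =>
    induction hp, hq using Submodule.span_induction₂ with
    | mem_mem p q hp hq =>
      obtain ⟨k, hk, hk0⟩ := hp
      obtain ⟨l, hl, hl0⟩ := hq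
      refine Submodule.subset_span ⟨k + l, ?_, fun h => ?_⟩
      · rw [euler_mul, hk, hl, smul_mul_assoc, mul_smul_comm, Nat.cast_add]
        module
      · obtain ⟨a, rfl⟩ := hk0 (by omega)
        obtain ⟨b, rfl⟩ := hl0 (by omega)
        exact ⟨a * b, (map_mul _ _ _).symm⟩
    | zero_left q _ => rw [zero_mul]; exact Submodule.zero_mem _
    | zero_right p _ => rw [mul_zero]; exact Submodule.zero_mem _
    | add_left p p' q _ _ _ h h' => rw [add_mul]; exact Submodule.add_mem _ h h'
    | add_right p q q' _ _ _ h h' => rw [mul_add]; exact Submodule.add_mem _ h h'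
    | smul_left c p q _ _ h => rw [smul_mul_assoc]; exact Submodule.smul_mem _ _ h
    | smul_right c p q _ _ h => rw [mul_smul_comm]; exact Submodule.smul_mem _ _ h

/-- If an operator `E` is diagonalizable with eigenvalues in `ℕ`, then its kernel is contained in
every subspace that contains the eigenvectors with eigenvalue `0`. -/
theorem mem_of_diagonalizable {N : Type*} [AddCommGroup N] [Module ℂ N] (E : Module.End ℂ N)
    (S : Submodule ℂ N)
    (h : ∀ v, v ∈ Submodule.span ℂ {w : N | ∃ k : ℕ, E w = (k : ℂ) • w ∧ (k = 0 → w ∈ S)})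
    {v : N} (hv : E v = 0) : v ∈ S := by
  -- `Q k` is the product of `1 - E / l` over `1 ≤ l ≤ k`. It fixes the kernel of `E`, scales every
  -- eigenvector, and annihilates those with eigenvalue in `1, …, k`. So for each vector `w`, `Q k
  -- w` lies in `S` once `k` is large.
  let Q : ℕ → Module.End ℂ N := fun k =>
    Nat.rec 1 (fun k Q => Q * (1 - ((k : ℂ) + 1)⁻¹ • E)) k
  have hQ : ∀ k, Q (k + 1) = Q k * (1 - ((k : ℂ) + 1)⁻¹ • E) := fun k => rfl
  have hQ0 : Q 0 = 1 := rfl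
  have h0 : ∀ k w, E w = 0 → Q k w = w := by
    intro k w hw
    induction k with
    | zero => simp [hQ0]
    | succ k ih => simp [hQ, hw, ih]
  have h1 : ∀ k (l : ℂ) w, E w = l • w → ∃ c : ℂ, Q k w = c • w := by
    intro k l w hw
    induction k with
    | zero => exact ⟨1, by simp [hQ0]⟩
    | succ k ih =>
      obtain ⟨c, hc⟩ := ih
      refine ⟨(1 - ((k : ℂ) + 1)⁻¹ * l) * c, ?_⟩
      simp only [hQ, Module.End.mul_apply, LinearMap.sub_apply, Module.End.one_apply,
        LinearMap.smul_apply, hw, map_sub, map_smul, hc]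
      module
  have h2 : ∀ k l : ℕ, 0 < l → l ≤ k → ∀ w, E w = (l : ℂ) • w → Q k w = 0 := by
    intro k l hl hk w hw
    induction k with
    | zero => omega
    | succ k ih =>
      simp only [hQ, Module.End.mul_apply, LinearMap.sub_apply, Module.End.one_apply,
        LinearMap.smul_apply, hw, map_sub, map_smul]
      rcases Nat.lt_or_ge k l with h | h
      · obtain ⟨c, hc⟩ := h1 k l w hw
        have hl' : l = k + 1 := by omega
        have hk0 : (k : ℂ) + 1 ≠ 0 := Nat.cast_add_one_ne_zero k
        rw [hl', Nat.cast_add, Nat.cast_one, smul_smul, inv_mul_cancel₀ hk0, one_smul, sub_self]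
      · rw [ih h]; simp
  have key : ∀ w, ∃ K, ∀ k, K ≤ k → Q k w ∈ S := by
    intro w
    induction h w using Submodule.span_induction with
    | mem w hw =>
      obtain ⟨l, hl, hl0⟩ := hw
      refine ⟨l, fun k hk => ?_⟩
      rcases Nat.eq_zero_or_pos l with h | h
      · obtain ⟨c, hc⟩ := h1 k l w hl
        rw [hc]; exact S.smul_mem _ (hl0 h)
      · rw [h2 k l h hk w hl]; exact S.zero_mem
    | zero => exact ⟨0, fun k _ => by rw [map_zero]; exact S.zero_mem⟩
    | add x y _ _ hx hy =>
      obtain ⟨K, hK⟩ := hx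
      obtain ⟨L, hL⟩ := hy
      refine ⟨max K L, fun k hk => ?_⟩
      rw [map_add]
      exact S.add_mem (hK k (le_of_max_le_left hk)) (hL k (le_of_max_le_right hk))
    | smul c x _ hx =>
      obtain ⟨K, hK⟩ := hx
      exact ⟨K, fun k hk => by rw [map_smul]; exact S.smul_mem _ (hK k hk)⟩
  obtain ⟨K, hK⟩ := key v
  have := hK K le_rfl
  rwa [h0 K v hv] at this

variable {V : Type u} [AddCommGroup V] [Module ℂ V]

/-- Such a `z` is killed by the Euler operator on the first factor, which is diagonalizable with
eigenvalues in `ℕ` and whose zero eigenspace consists of the constants. -/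
theorem exists_one_tmul {z : A m n ⊗[ℂ] V} (hz : ∀ d, (pd d).rTensor V z = 0) :
    ∃ v : V, z = 1 ⊗ₜ v := by
  have hE : (euler m n).rTensor V z = 0 := by
    change LinearMap.rTensorHom V (euler m n) z = 0
    rw [euler, map_sum, LinearMap.sum_apply]
    refine Finset.sum_eq_zero fun d _ => ?_
    rw [LinearMap.coe_rTensorHom, LinearMap.rTensor_comp_apply, hz, map_zero]
  have := mem_of_diagonalizable (N := A m n ⊗[ℂ] V) ((euler m n).rTensor V)
    (LinearMap.range (TensorProduct.mk ℂ (A m n) V 1)) (fun w => ?_) hE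
  · obtain ⟨v, hv⟩ := this
    exact ⟨v, hv.symm⟩
  · induction w using TensorProduct.induction_on with
    | zero => exact Submodule.zero_mem _
    | add x y hx hy => exact Submodule.add_mem _ hx hy
    | tmul p v =>
      induction mem_span_euler p using Submodule.span_induction with
      | mem q hq =>
        obtain ⟨k, hk, hk0⟩ := hq
        refine Submodule.subset_span ⟨k, ?_, fun h => ?_⟩
        · rw [LinearMap.rTensor_tmul, hk]; rfl
        · obtain ⟨c, rfl⟩ := hk0 h
          refine ⟨c • v, ?_⟩
          rw [TensorProduct.mk_apply, Algebra.algebraMap_eq_smul_one, TensorProduct.smul_tmul]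
      | zero => rw [TensorProduct.zero_tmul]; exact Submodule.zero_mem _
      | add x y _ _ hx hy => rw [TensorProduct.add_tmul]; exact Submodule.add_mem _ hx hy
      | smul c x _ hx => exact Submodule.smul_mem _ c hx

/-- Evaluation at the origin, on `A ⊗ V`. -/
def augTensor (V : Type u) [AddCommGroup V] [Module ℂ V] : A m n ⊗[ℂ] V →ₗ[ℂ] V :=
  TensorProduct.lift (LinearMap.lsmul ℂ V ∘ₗ (aug (m := m) (n := n)).toLinearMap)

theorem augTensor_tmul (p : A m n) (v : V) : augTensor V (p ⊗ₜ v) = aug p • v := rfl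

theorem augTensor_one_tmul (v : V) : augTensor V ((1 : A m n) ⊗ₜ v) = v := by
  rw [augTensor_tmul, map_one, one_smul]

theorem one_tmul_injective : Function.Injective fun v : V => (1 : A m n) ⊗ₜ[ℂ] v :=
  fun v w h => by
    have := congrArg (augTensor V) h
    simpa only [augTensor_one_tmul] using this

/-! ### Spanning by monomials -/

theorem xiProd_insert {j : Fin n} {I : Finset (Fin n)} (h : ∀ i ∈ I, j < i) :
    xiProd (insert j I) = xi j * xiProd I := by
  rw [xiProd, Finset.sort_insert (· ≤ ·) (fun i hi => (h i hi).le)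
    fun hj => lt_irrefl _ (h j hj), List.map_cons, List.prod_cons, xiProd]

theorem xi_mul_xi (i j : Fin n) : xi i * xi j = -(xi j * xi i) :=
  eq_neg_of_add_eq_zero_left (ExteriorAlgebra.ι_add_mul_swap _ _)

theorem xi_mul_self (i : Fin n) : xi i * xi i = 0 := ExteriorAlgebra.ι_sq_zero _

theorem xi_mul_xiProd (j : Fin n) (I : Finset (Fin n)) :
    ∃ c : ℂ, xi j * xiProd I = c • xiProd (insert j I) := by
  induction I using Finset.induction_on_min with
  | empty => exact ⟨1, by rw [xiProd_insert (by simp), one_smul]⟩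
  | insert i I hi ih =>
    rcases lt_trichotomy j i with h | h | h
    · refine ⟨1, ?_⟩
      rw [one_smul, xiProd_insert (j := j)]
      intro k hk
      rcases Finset.mem_insert.1 hk with rfl | hk
      · exact h
      · exact h.trans (hi k hk)
    · subst h
      refine ⟨0, ?_⟩
      rw [xiProd_insert hi, ← mul_assoc, xi_mul_self, zero_mul, zero_smul]
    · obtain ⟨c, hc⟩ := ih
      refine ⟨-c, ?_⟩
      rw [xiProd_insert hi, ← mul_assoc, xi_mul_xi, neg_mul, mul_assoc, hc, Finset.insert_comm,
        xiProd_insert (j := i), mul_smul_comm, neg_smul]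
      intro k hk
      rcases Finset.mem_insert.1 hk with rfl | hk
      · exact h
      · exact hi k hk

theorem span_xiProd (x : Lam n) : x ∈ Submodule.span ℂ (Set.range (xiProd (n := n))) := by
  induction x using lam_induction with
  | h1 r =>
    rw [Algebra.algebraMap_eq_smul_one]
    exact Submodule.smul_mem _ _ (Submodule.subset_span ⟨∅, by simp [xiProd]⟩)
  | ha x y hx hy => exact Submodule.add_mem _ hx hy
  | hs c x hx => exact Submodule.smul_mem _ c hx
  | hm j x hx =>
    induction hx using Submodule.span_induction with
    | mem x hx =>
      obtain ⟨I, rfl⟩ := hx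
      obtain ⟨c, hc⟩ := xi_mul_xiProd j I
      rw [hc]
      exact Submodule.smul_mem _ _ (Submodule.subset_span ⟨_, rfl⟩)
    | zero => rw [mul_zero]; exact Submodule.zero_mem _
    | add x y _ _ hx hy => rw [mul_add]; exact Submodule.add_mem _ hx hy
    | smul c x _ hx => rw [mul_smul_comm]; exact Submodule.smul_mem _ _ hx

theorem span_mono (p : A m n) :
    p ∈ Submodule.span ℂ {q : A m n | ∃ α I, q = mono α I} := by
  induction p using TensorProduct.induction_on with
  | zero => exact Submodule.zero_mem _
  | add x y hx hy => exact Submodule.add_mem _ hx hy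
  | tmul p x =>
    induction p using MvPolynomial.induction_on' with
    | monomial α a =>
      induction span_xiProd x using Submodule.span_induction with
      | mem x hx =>
        obtain ⟨I, rfl⟩ := hx
        have : MvPolynomial.monomial α a ⊗ₜ[ℂ] xiProd I = a • mono α I := by
          rw [mono, TensorProduct.smul_tmul', MvPolynomial.smul_monomial, smul_eq_mul, mul_one]
        rw [this]
        exact Submodule.smul_mem _ _ (Submodule.subset_span ⟨α, I, rfl⟩)
      | zero => rw [TensorProduct.tmul_zero]; exact Submodule.zero_mem _
      | add x y _ _ hx hy => rw [TensorProduct.tmul_add]; exact Submodule.add_mem _ hx hy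
      | smul c x _ hx => rw [TensorProduct.tmul_smul]; exact Submodule.smul_mem _ _ hx
    | add p q hp hq => rw [TensorProduct.add_tmul]; exact Submodule.add_mem _ hp hq

theorem aGr_eq_span (k : ZMod 2) :
    aGr m n k = Submodule.span ℂ {q | ∃ α I, (I.card : ZMod 2) = k ∧ q = mono α I} := by
  refine le_antisymm (fun p hp => ?_) (Submodule.span_le.2 ?_)
  · have h : ∀ p : A m n, p + sgn 1 k • sigma 1 p ∈
        Submodule.span ℂ {q : A m n | ∃ α I, (I.card : ZMod 2) = k ∧ q = mono α I} := by
      intro p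
      induction span_mono p using Submodule.span_induction with
      | mem q hq =>
        obtain ⟨α, I, rfl⟩ := hq
        have e : mono α I + sgn 1 k • sigma 1 (mono α I) =
            (1 + sgn 1 (k + I.card)) • (mono α I : A m n) := by
          rw [sigma_apply (mono_mem α I), sgn_add_right]
          module
        rw [e]
        by_cases hk : (I.card : ZMod 2) = k
        · exact Submodule.smul_mem _ _ (Submodule.subset_span ⟨α, I, hk, rfl⟩)
        · have : k + (I.card : ZMod 2) = 1 := by
            have hd : ∀ k l : ZMod 2, l ≠ k → k + l = 1 := by decide
            exact hd _ _ hk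
          have h0 : (1 : ℂ) + sgn 1 (k + I.card) = 0 := by
            rw [this, sgn_one_one, add_neg_cancel]
          rw [h0]
          have : (0 : ℂ) • (mono α I : A m n) = 0 := by module
          rw [this]
          exact Submodule.zero_mem _
      | zero => simp
      | add x y _ _ hx hy =>
        have := Submodule.add_mem _ hx hy
        rw [map_add]
        convert this using 1
        module
      | smul c x _ hx =>
        have := Submodule.smul_mem _ c hx
        rw [map_smul]
        convert this using 1
        module
    have h2 := Submodule.smul_mem _ (2⁻¹ : ℂ) (h p)
    rw [sigma_apply hp, sgn_smul_smul] at h2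
    convert h2 using 1
    module
  · rintro _ ⟨α, I, rfl, rfl⟩
    exact mono_mem α I

theorem mono_zero_empty : (mono 0 ∅ : A m n) = 1 := by
  simp [mono, xiProd, Algebra.TensorProduct.one_def]

/-! ### Modules over the Weyl superalgebra -/

section Weyl

variable {N V : Type*} [AddCommGroup N] [Module ℂ N] [AddCommGroup V] [Module ℂ V]

/-- The map `p ⊗ v ↦ p f(v)`, for a linear map `f` from `V` to an `A`-module. -/
def actMap (L : A m n →ₐ[ℂ] Module.End ℂ N) (f : V →ₗ[ℂ] N) : A m n ⊗[ℂ] V →ₗ[ℂ] N :=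
  TensorProduct.lift (LinearMap.lcomp ℂ N f ∘ₗ L.toLinearMap)

theorem actMap_tmul (L : A m n →ₐ[ℂ] Module.End ℂ N) (f : V →ₗ[ℂ] N) (p : A m n) (v : V) :
    actMap L f (p ⊗ₜ v) = L p (f v) := rfl

/-- The subspace of elements of degree at most `k` of `A ⊗ V`. -/
def degTensor (m n : ℕ) (V : Type*) [AddCommGroup V] [Module ℂ V] (k : ℕ) :
    Submodule ℂ (A m n ⊗[ℂ] V) :=
  Submodule.map₂ (TensorProduct.mk ℂ (A m n) V) (degLE m n k) ⊤

theorem exists_mem_degTensor (z : A m n ⊗[ℂ] V) : ∃ k, z ∈ degTensor m n V k := by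
  have mono : ∀ {k l : ℕ}, k ≤ l → degTensor m n V k ≤ degTensor m n V l := fun h =>
    Submodule.map₂_le_map₂ (degLE_mono h) le_rfl
  induction z using TensorProduct.induction_on with
  | zero => exact ⟨0, Submodule.zero_mem _⟩
  | tmul p v =>
    obtain ⟨k, hk⟩ := exists_mem_degLE p
    exact ⟨k, Submodule.apply_mem_map₂ (TensorProduct.mk ℂ (A m n) V) hk trivial⟩
  | add x y hx hy =>
    obtain ⟨k, hk⟩ := hx
    obtain ⟨l, hl⟩ := hy
    exact ⟨max k l, Submodule.add_mem _ (mono (le_max_left k l) hk)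
      (mono (le_max_right k l) hl)⟩

theorem pd_degTensor_zero (d : Fin m ⊕ Fin n) {z : A m n ⊗[ℂ] V} (hz : z ∈ degTensor m n V 0) :
    (pd d).rTensor V z = 0 := by
  have : degTensor m n V 0 ≤ LinearMap.ker ((pd d).rTensor V) := by
    refine Submodule.map₂_le.2 fun p hp v _ => ?_
    rw [LinearMap.mem_ker, TensorProduct.mk_apply, LinearMap.rTensor_tmul, pd_degLE_zero d hp,
      TensorProduct.zero_tmul]
  exact this hz

theorem pd_degTensor_succ (d : Fin m ⊕ Fin n) {k : ℕ} {z : A m n ⊗[ℂ] V}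
    (hz : z ∈ degTensor m n V (k + 1)) : (pd d).rTensor V z ∈ degTensor m n V k := by
  have : degTensor m n V (k + 1) ≤ (degTensor m n V k).comap ((pd d).rTensor V) := by
    refine Submodule.map₂_le.2 fun p hp v _ => ?_
    rw [Submodule.mem_comap, TensorProduct.mk_apply, LinearMap.rTensor_tmul]
    exact Submodule.apply_mem_map₂ (TensorProduct.mk ℂ (A m n) V) (pd_degLE_succ d k hp) trivial
  exact this hz

theorem degTensor_fg [FiniteDimensional ℂ V] (k : ℕ) : (degTensor m n V k).FG :=
  Submodule.FG.map₂ _ (degLE_fg k) (Module.finite_def.1 inferInstance)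

/-- The hypothesis says that `D d` differentiates the coefficients of `∑ p f(v)`, so the kernel of
`actMap` is stable under the partial derivatives, which lower the degree. By induction all
derivatives of an element of the kernel vanish; the element is then `1 ⊗ v` and `f v = 0`. This is
used in `Ū`, where `D` is the supercommutator with `∂_d`, and in modules, where `D` is the shifted
action of `∂_d`. -/
theorem actMap_injective {L : A m n →ₐ[ℂ] Module.End ℂ N} {D : Fin m ⊕ Fin n → Module.End ℂ N}
    {f : V →ₗ[ℂ] N} (hf : Function.Injective f)
    (h : ∀ d p v, D d (L p (f v)) = L (pd d p) (f v)) : Function.Injective (actMap L f) := by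
  have hD : ∀ d z, actMap L f ((pd d).rTensor V z) = D d (actMap L f z) := by
    intro d z
    induction z using TensorProduct.induction_on with
    | zero => simp
    | tmul p v => rw [LinearMap.rTensor_tmul, actMap_tmul, actMap_tmul, h]
    | add x y hx hy => simp only [map_add, hx, hy]
  have key : ∀ z : A m n ⊗[ℂ] V, (∀ d, (pd d).rTensor V z = 0) → actMap L f z = 0 → z = 0 := by
    intro z hz hz0
    obtain ⟨v, rfl⟩ := exists_one_tmul hz
    rw [actMap_tmul, map_one, Module.End.one_apply] at hz0
    rw [hf (hz0.trans (map_zero f).symm), TensorProduct.tmul_zero]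
  have main : ∀ k, ∀ z ∈ degTensor m n V k, actMap L f z = 0 → z = 0 := by
    intro k
    induction k with
    | zero => exact fun z hz hz0 => key z (fun d => pd_degTensor_zero d hz) hz0
    | succ k ih =>
      intro z hz hz0
      refine key z (fun d => ih _ (pd_degTensor_succ d hz) ?_) hz0
      rw [hD, hz0, map_zero]
  refine (injective_iff_map_eq_zero _).2 fun z hz => ?_
  obtain ⟨k, hk⟩ := exists_mem_degTensor z
  exact main k z hk hz

/-! ### Generation by the common kernel of locally nilpotent derivatives -/

theorem pd_gen_pow_of_ne {d e : Fin m ⊕ Fin n} (h : d ≠ e) (k : ℕ) :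
    pd d (gen e ^ k : A m n) = 0 := by
  induction k with
  | zero => rw [pow_zero, pd_one]
  | succ k ih => rw [pow_succ, pd_mul, ih, pd_gen, if_neg h, zero_mul, mul_zero, add_zero]

theorem pd_gen_pow {d : Fin m ⊕ Fin n} (h : pdPar d = 0) (k : ℕ) :
    pd d (gen d ^ (k + 1) : A m n) = ((k : ℂ) + 1) • gen d ^ k := by
  induction k with
  | zero => rw [zero_add, pow_one, pd_gen, if_pos rfl, pow_zero, Nat.cast_zero, zero_add, one_smul]
  | succ k ih =>
    rw [pow_succ, pd_mul, ih, pd_gen, if_pos rfl, h, sigma_zero, AlgHom.id_apply, mul_one,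
      smul_mul_assoc, ← pow_succ, Nat.cast_add, Nat.cast_one]
    module

/-- A Taylor expansion in one variable at a time. The relations are those of the Weyl superalgebra;
they ensure that treating a new variable does not disturb the vanishing of the derivatives already
treated. -/
theorem mem_span_of_locally_nilpotent {L : A m n →ₐ[ℂ] Module.End ℂ N}
    {D : Fin m ⊕ Fin n → Module.End ℂ N}
    (hL : ∀ d p v, D d (L p v) = L (pd d p) v + L (sigma (pdPar d) p) (D d v))
    (hD : ∀ d e v, D d (D e v) = sgn (pdPar d) (pdPar e) • D e (D d v))
    (hnil : ∀ d v, ∃ k, (D d ^ k) v = 0) (v : N) :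
    v ∈ Submodule.span ℂ {w | ∃ p u, (∀ d, D d u = 0) ∧ w = L p u} := by
  classical
  -- `s` is the set of variables already treated, so that the coefficients `u` are killed by `D d`
  -- for `d ∈ s`.
  have main : ∀ (s : Finset (Fin m ⊕ Fin n)) (v : N),
      v ∈ Submodule.span ℂ {w | ∃ p u, (∀ d ∈ s, D d u = 0) ∧ w = L p u} := by
    intro s
    induction s using Finset.induction_on with
    | empty => exact fun v => Submodule.subset_span ⟨1, v, by simp, by simp⟩
    | insert d s hds ih =>
      intro v
      have mem : ∀ p u, (∀ e ∈ insert d s, D e u = 0) → L p u ∈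
          Submodule.span ℂ {w | ∃ p u, (∀ e ∈ insert d s, D e u = 0) ∧ w = L p u} :=
        fun p u hu => Submodule.subset_span ⟨p, u, hu, rfl⟩
      have smem : ∀ p w, w ∈
          Submodule.span ℂ {w | ∃ p u, (∀ e ∈ insert d s, D e u = 0) ∧ w = L p u} → L p w ∈
          Submodule.span ℂ {w | ∃ p u, (∀ e ∈ insert d s, D e u = 0) ∧ w = L p u} := by
        intro p w hw
        induction hw using Submodule.span_induction with
        | mem w hw =>
          obtain ⟨q, u, hu, rfl⟩ := hw
          rw [← Module.End.mul_apply, ← map_mul]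
          exact mem _ _ hu
        | zero => rw [map_zero]; exact Submodule.zero_mem _
        | add x y _ _ hx hy => rw [map_add]; exact Submodule.add_mem _ hx hy
        | smul c x _ hx => rw [map_smul]; exact Submodule.smul_mem _ _ hx
      have hDs : ∀ u, (∀ e ∈ s, D e u = 0) → ∀ e ∈ s, D e (D d u) = 0 := by
        intro u hu e he
        rw [hD, hu e he, map_zero, smul_zero]
      have step : ∀ u, (∀ e ∈ s, D e u = 0) → u ∈
          Submodule.span ℂ {w | ∃ p u, (∀ e ∈ insert d s, D e u = 0) ∧ w = L p u} := by
        have hgen : ∀ k u, (∀ e ∈ s, D e u = 0) → ∀ e ∈ s, D e (L (gen d ^ k) u) = 0 := by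
          intro k u hu e he
          have hne : e ≠ d := fun h => hds (h ▸ he)
          rw [hL, hu e he, map_zero, add_zero, pd_gen_pow_of_ne hne, map_zero,
            LinearMap.zero_apply]
        rcases parity_cases (pdPar d) with h0 | h1
        · have hpow : ∀ k u, D d u = 0 →
              (D d ^ k) (L (gen d ^ k) u) = (k.factorial : ℂ) • u := by
            intro k u hu
            induction k with
            | zero => simp
            | succ k ih =>
              rw [pow_succ, Module.End.mul_apply, hL, hu, map_zero, add_zero, pd_gen_pow h0,
                map_smul, LinearMap.smul_apply, map_smul, ih, smul_smul, Nat.factorial_succ]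
              push_cast
              rfl
          have hDpow : ∀ k u, (∀ e ∈ s, D e u = 0) → ∀ e ∈ s, D e ((D d ^ k) u) = 0 := by
            intro k u hu
            induction k with
            | zero => simpa using hu
            | succ k ih =>
              rw [pow_succ', Module.End.mul_apply]
              exact hDs _ ih
          have : ∀ k u, (∀ e ∈ s, D e u = 0) → (D d ^ k) u = 0 → u ∈
              Submodule.span ℂ {w | ∃ p u, (∀ e ∈ insert d s, D e u = 0) ∧ w = L p u} := by
            intro k
            induction k with
            | zero =>
              intro u _ hk
              rw [pow_zero, Module.End.one_apply] at hk
              rw [hk]; exact Submodule.zero_mem _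
            | succ k ihk =>
              intro u hu hk
              set w := (D d ^ k) u with hw
              have hdw : D d w = 0 := by
                rw [hw, ← Module.End.mul_apply, ← pow_succ', hk]
              have hsw : ∀ e ∈ s, D e w = 0 := hDpow k u hu
              have hfac : (k.factorial : ℂ) ≠ 0 := Nat.cast_ne_zero.2 (Nat.factorial_ne_zero k)
              -- `w` is killed by `D d`, hence `D d ^ k` maps `x_d ^ k w` to `k! w`. Subtracting
              -- `x_d ^ k w / k!` from `u` makes it vanish under `D d ^ k`, which lowers the
              -- exponent by one.
              have e : u = (u - (k.factorial : ℂ)⁻¹ • L (gen d ^ k) w) +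
                (k.factorial : ℂ)⁻¹ • L (gen d ^ k) w := by abel
              rw [e]
              refine Submodule.add_mem _ (ihk _ (fun e he => ?_) ?_)
                (Submodule.smul_mem _ _ (mem _ _ fun e he => ?_))
              · rw [map_sub, map_smul, hu e he, hgen k w hsw e he, smul_zero, sub_zero]
              · rw [map_sub, map_smul, hpow k w hdw, smul_smul, inv_mul_cancel₀ hfac, one_smul,
                  sub_self]
              · rcases Finset.mem_insert.1 he with rfl | he
                · exact hdw
                · exact hsw e he
          intro u hu
          obtain ⟨k, hk⟩ := hnil d u
          exact this k u hu hk
        · intro u hu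
          have hdd : ∀ w, D d (D d w) = 0 := by
            intro w
            have := hD d d w
            rw [h1, sgn_one_one, neg_smul, one_smul] at this
            exact eq_zero_of_eq_neg this
          -- For odd `d` the square of `D d` is zero and the expansion has two terms: both `u - ξ D
          -- u` and the coefficient `D u` of `ξ` are killed by `D d`.
          have e : u = L 1 (u - L (gen d) (D d u)) + L (gen d) (D d u) := by
            rw [map_one, Module.End.one_apply]; abel
          rw [e]
          have hsw := hDs u hu
          refine Submodule.add_mem _ (mem _ _ fun e he => ?_) (mem _ _ fun e he => ?_)
          · rcases Finset.mem_insert.1 he with rfl | he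
            · rw [map_sub, hL, hdd, map_zero, add_zero, pd_gen, if_pos rfl, map_one,
                Module.End.one_apply, sub_self]
            · have := hgen 1 _ hsw e he
              rw [pow_one] at this
              rw [map_sub, hu e he, this, sub_zero]
          · rcases Finset.mem_insert.1 he with rfl | he
            · exact hdd u
            · exact hsw e he
      -- By induction `v` is a sum of terms `L p u` with `u` killed by `D e` for all `e ∈ s`; it
      -- remains to expand `u` in the variable `d` and multiply by `p`.
      induction ih v using Submodule.span_induction with
      | mem w hw =>
        obtain ⟨p, u, hu, rfl⟩ := hw
        exact smem p u (step u hu)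
      | zero => exact Submodule.zero_mem _
      | add x y _ _ hx hy => exact Submodule.add_mem _ hx hy
      | smul c x _ hx => exact Submodule.smul_mem _ _ hx
  simpa using main Finset.univ v

end Weyl

/-! ### The algebra `Ū` -/

theorem toUbar_lie {i j : ZMod 2} {x y z : (wTilde m n).total}
    (hx : (x : (wTilde m n).L) ∈ (wTilde m n).gr i) (hy : (y : (wTilde m n).L) ∈ (wTilde m n).gr j)
    (hz : (z : (wTilde m n).L) = (wTilde m n).br i j x y) :
    toUbar z = toUbar x * toUbar y - sgn i j • (toUbar y * toUbar x) := by
  have := RingQuot.mkAlgHom_rel ℂ (UbarRel.lie i j x y z hx hy hz)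
  simpa [toUbar] using this

theorem toUbar_inA_one : toUbar (inA (1 : A m n)) = 1 := by
  have := RingQuot.mkAlgHom_rel ℂ (UbarRel.one (m := m) (n := n))
  simpa [toUbar] using this

theorem toUbar_inA_mul (a b : A m n) :
    toUbar (inA (a * b)) = toUbar (inA a) * toUbar (inA b) := by
  have := RingQuot.mkAlgHom_rel ℂ (UbarRel.mul a b)
  simpa [toUbar] using this

theorem ubar_induction {P : Ubar m n → Prop} (h1 : ∀ c : ℂ, P (algebraMap ℂ _ c))
    (hι : ∀ x, P (toUbar x)) (ha : ∀ u v, P u → P v → P (u + v))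
    (hm : ∀ u v, P u → P v → P (u * v)) (u : Ubar m n) : P u := by
  obtain ⟨t, rfl⟩ := RingQuot.mkAlgHom_surjective ℂ (UbarRel m n) u
  induction t using TensorAlgebra.induction with
  | algebraMap c => rw [AlgHom.commutes]; exact h1 c
  | ι x => exact hι x
  | mul a b ha hb => rw [map_mul]; exact hm _ _ ha hb
  | add a b hx hb => rw [map_add]; exact ha _ _ hx hb

/-- The universal property of `Ū`. -/
def ubarLift {E : Type*} [Ring E] [Algebra ℂ E] (f : (wTilde m n).total →ₗ[ℂ] E)
    (hlie : ∀ (i j : ZMod 2) (x y z : (wTilde m n).total),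
      (x : (wTilde m n).L) ∈ (wTilde m n).gr i → (y : (wTilde m n).L) ∈ (wTilde m n).gr j →
      (z : (wTilde m n).L) = (wTilde m n).br i j x y → f z = f x * f y - sgn i j • (f y * f x))
    (hone : f (inA 1) = 1) (hmul : ∀ a b, f (inA (a * b)) = f (inA a) * f (inA b)) :
    Ubar m n →ₐ[ℂ] E :=
  RingQuot.liftAlgHom ℂ ⟨TensorAlgebra.lift ℂ f, by
    intro x y h
    induction h with
    | lie i j x y z hx hy hz => simpa using hlie i j x y z hx hy hz
    | one => simpa using hone
    | mul a b => simpa using hmul a b⟩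

theorem ubarLift_toUbar {E : Type*} [Ring E] [Algebra ℂ E] (f : (wTilde m n).total →ₗ[ℂ] E)
    (hlie hone hmul) (x : (wTilde m n).total) : ubarLift f hlie hone hmul (toUbar x) = f x := by
  simp [ubarLift, toUbar]

theorem ubarAct_toUbar (M : SuperModule.{u} (wTilde m n)) (hM : IsAW M) (x : (wTilde m n).total) :
    ubarAct M hM (toUbar x) = M.ρ x := by
  simp [ubarAct, toUbar]

/-- The inclusion of `A` into `Ū`. -/
def iA : A m n →ₐ[ℂ] Ubar m n :=
  AlgHom.ofLinearMap (toUbar ∘ₗ inA) toUbar_inA_one toUbar_inA_mul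

theorem iA_apply (a : A m n) : iA a = toUbar (inA a) := rfl

/-- The partial derivatives in `Ū`. -/
def dU (d : Fin m ⊕ Fin n) : Ubar m n := toUbar (inW (wPd d))

theorem inA_mem_gr {i : ZMod 2} {a : A m n} (ha : a ∈ aGr m n i) :
    ((inA a : (wTilde m n).total) : (wTilde m n).L) ∈ (wTilde m n).gr i :=
  ⟨Submodule.zero_mem _, ha⟩

theorem inW_mem_gr {i : ZMod 2} {D : wTotal m n} (hD : (D : Module.End ℂ (A m n)) ∈ wGr m n i) :
    ((inW D : (wTilde m n).total) : (wTilde m n).L) ∈ (wTilde m n).gr i :=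
  ⟨hD, Submodule.zero_mem _⟩

theorem toUbar_inW_mul_iA {i j : ZMod 2} {D : wTotal m n}
    (hD : (D : Module.End ℂ (A m n)) ∈ wGr m n i) {a : A m n} (ha : a ∈ aGr m n j) :
    toUbar (inW D) * iA a = iA (D.1 a) + sgn i j • (iA a * toUbar (inW D)) := by
  have := toUbar_lie (z := inA (D.1 a)) (inW_mem_gr hD) (inA_mem_gr ha) ?_
  · rw [iA_apply, iA_apply, this, sub_add_cancel]
  · have e : (0 : Module.End ℂ (A m n)) = D.1 * 0 - sgn i j • (0 * D.1) :=
      LinearMap.ext fun p => by simp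
    exact Prod.ext e (by simp [inA, inW])

theorem toUbar_inW_lie {i j : ZMod 2} {D E F : wTotal m n}
    (hD : (D : Module.End ℂ (A m n)) ∈ wGr m n i) (hE : (E : Module.End ℂ (A m n)) ∈ wGr m n j)
    (hF : F.1 = D.1 * E.1 - sgn i j • (E.1 * D.1)) :
    toUbar (inW F) = toUbar (inW D) * toUbar (inW E) -
      sgn i j • (toUbar (inW E) * toUbar (inW D)) :=
  toUbar_lie (inW_mem_gr hD) (inW_mem_gr hE) (Prod.ext hF (by simp [inW]))

theorem eq_inW_add_inA (x : (wTilde m n).total) :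
    x = inW ⟨x.1.1, x.2.1⟩ + inA x.1.2 :=
  Subtype.ext (Prod.ext (add_zero _).symm (zero_add _).symm)

theorem dU_mul_iA (d : Fin m ⊕ Fin n) (p : A m n) :
    dU d * iA p = iA (pd d p) + iA (sigma (pdPar d) p) * dU d := by
  induction p using homogeneous_induction with
  | h i p hp =>
    rw [dU, toUbar_inW_mul_iA (pd_mem d) hp, sigma_apply hp, map_smul, smul_mul_assoc]
    rfl
  | ha p q hp hq => simp only [map_add, mul_add, add_mul, hp, hq]; abel

theorem wTilde_closed : (wTilde m n).Closed := by
  intro i j x hx y hy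
  refine ⟨wGr_bracket hx.1 hy.1, Submodule.sub_mem _ (hx.1.1 _ _ hy.2)
    (Submodule.smul_mem _ _ ?_)⟩
  rw [add_comm i]
  exact hy.1.1 _ _ hx.2

/-! ### The parity automorphism of `Ū` -/

/-- The parity automorphism of `W̃`, on the ambient space. -/
def parPair (m n : ℕ) : (wTilde m n).L →ₗ[ℂ] (wTilde m n).L :=
  LinearMap.prodMap
    (LinearMap.llcomp ℂ _ _ _ (sigma 1).toLinearMap ∘ₗ LinearMap.lcomp ℂ _ (sigma 1).toLinearMap)
    (sigma 1).toLinearMap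

theorem parPair_apply {i : ZMod 2} {x : (wTilde m n).L} (hx : x ∈ (wTilde m n).gr i) :
    parPair m n x = sgn 1 i • x := by
  refine Prod.ext (LinearMap.ext fun p => ?_) (show sigma 1 x.2 = sgn 1 i • x.2 from
    sigma_apply hx.2)
  change sigma 1 (x.1 (sigma 1 p)) = sgn 1 i • x.1 p
  rw [sigma_wGr hx.1, sigma_sigma]

theorem parPair_mem (x : (wTilde m n).L) (hx : x ∈ (wTilde m n).total) :
    parPair m n x ∈ (wTilde m n).total := by
  obtain ⟨D₀, h₀, D₁, h₁, h⟩ := Submodule.mem_sup.1 hx.1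
  have e : x = (D₀, (0 : A m n)) + (D₁, (0 : A m n)) + ((0 : Module.End ℂ (A m n)), x.2) :=
    Prod.ext (by simp [h]) (by simp)
  have h0 := parPair_apply (x := (D₀, (0 : A m n))) (i := 0) ⟨h₀, Submodule.zero_mem _⟩
  have h1 := parPair_apply (x := (D₁, (0 : A m n))) (i := 1) ⟨h₁, Submodule.zero_mem _⟩
  rw [e, map_add, map_add, h0, h1]
  refine Submodule.add_mem _ (Submodule.add_mem _ (Submodule.smul_mem _ _ ?_)
    (Submodule.smul_mem _ _ ?_)) ⟨?_, trivial⟩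
  · exact ⟨wGr_le m n 0 h₀, trivial⟩
  · exact ⟨wGr_le m n 1 h₁, trivial⟩
  · have : (parPair m n ((0 : Module.End ℂ (A m n)), x.2)).1 = 0 := by
      ext p; simp [parPair]
    rw [this]; exact Submodule.zero_mem _

/-- The parity automorphism of `W̃`. -/
def parTilde (m n : ℕ) : (wTilde m n).total →ₗ[ℂ] (wTilde m n).total :=
  (parPair m n).restrict parPair_mem

theorem parTilde_apply {i : ZMod 2} {x : (wTilde m n).total}
    (hx : (x : (wTilde m n).L) ∈ (wTilde m n).gr i) : parTilde m n x = sgn 1 i • x :=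
  Subtype.ext (parPair_apply hx)

theorem parTilde_inA (a : A m n) : parTilde m n (inA a) = inA (sigma 1 a) :=
  Subtype.ext (Prod.ext (LinearMap.ext fun p => by simp [parTilde, parPair, inA])
    (by simp [parTilde, parPair, inA]))

/-- The parity automorphism of `Ū`. -/
def parU (m n : ℕ) : Ubar m n →ₐ[ℂ] Ubar m n :=
  ubarLift (toUbar ∘ₗ parTilde m n)
    (fun i j x y z hx hy hz => by
      have hz' : (z : (wTilde m n).L) ∈ (wTilde m n).gr (i + j) := by
        rw [hz]; exact wTilde_closed i j _ hx _ hy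
      simp only [LinearMap.comp_apply]
      rw [parTilde_apply hx, parTilde_apply hy, parTilde_apply hz']
      simp only [map_smul, toUbar_lie hx hy hz, smul_mul_assoc, mul_smul_comm, smul_sub,
        sgn_add_right]
      module)
    (by simp only [LinearMap.comp_apply]; rw [parTilde_inA, map_one, toUbar_inA_one])
    (fun a b => by
      simp only [LinearMap.comp_apply]
      rw [parTilde_inA, parTilde_inA, parTilde_inA, map_mul, toUbar_inA_mul])

theorem parU_toUbar {i : ZMod 2} {x : (wTilde m n).total}
    (hx : (x : (wTilde m n).L) ∈ (wTilde m n).gr i) :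
    parU m n (toUbar x) = sgn 1 i • toUbar x := by
  rw [parU, ubarLift_toUbar, LinearMap.comp_apply, parTilde_apply hx, map_smul]

theorem parU_iA (a : A m n) : parU m n (iA a) = iA (sigma 1 a) := by
  rw [iA_apply, parU, ubarLift_toUbar, LinearMap.comp_apply, parTilde_inA, iA_apply]

/-! ### The action of `Ū` on `A` -/

/-- The action of `W̃` on `A`, in which `W` acts by superderivations and `A` by multiplication. -/
def actTilde (m n : ℕ) : (wTilde m n).total →ₗ[ℂ] Module.End ℂ (A m n) :=
  (LinearMap.coprod (LinearMap.id : Module.End ℂ (A m n) →ₗ[ℂ] Module.End ℂ (A m n))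
    (Algebra.lmul ℂ (A m n)).toLinearMap) ∘ₗ (wTilde m n).total.subtype

theorem actTilde_apply (x : (wTilde m n).total) (p : A m n) :
    actTilde m n x p = x.1.1 p + x.1.2 * p := rfl

theorem actTilde_lie (i j : ZMod 2) (x y z : (wTilde m n).total)
    (hx : (x : (wTilde m n).L) ∈ (wTilde m n).gr i) (hy : (y : (wTilde m n).L) ∈ (wTilde m n).gr j)
    (hz : (z : (wTilde m n).L) = (wTilde m n).br i j x y) :
    actTilde m n z = actTilde m n x * actTilde m n y -
      sgn i j • (actTilde m n y * actTilde m n x) := by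
  have h1 : z.1.1 = x.1.1 * y.1.1 - sgn i j • (y.1.1 * x.1.1) := congrArg Prod.fst hz
  have h2 : z.1.2 = x.1.1 y.1.2 - sgn i j • y.1.1 x.1.2 := congrArg Prod.snd hz
  refine LinearMap.ext fun p => ?_
  change z.1.1 p + z.1.2 * p = x.1.1 (y.1.1 p + y.1.2 * p) + x.1.2 * (y.1.1 p + y.1.2 * p) -
    sgn i j • (y.1.1 (x.1.1 p + x.1.2 * p) + y.1.2 * (x.1.1 p + x.1.2 * p))
  have h3 : z.1.1 p = x.1.1 (y.1.1 p) - sgn i j • y.1.1 (x.1.1 p) := LinearMap.congr_fun h1 p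
  rw [h2, h3, map_add, map_add, hx.1.2 _ _ hy.2, hy.1.2 _ _ hx.2, mul_add, mul_add, ← mul_assoc,
    ← mul_assoc, sub_mul, smul_mul_assoc, aGr_mul_comm hx.2 hy.2, sgn_comm j i, smul_mul_assoc]
  have : sgn i j • sgn i j • (x.1.2 * y.1.1 p) = x.1.2 * y.1.1 p := sgn_smul_smul _ _ _
  simp only [smul_add, this]
  abel

/-- The action of `Ū` on `A`. -/
def actA (m n : ℕ) : Ubar m n →ₐ[ℂ] Module.End ℂ (A m n) :=
  ubarLift (E := Module.End ℂ (A m n)) (actTilde m n) actTilde_lie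
    (LinearMap.ext fun p => by
      rw [actTilde_apply]
      simp [inA])
    (fun a b => LinearMap.ext fun p => by
      rw [Module.End.mul_apply, actTilde_apply, actTilde_apply, actTilde_apply]
      simp [inA, mul_assoc])

theorem actA_iA (a p : A m n) : actA m n (iA a) p = a * p := by
  rw [iA_apply, actA, ubarLift_toUbar, actTilde_apply]
  simp [inA]

theorem actA_inW (D : wTotal m n) (p : A m n) : actA m n (toUbar (inW D)) p = D.1 p := by
  rw [actA, ubarLift_toUbar, actTilde_apply]
  simp [inW]

/-! ### The superderivations `q ∂` -/

theorem mulLeft_pd_mem {k : ZMod 2} {q : A m n} (hq : q ∈ aGr m n k) (d : Fin m ⊕ Fin n) :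
    LinearMap.mulLeft ℂ q ∘ₗ pd d ∈ wGr m n (k + pdPar d) := by
  refine ⟨fun j x hx => ?_, fun j x hx y => ?_⟩
  · rw [add_assoc]
    exact aGr_mul hq ((pd_mem d).1 j x hx)
  · have h := (pd_mem d).2 j x hx y
    simp only [LinearMap.comp_apply, LinearMap.mulLeft_apply, h, mul_add,
      mul_smul_comm, sgn_add_left]
    rw [← mul_assoc, ← mul_assoc, aGr_mul_comm hq hx, smul_mul_assoc, smul_smul, mul_assoc x,
      mul_comm (sgn _ _)]

theorem mulLeft_pd_mem_wTotal (d : Fin m ⊕ Fin n) (q : A m n) :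
    LinearMap.mulLeft ℂ q ∘ₗ pd d ∈ wTotal m n := by
  induction q using homogeneous_induction with
  | h k q hq => exact wGr_le m n _ (mulLeft_pd_mem hq d)
  | ha p q hp hq =>
    have : LinearMap.mulLeft ℂ (p + q) ∘ₗ pd d =
        LinearMap.mulLeft ℂ p ∘ₗ pd d + LinearMap.mulLeft ℂ q ∘ₗ pd d :=
      LinearMap.ext fun x => add_mul p q _
    rw [this]
    exact Submodule.add_mem _ hp hq

/-- The map `q ↦ q ∂_d` from `A` to `W`. -/
def wMul (d : Fin m ⊕ Fin n) : A m n →ₗ[ℂ] wTotal m n where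
  toFun q := ⟨LinearMap.mulLeft ℂ q ∘ₗ pd d, mulLeft_pd_mem_wTotal d q⟩
  map_add' p q := Subtype.ext (LinearMap.ext fun _ => add_mul p q _)
  map_smul' c p := Subtype.ext (LinearMap.ext fun _ => smul_mul_assoc c p _)

theorem wMul_apply (d : Fin m ⊕ Fin n) (q p : A m n) : (wMul d q).1 p = q * pd d p := rfl

theorem wMul_mem {k : ZMod 2} {q : A m n} (hq : q ∈ aGr m n k) (d : Fin m ⊕ Fin n) :
    (wMul d q).1 ∈ wGr m n (k + pdPar d) := mulLeft_pd_mem hq d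

/-- Both sides are superderivations of the same parity with the same values on the generators; `W`
is the left `A`-module generated by the partial derivatives. -/
theorem wGr_eq_sum {i : ZMod 2} {D : Module.End ℂ (A m n)} (hD : D ∈ wGr m n i) :
    D = ∑ d, (wMul d (D (gen d))).1 := by
  refine wGr_ext hD (Submodule.sum_mem _ fun d _ => ?_) fun e => ?_
  · have := wMul_mem (hD.1 _ _ (gen_mem d)) d
    rwa [add_assoc, CharTwo.add_self_eq_zero, add_zero] at this
  · rw [LinearMap.sum_apply, Finset.sum_eq_single e]
    · rw [wMul_apply, pd_gen, if_pos rfl, mul_one]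
    · intro d _ hd
      rw [wMul_apply, pd_gen, if_neg hd, mul_zero]
    · exact fun h => absurd (Finset.mem_univ e) h

/-- The map `q ↦ q ∂_d` from `A` to `Ū`. -/
def theta (d : Fin m ⊕ Fin n) : A m n →ₗ[ℂ] Ubar m n := toUbar ∘ₗ inW ∘ₗ wMul d

theorem theta_apply (d : Fin m ⊕ Fin n) (q : A m n) : theta d q = toUbar (inW (wMul d q)) := rfl

theorem theta_mul_iA {k l : ZMod 2} {q b : A m n} (hq : q ∈ aGr m n k) (hb : b ∈ aGr m n l)
    (d : Fin m ⊕ Fin n) :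
    theta d q * iA b = iA (q * pd d b) + sgn (k + pdPar d) l • (iA b * theta d q) :=
  toUbar_inW_mul_iA (wMul_mem hq d) hb

theorem dU_mul_theta {k : ZMod 2} {q : A m n} (hq : q ∈ aGr m n k) (d e : Fin m ⊕ Fin n) :
    dU e * theta d q = theta d (pd e q) + sgn (pdPar e) (k + pdPar d) • (theta d q * dU e) := by
  have := toUbar_inW_lie (F := wMul d (pd e q)) (D := wPd e) (pd_mem e) (wMul_mem hq d) ?_
  · rw [theta_apply, theta_apply, this, dU, sub_add_cancel]
  · refine LinearMap.ext fun p => ?_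
    change pd e q * pd d p = pd e (q * pd d p) - sgn (pdPar e) (k + pdPar d) • (q * pd d (pd e p))
    rw [(pd_mem e).2 k q hq, pd_pd e d, mul_smul_comm, smul_smul, sgn_add_right,
      add_sub_cancel_right]

theorem parU_theta {k : ZMod 2} {q : A m n} (hq : q ∈ aGr m n k) (d : Fin m ⊕ Fin n) :
    parU m n (theta d q) = sgn 1 (k + pdPar d) • theta d q :=
  parU_toUbar (inW_mem_gr (wMul_mem hq d))

/-! ### The bimodule `A ⊗ A` of coefficients -/

/-- The map `p ⊗ q ↦ p · q ∂_d` from `A ⊗ A` to `Ū`. -/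
def bU (d : Fin m ⊕ Fin n) : A m n ⊗[ℂ] A m n →ₗ[ℂ] Ubar m n :=
  TensorProduct.lift ((LinearMap.mul ℂ (Ubar m n)).compl₁₂ iA.toLinearMap (theta d))

theorem bU_tmul (d : Fin m ⊕ Fin n) (p q : A m n) : bU d (p ⊗ₜ q) = iA p * theta d q := rfl

/-- The homogeneous part of parity `k` of `A ⊗ A`. -/
def homTensor (m n : ℕ) (k : ZMod 2) : Submodule ℂ (A m n ⊗[ℂ] A m n) :=
  Submodule.span ℂ {z | ∃ i j p q, p ∈ aGr m n i ∧ q ∈ aGr m n j ∧ i + j = k ∧ z = p ⊗ₜ q}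

/-- Left multiplication by `1 ⊗ x_d - x_d ⊗ 1` in the super tensor product `A ⊗ A`. -/
def lamOp (d : Fin m ⊕ Fin n) : A m n ⊗[ℂ] A m n →ₗ[ℂ] A m n ⊗[ℂ] A m n :=
  TensorProduct.map (sigma (m := m) (n := n) (pdPar d)).toLinearMap (LinearMap.mulLeft ℂ (gen d)) +
    (-1 : ℂ) • TensorProduct.map (LinearMap.mulLeft ℂ (gen d)) (LinearMap.id : A m n →ₗ[ℂ] A m n)

/-- The action of `∂_d` on the super tensor product `A ⊗ A`. -/
def hatPd (d : Fin m ⊕ Fin n) : A m n ⊗[ℂ] A m n →ₗ[ℂ] A m n ⊗[ℂ] A m n :=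
  TensorProduct.map (pd d) (LinearMap.id : A m n →ₗ[ℂ] A m n) +
    TensorProduct.map (sigma (m := m) (n := n) (pdPar d)).toLinearMap (pd d)

/-- The multiplication of `A`. -/
def mulA (m n : ℕ) : A m n ⊗[ℂ] A m n →ₗ[ℂ] A m n :=
  TensorProduct.lift (Algebra.lmul ℂ (A m n)).toLinearMap

theorem mulA_tmul (p q : A m n) : mulA m n (p ⊗ₜ q) = p * q := rfl

theorem lamOp_tmul (d : Fin m ⊕ Fin n) (p q : A m n) :
    lamOp d (p ⊗ₜ q) =
      sigma (pdPar d) p ⊗ₜ (gen d * q) + (-1 : ℂ) • ((gen d * p) ⊗ₜ q) := rfl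

/-- Cancellation in an additive monoid: the minus sign of `lamOp` is written as the scalar `-1`, so
no negation on `A ⊗ A` is involved. -/
theorem add_neg_one_smul {N : Type*} [AddCommMonoid N] [Module ℂ N] (v : N) :
    v + (-1 : ℂ) • v = 0 := by
  have h := add_smul (1 : ℂ) (-1) v
  rwa [add_neg_cancel, zero_smul, one_smul, eq_comm] at h

theorem hatPd_tmul (d : Fin m ⊕ Fin n) (p q : A m n) :
    hatPd d (p ⊗ₜ q) = pd d p ⊗ₜ q + sigma (pdPar d) p ⊗ₜ pd d q := rfl

theorem mulA_lamOp (d : Fin m ⊕ Fin n) (z : A m n ⊗[ℂ] A m n) : mulA m n (lamOp d z) = 0 := by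
  induction z using TensorProduct.induction_on with
  | zero => simp
  | add x y hx hy => rw [map_add, map_add, hx, hy, add_zero]
  | tmul p q =>
    rw [lamOp_tmul, map_add, map_smul, mulA_tmul, mulA_tmul, gen_mul d p, mul_assoc,
      add_neg_one_smul]

/-- The diagonal `∂_e` obeys the super Leibniz rule, and it kills `1 ⊗ x_d - x_d ⊗ 1` because both
terms have the same derivative, `1` or `0`. The two contributions `h4` cancel and only the sign
remains. -/
theorem hatPd_lamOp (d e : Fin m ⊕ Fin n) (z : A m n ⊗[ℂ] A m n) :
    hatPd e (lamOp d z) = sgn (pdPar e) (pdPar d) • lamOp d (hatPd e z) := by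
  induction z using TensorProduct.induction_on with
  | zero => simp
  | add x y hx hy => rw [map_add, map_add, hx, hy, map_add, map_add, smul_add]
  | tmul p q =>
    have h1 : pd e (sigma (pdPar d) p) =
        sgn (pdPar e) (pdPar d) • sigma (pdPar d) (pd e p) := by
      rw [sigma_pd, sgn_comm, sgn_smul_smul]
    have h2 : sigma (pdPar e) (gen d : A m n) = sgn (pdPar e) (pdPar d) • gen d :=
      sigma_apply (gen_mem d)
    have h3 : sigma (pdPar e) (sigma (pdPar d) p) = sigma (pdPar d) (sigma (pdPar e) p) := by
      rw [← sigma_add, ← sigma_add, add_comm]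
    have h4 : (sigma (pdPar e) (sigma (pdPar d) p)) ⊗ₜ[ℂ] (pd e (gen d) * q) =
        (pd e (gen d) * p) ⊗ₜ[ℂ] q := by
      rw [pd_gen]
      split_ifs with h
      · rw [h, sigma_sigma, one_mul, one_mul]
      · rw [zero_mul, zero_mul, TensorProduct.tmul_zero, TensorProduct.zero_tmul]
    rw [lamOp_tmul, hatPd_tmul, map_add, map_smul, map_add, hatPd_tmul, hatPd_tmul, lamOp_tmul,
      lamOp_tmul, pd_mul, pd_mul, TensorProduct.tmul_add, TensorProduct.add_tmul, h4, h1, map_mul,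
      h2, h3]
    have h5 := add_neg_one_smul ((pd e (gen d) * p) ⊗ₜ[ℂ] q)
    generalize (pd e (gen d) * p) ⊗ₜ[ℂ] q = y at h5 ⊢
    simp only [smul_mul_assoc, TensorProduct.tmul_smul, ← TensorProduct.smul_tmul', smul_add,
      smul_comm (sgn _ _) (-1 : ℂ)]
    refine Eq.trans ?_ ((congrArg (HAdd.hAdd _) h5).trans (add_zero _))
    abel

/-- The failure of `bU d z` to supercommute with `A` depends on `z` only through its product in `A`,
so it vanishes on the kernel of multiplication. -/
theorem bU_mul_iA {k l : ZMod 2} {z : A m n ⊗[ℂ] A m n} (hz : z ∈ homTensor m n k) {b : A m n}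
    (hb : b ∈ aGr m n l) (d : Fin m ⊕ Fin n) :
    bU d z * iA b = iA (mulA m n z * pd d b) + sgn (k + pdPar d) l • (iA b * bU d z) := by
  induction hz using Submodule.span_induction with
  | mem z hz =>
    obtain ⟨i, j, p, q, hp, hq, rfl, rfl⟩ := hz
    rw [bU_tmul, mulA_tmul, mul_assoc, theta_mul_iA hq hb, mul_add, ← map_mul, ← mul_assoc,
      mul_smul_comm, ← mul_assoc, ← mul_assoc, ← map_mul, ← map_mul, aGr_mul_comm hp hb, map_smul,
      smul_mul_assoc, smul_smul, add_assoc i, sgn_add_left i, mul_comm (sgn i l)]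
  | zero => simp
  | add x y _ _ hx hy =>
    rw [map_add, add_mul, hx, hy, map_add, add_mul, map_add, mul_add, smul_add]; abel
  | smul c x _ hx =>
    rw [map_smul, smul_mul_assoc, hx, map_smul, smul_mul_assoc, map_smul, mul_smul_comm, smul_add,
      smul_comm c]

/-- The supercommutator with `∂_e` differentiates the coefficients in both tensor factors, since it
sends `q ∂_d` to `∂_e(q) ∂_d`; it therefore vanishes when `z` lies in `hatKer`. -/
theorem dU_mul_bU {k : ZMod 2} {z : A m n ⊗[ℂ] A m n} (hz : z ∈ homTensor m n k)
    (d e : Fin m ⊕ Fin n) :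
    dU e * bU d z = bU d (hatPd e z) + sgn (pdPar e) (k + pdPar d) • (bU d z * dU e) := by
  induction hz using Submodule.span_induction with
  | mem z hz =>
    obtain ⟨i, j, p, q, hp, hq, rfl, rfl⟩ := hz
    rw [bU_tmul, hatPd_tmul, map_add, bU_tmul, bU_tmul, ← mul_assoc, dU_mul_iA, add_mul,
      mul_assoc _ (dU e), dU_mul_theta hq, mul_add, sigma_apply hp, map_smul, mul_smul_comm,
      smul_mul_assoc, smul_mul_assoc, smul_smul, add_assoc i, sgn_add_right _ i,
      mul_comm (sgn _ i), ← mul_assoc, add_assoc]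
  | zero => simp
  | add x y _ _ hx hy =>
    rw [map_add, mul_add, hx, hy, map_add, map_add, add_mul, smul_add]; abel
  | smul c x _ hx =>
    rw [map_smul, mul_smul_comm, hx, map_smul, map_smul, smul_mul_assoc, smul_add, smul_comm c]

theorem parU_bU {k : ZMod 2} {z : A m n ⊗[ℂ] A m n} (hz : z ∈ homTensor m n k)
    (d : Fin m ⊕ Fin n) : parU m n (bU d z) = sgn 1 (k + pdPar d) • bU d z := by
  induction hz using Submodule.span_induction with
  | mem z hz =>
    obtain ⟨i, j, p, q, hp, hq, rfl, rfl⟩ := hz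
    rw [bU_tmul, map_mul, parU_theta hq, parU_iA, sigma_apply hp, map_smul, smul_mul_assoc,
      mul_smul_comm, smul_smul, add_assoc i, sgn_add_right 1 i]
  | zero => simp
  | add x y _ _ hx hy => rw [map_add, map_add, hx, hy, smul_add]
  | smul c x _ hx => rw [map_smul, map_smul, hx, smul_comm c]

theorem actA_bU_one (d : Fin m ⊕ Fin n) (z : A m n ⊗[ℂ] A m n) : actA m n (bU d z) 1 = 0 := by
  induction z using TensorProduct.induction_on with
  | zero => simp
  | add x y hx hy => rw [map_add, map_add, LinearMap.add_apply, hx, hy, add_zero]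
  | tmul p q =>
    rw [bU_tmul, map_mul, Module.End.mul_apply, theta_apply, actA_inW, wMul_apply, pd_one,
      mul_zero, map_zero]

/-! ### The coefficients of `X_{α,I,∂}` -/

theorem sgn_one_natCast (k : ℕ) : sgn 1 (k : ZMod 2) = (-1) ^ k := by
  induction k with
  | zero => rw [Nat.cast_zero, sgn_zero_right, pow_zero]
  | succ k ih => rw [Nat.cast_succ, sgn_add_right, ih, sgn_one_one, pow_succ]

theorem tau_eq_sum (J K : Finset (Fin n)) :
    tau J K = ∑ x ∈ J, ∑ k ∈ K, if k < x then 1 else 0 := by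
  rw [tau, Finset.card_filter, Finset.sum_product]

theorem tau_insert_right {j : Fin n} {J K : Finset (Fin n)} (hJ : ∀ i ∈ J, j < i) (hK : j ∉ K) :
    tau J (insert j K) = J.card + tau J K := by
  rw [tau_eq_sum, tau_eq_sum, Finset.card_eq_sum_ones, ← Finset.sum_add_distrib]
  refine Finset.sum_congr rfl fun x hx => ?_
  rw [Finset.sum_insert hK, if_pos (hJ x hx)]

theorem tau_insert_left {j : Fin n} {J K : Finset (Fin n)} (hJ : j ∉ J) (hK : ∀ i ∈ K, j < i) :
    tau (insert j J) K = tau J K := by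
  rw [tau_eq_sum, tau_eq_sum, Finset.sum_insert hJ, Finset.sum_eq_zero, zero_add]
  intro k hk
  rw [if_neg (hK k hk).not_gt]

theorem mono_insert {j : Fin n} {I : Finset (Fin n)} (h : ∀ i ∈ I, j < i) :
    (mono 0 (insert j I) : A m n) = gen (Sum.inr j) * mono 0 I := by
  rw [mono, xiProd_insert h, mono, gen, Algebra.TensorProduct.tmul_mul_tmul, one_mul]

/-- The element `∑_J ± ξ_J ⊗ ξ_{I∖J}` of `A ⊗ A`. -/
def zXi (m : ℕ) {n : ℕ} (I : Finset (Fin n)) : A m n ⊗[ℂ] A m n :=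
  ∑ J ∈ I.powerset, ((-1 : ℂ) ^ (J.card + tau J (I \ J))) • (mono 0 J ⊗ₜ mono 0 (I \ J))

theorem zXi_empty : zXi m (∅ : Finset (Fin n)) = 1 ⊗ₜ 1 := by
  simp [zXi, tau, mono_zero_empty]

/-- The subsets of `insert j I` without and with `j` give the two terms of `lamOp`. As `j` is
minimal, putting `ξ_j` in the second factor raises `tau` by the number of elements of `J`, which is
the sign of `sigma 1` on `ξ_J`; putting it in the first factor leaves `tau` unchanged and raises the
cardinality by one, which gives the `-1`. -/
theorem zXi_insert {j : Fin n} {I : Finset (Fin n)} (h : ∀ i ∈ I, j < i) :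
    zXi m (insert j I) = lamOp (Sum.inr j) (zXi m I) := by
  have hj : j ∉ I := fun hj => lt_irrefl _ (h j hj)
  rw [zXi, Finset.sum_powerset_insert hj, zXi, map_sum, ← Finset.sum_add_distrib]
  refine Finset.sum_congr rfl fun J hJ => ?_
  have hJI := Finset.mem_powerset.1 hJ
  have hjJ : j ∉ J := fun hj' => hj (hJI hj')
  have hJ' : ∀ i ∈ J, j < i := fun i hi => h i (hJI hi)
  have hK' : ∀ i ∈ I \ J, j < i := fun i hi => h i (Finset.mem_sdiff.1 hi).1
  have e1 : insert j I \ J = insert j (I \ J) := Finset.insert_sdiff_of_notMem _ hjJ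
  have e2 : insert j I \ insert j J = I \ J := by
    ext i
    simp only [Finset.mem_sdiff, Finset.mem_insert]
    constructor
    · rintro ⟨rfl | h1, h2⟩
      · exact absurd (Or.inl rfl) h2
      · exact ⟨h1, fun h3 => h2 (Or.inr h3)⟩
    · rintro ⟨h1, h2⟩
      exact ⟨Or.inr h1, fun h3 => h3.elim (fun h4 => hj (h4 ▸ h1)) h2⟩
  rw [e1, e2, tau_insert_right hJ' (fun h' => hj (Finset.mem_sdiff.1 h').1),
    tau_insert_left hjJ hK', Finset.card_insert_of_notMem hjJ, mono_insert hK', mono_insert hJ',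
    map_smul, lamOp_tmul, sigma_apply (mono_mem 0 J)]
  have : pdPar (Sum.inr j : Fin m ⊕ Fin n) = 1 := rfl
  rw [this, sgn_one_natCast, smul_add, ← TensorProduct.smul_tmul', smul_smul, smul_smul]
  rw [show J.card + 1 + tau J (I \ J) = J.card + tau J (I \ J) + 1 by ring, pow_succ,
    show J.card + (J.card + tau J (I \ J)) = J.card + tau J (I \ J) + J.card by ring,
    pow_add _ _ J.card]

/-- The elements of `A ⊗ A` that are killed by all partial derivatives. -/
def hatKer (m n : ℕ) : Submodule ℂ (A m n ⊗[ℂ] A m n) :=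
  ⨅ d, LinearMap.ker (hatPd d)

theorem mem_hatKer {z : A m n ⊗[ℂ] A m n} : z ∈ hatKer m n ↔ ∀ d, hatPd d z = 0 := by
  simp [hatKer]

theorem lamOp_mem_hatKer (d : Fin m ⊕ Fin n) {z : A m n ⊗[ℂ] A m n} (hz : z ∈ hatKer m n) :
    lamOp d z ∈ hatKer m n := by
  rw [mem_hatKer] at hz ⊢
  intro e
  rw [hatPd_lamOp, hz, map_zero, smul_zero]

theorem zXi_mem_hatKer (I : Finset (Fin n)) : zXi m I ∈ hatKer m n := by
  induction I using Finset.induction_on_min with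
  | empty =>
    rw [zXi_empty, mem_hatKer]
    intro d
    rw [hatPd_tmul, pd_one, TensorProduct.zero_tmul, TensorProduct.tmul_zero, add_zero]
  | insert j I hj ih => rw [zXi_insert hj]; exact lamOp_mem_hatKer _ ih

theorem mulA_zXi {I : Finset (Fin n)} (hI : I ≠ ∅) : mulA m n (zXi m I) = 0 := by
  induction I using Finset.induction_on_min with
  | empty => exact absurd rfl hI
  | insert j I hj ih => rw [zXi_insert hj, mulA_lamOp]

/-- The element `∑_β ± binom(α, β) t^β ⊗ t^{α-β}`. -/
def zT (α : Fin m →₀ ℕ) : MvPolynomial (Fin m) ℂ ⊗[ℂ] MvPolynomial (Fin m) ℂ :=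
  ∑ β ∈ Finset.Iic α, ((-1 : ℂ) ^ (∑ k, β k) * ((∏ k, (α k).choose (β k) : ℕ) : ℂ)) •
    (MvPolynomial.monomial β 1 ⊗ₜ MvPolynomial.monomial (α - β) 1)

theorem sum_Iic_eq_prod_pow {R : Type*} [CommRing R] (x y : Fin m → R) (α : Fin m →₀ ℕ) :
    ∑ β ∈ Finset.Iic α, ((∏ k, (α k).choose (β k) : ℕ) : R) *
      ((∏ k, x k ^ β k) * ∏ k, y k ^ (α - β) k) = ∏ k, (x k + y k) ^ α k := by
  simp only [add_pow]
  rw [Finset.prod_univ_sum]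
  refine Finset.sum_bij' (fun β _ => ⇑β) (fun f _ => Finsupp.equivFunOnFinite.symm f) ?_ ?_ ?_ ?_ ?_
  · intro β hβ
    rw [Fintype.mem_piFinset]
    intro k
    exact Finset.mem_range_succ_iff.2 (Finset.mem_Iic.1 hβ k)
  · intro f hf
    rw [Fintype.mem_piFinset] at hf
    rw [Finset.mem_Iic]
    exact fun k => Finset.mem_range_succ_iff.1 (hf k)
  · intro β _
    exact Finsupp.ext fun k => rfl
  · intro f _
    rfl
  · intro β _
    rw [Nat.cast_prod, ← Finset.prod_mul_distrib, ← Finset.prod_mul_distrib]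
    refine Finset.prod_congr rfl fun k _ => ?_
    rw [Finsupp.coe_tsub, Pi.sub_apply]
    ring

theorem monomial_eq_prod (β : Fin m →₀ ℕ) :
    MvPolynomial.monomial β (1 : ℂ) = ∏ k, MvPolynomial.X k ^ β k := by
  rw [MvPolynomial.monomial_eq, map_one, one_mul, Finsupp.prod_fintype]
  exact fun _ => pow_zero _

theorem sum_Iic_eq_prod_map {B : Type*} [CommRing B] [Algebra ℂ B]
    (f g : MvPolynomial (Fin m) ℂ →ₐ[ℂ] B) (α : Fin m →₀ ℕ) :
    ∑ β ∈ Finset.Iic α, ((-1 : ℂ) ^ (∑ k, β k) * ((∏ k, (α k).choose (β k) : ℕ) : ℂ)) •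
      (f (MvPolynomial.monomial β 1) * g (MvPolynomial.monomial (α - β) 1)) =
    ∏ k, (g (MvPolynomial.X k) + (-1 : ℂ) • f (MvPolynomial.X k)) ^ α k := by
  have h := sum_Iic_eq_prod_pow (fun k => -f (MvPolynomial.X k))
    (fun k => g (MvPolynomial.X k)) α
  have e : ∀ k, -f (MvPolynomial.X k) + g (MvPolynomial.X k) =
      g (MvPolynomial.X k) + (-1 : ℂ) • f (MvPolynomial.X k) := by
    intro k
    rw [neg_one_smul, add_comm]
  simp only [e] at h
  rw [← h]
  refine Finset.sum_congr rfl fun β _ => ?_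
  have h2 : ∏ k, (-f (MvPolynomial.X k)) ^ β k =
      (-1) ^ (∑ k, β k) * ∏ k, f (MvPolynomial.X k) ^ β k := by
    rw [← Finset.prod_pow_eq_pow_sum, ← Finset.prod_mul_distrib]
    exact Finset.prod_congr rfl fun k _ => neg_pow _ _
  rw [h2, monomial_eq_prod, monomial_eq_prod, map_prod, map_prod]
  simp only [map_pow]
  rw [Algebra.smul_def, map_mul, map_pow, map_neg, map_one, map_natCast]
  ring

/-- The binomial theorem in every variable: the signs and binomial coefficients of the even part of
`X_{α,I,∂}` come from powers of `1 ⊗ t_k - t_k ⊗ 1`. -/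
theorem zT_eq_prod (α : Fin m →₀ ℕ) :
    zT α = ∏ k, ((1 : MvPolynomial (Fin m) ℂ) ⊗ₜ[ℂ] MvPolynomial.X k +
      (-1 : ℂ) • (MvPolynomial.X k ⊗ₜ[ℂ] (1 : MvPolynomial (Fin m) ℂ))) ^ α k := by
  have h := sum_Iic_eq_prod_map (B := MvPolynomial (Fin m) ℂ ⊗[ℂ] MvPolynomial (Fin m) ℂ)
    (Algebra.TensorProduct.includeLeft (R := ℂ) (S := ℂ)) Algebra.TensorProduct.includeRight α
  simp only [Algebra.TensorProduct.includeLeft_apply, Algebra.TensorProduct.includeRight_apply,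
    Algebra.TensorProduct.tmul_mul_tmul, one_mul, mul_one] at h
  exact h

/-- The action of `ℂ[t]` on the first factor of `A ⊗ A`. -/
def actLeft (m n : ℕ) : MvPolynomial (Fin m) ℂ →ₐ[ℂ] Module.End ℂ (A m n ⊗[ℂ] A m n) :=
  ((Module.End.rTensorAlgHom ℂ (A m n) (A m n)).comp (Algebra.lmul ℂ (A m n))).comp
    Algebra.TensorProduct.includeLeft

/-- The action of `ℂ[t]` on the second factor of `A ⊗ A`. -/
def actRight (m n : ℕ) : MvPolynomial (Fin m) ℂ →ₐ[ℂ] Module.End ℂ (A m n ⊗[ℂ] A m n) :=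
  ((Module.End.lTensorAlgHom ℂ (A m n) (A m n)).comp (Algebra.lmul ℂ (A m n))).comp
    Algebra.TensorProduct.includeLeft

/-- The action of `ℂ[t] ⊗ ℂ[t]` on `A ⊗ A`. -/
def inclT (m n : ℕ) : MvPolynomial (Fin m) ℂ ⊗[ℂ] MvPolynomial (Fin m) ℂ →ₐ[ℂ]
    Module.End ℂ (A m n ⊗[ℂ] A m n) :=
  Algebra.TensorProduct.lift (actLeft m n) (actRight m n) fun f g => by
    refine LinearMap.ext fun z => ?_
    rw [Module.End.mul_apply, Module.End.mul_apply]
    induction z using TensorProduct.induction_on with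
    | zero => rw [map_zero, map_zero, map_zero]
    | add x y hx hy => rw [map_add, map_add, hx, hy, map_add, map_add]
    | tmul p q => rfl

theorem inclT_tmul (f g : MvPolynomial (Fin m) ℂ) (p q : A m n) :
    inclT m n (f ⊗ₜ g) (p ⊗ₜ q) = ((f ⊗ₜ 1) * p) ⊗ₜ ((g ⊗ₜ 1) * q) := rfl

theorem inclT_apply (i : Fin m) (z : A m n ⊗[ℂ] A m n) :
    inclT m n (1 ⊗ₜ MvPolynomial.X i + (-1 : ℂ) • (MvPolynomial.X i ⊗ₜ 1)) z = lamOp (Sum.inl i) z := by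
  induction z using TensorProduct.induction_on with
  | zero => rw [map_zero, map_zero]
  | add x y hx hy => rw [map_add, hx, hy, map_add]
  | tmul p q =>
    have h0 : pdPar (Sum.inl i : Fin m ⊕ Fin n) = 0 := rfl
    have h1 : (1 : MvPolynomial (Fin m) ℂ) ⊗ₜ[ℂ] (1 : Lam n) = 1 := rfl
    rw [lamOp_tmul, h0, sigma_zero, map_add, map_smul, LinearMap.add_apply,
      LinearMap.smul_apply, inclT_tmul, inclT_tmul, h1, one_mul, one_mul]
    rfl

theorem inclT_zT_mem_hatKer (α : Fin m →₀ ℕ) {z : A m n ⊗[ℂ] A m n} (hz : z ∈ hatKer m n) :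
    inclT m n (zT α) z ∈ hatKer m n := by
  rw [zT_eq_prod]
  refine Finset.prod_induction _ (fun w => ∀ z ∈ hatKer m n, inclT m n w z ∈ hatKer m n)
    ?_ ?_ ?_ z hz
  · intro w w' hw hw' z hz
    rw [map_mul, Module.End.mul_apply]
    exact hw _ (hw' _ hz)
  · intro z hz
    rwa [map_one, Module.End.one_apply]
  · intro k _
    induction α k with
    | zero => intro z hz; rwa [pow_zero, map_one, Module.End.one_apply]
    | succ l ih =>
      intro z hz
      rw [pow_succ, map_mul, Module.End.mul_apply]
      refine ih _ ?_
      rw [inclT_apply]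
      exact lamOp_mem_hatKer _ hz

/-- If `α i ≠ 0`, a factor `1 ⊗ t_i - t_i ⊗ 1` can be pulled to the front by commutativity, and
multiplication kills its image. -/
theorem mulA_inclT_zT {α : Fin m →₀ ℕ} (hα : α ≠ 0) (z : A m n ⊗[ℂ] A m n) :
    mulA m n (inclT m n (zT α) z) = 0 := by
  obtain ⟨i, hi⟩ := Finsupp.ne_iff.1 hα
  have h : (1 ⊗ₜ MvPolynomial.X i + (-1 : ℂ) • (MvPolynomial.X i ⊗ₜ 1)) ∣ zT α := by
    rw [zT_eq_prod]
    exact (dvd_pow_self _ hi).trans (Finset.dvd_prod_of_mem _ (Finset.mem_univ i))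
  obtain ⟨w, hw⟩ := h
  rw [hw, map_mul, Module.End.mul_apply, inclT_apply, mulA_lamOp]

/-- The element of `A ⊗ A` with image `X_{α,I,∂}`. -/
def zX (α : Fin m →₀ ℕ) (I : Finset (Fin n)) : A m n ⊗[ℂ] A m n := inclT m n (zT α) (zXi m I)

theorem zX_mem_hatKer (α : Fin m →₀ ℕ) (I : Finset (Fin n)) : zX α I ∈ hatKer m n :=
  inclT_zT_mem_hatKer α (zXi_mem_hatKer I)

theorem mulA_zX {α : Fin m →₀ ℕ} {I : Finset (Fin n)} (h : α ≠ 0 ∨ I ≠ ∅) :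
    mulA m n (zX α I) = 0 := by
  by_cases hα : α = 0
  · have hI := h.resolve_left (not_not.2 hα)
    have : zT (0 : Fin m →₀ ℕ) = 1 := by
      rw [zT_eq_prod]
      exact Finset.prod_eq_one fun k _ => pow_zero _
    rw [zX, hα, this, map_one, Module.End.one_apply, mulA_zXi hI]
  · exact mulA_inclT_zT hα _

theorem zX_eq_sum (α : Fin m →₀ ℕ) (I : Finset (Fin n)) :
    zX α I = ∑ β ∈ Finset.Iic α, ∑ J ∈ I.powerset,
      ((-1 : ℂ) ^ ((∑ k, β k) + J.card + tau J (I \ J)) *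
        ((∏ k, (α k).choose (β k) : ℕ) : ℂ)) • (mono β J ⊗ₜ mono (α - β) (I \ J)) := by
  rw [zX, zT, map_sum, LinearMap.sum_apply]
  refine Finset.sum_congr rfl fun β _ => ?_
  rw [zXi, map_sum]
  refine Finset.sum_congr rfl fun J _ => ?_
  have h : ∀ (γ : Fin m →₀ ℕ) (K : Finset (Fin n)),
      (MvPolynomial.monomial γ (1 : ℂ) ⊗ₜ[ℂ] (1 : Lam n)) * mono 0 K = mono γ K := by
    intro γ K
    rw [mono, Algebra.TensorProduct.tmul_mul_tmul, one_mul, MvPolynomial.monomial_mul, add_zero,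
      one_mul, mono]
  rw [map_smul, map_smul, LinearMap.smul_apply, inclT_tmul, h, h, smul_smul, add_assoc,
    pow_add _ (∑ k, β k)]
  congr 1
  ring

theorem zX_mem_homTensor (α : Fin m →₀ ℕ) (I : Finset (Fin n)) :
    zX α I ∈ homTensor m n (I.card : ZMod 2) := by
  rw [zX_eq_sum]
  refine Submodule.sum_mem _ fun β _ => Submodule.sum_mem _ fun J hJ => Submodule.smul_mem _ _
    (Submodule.subset_span ⟨_, _, _, _, mono_mem β J, mono_mem _ _, ?_, rfl⟩)
  rw [← Nat.cast_add, add_comm, Finset.card_sdiff_add_card_eq_card (Finset.mem_powerset.1 hJ)]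

/-- All later use of `X_{α,I,∂}` goes through this form, in which the double sum is replaced by a
product of operators `lamOp` applied to `1 ⊗ 1`. -/
theorem X_eq_bU (α : Fin m →₀ ℕ) (I : Finset (Fin n)) (d : Fin m ⊕ Fin n) :
    X α I d = bU d (zX α I) := by
  rw [zX_eq_sum, map_sum, X]
  refine Finset.sum_congr rfl fun β _ => ?_
  rw [map_sum]
  refine Finset.sum_congr rfl fun J _ => ?_
  rw [map_smul]
  rfl

/-! ### Properties of `T` -/

theorem tAlg_induction {k : ZMod 2} {P : Ubar m n → Prop} {x : Ubar m n}
    (hx : x ∈ (tAlg m n).gr k)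
    (h : ∀ α I d, (α ≠ 0 ∨ I ≠ ∅) → (I.card : ZMod 2) + pdPar d = k → P (bU d (zX α I)))
    (h0 : P 0) (ha : ∀ u v, P u → P v → P (u + v)) (hs : ∀ (c : ℂ) u, P u → P (c • u)) : P x := by
  refine Submodule.span_induction (p := fun x _ => P x) ?_ h0 (fun x y _ _ => ha x y)
    (fun c x _ => hs c x) hx
  rintro _ ⟨α, I, d, hαI, hk, rfl⟩
  rw [X_eq_bU]
  exact h α I d hαI hk

/-- The condition `|α| + |I| > 0` enters here: with at least one factor `1 ⊗ x_d - x_d ⊗ 1`, the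
product of the coefficients in `A` is zero. -/
theorem tAlg_mul_iA {k l : ZMod 2} {x : Ubar m n} (hx : x ∈ (tAlg m n).gr k) {b : A m n}
    (hb : b ∈ aGr m n l) : x * iA b = sgn k l • (iA b * x) := by
  refine tAlg_induction (P := fun x => x * iA b = sgn k l • (iA b * x)) hx ?_ ?_ ?_ ?_
  · rintro α I d h rfl
    rw [bU_mul_iA (zX_mem_homTensor α I) hb, mulA_zX h, zero_mul, map_zero, zero_add]
  · simp
  · intro u v hu hv
    rw [add_mul, mul_add, hu, hv, smul_add]
  · intro c u hu
    rw [smul_mul_assoc, mul_smul_comm, hu, smul_comm]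

theorem dU_mul_tAlg {k : ZMod 2} {x : Ubar m n} (hx : x ∈ (tAlg m n).gr k) (e : Fin m ⊕ Fin n) :
    dU e * x = sgn (pdPar e) k • (x * dU e) := by
  refine tAlg_induction (P := fun x => dU e * x = sgn (pdPar e) k • (x * dU e)) hx ?_ ?_ ?_ ?_
  · rintro α I d h rfl
    rw [dU_mul_bU (zX_mem_homTensor α I), mem_hatKer.1 (zX_mem_hatKer α I), map_zero, zero_add]
  · simp
  · intro u v hu hv
    rw [add_mul, mul_add, hu, hv, smul_add]
  · intro c u hu
    rw [smul_mul_assoc, mul_smul_comm, hu, smul_comm]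

theorem parU_tAlg {k : ZMod 2} {x : Ubar m n} (hx : x ∈ (tAlg m n).gr k) :
    parU m n x = sgn 1 k • x := by
  refine tAlg_induction (P := fun x => parU m n x = sgn 1 k • x) hx ?_ ?_ ?_ ?_
  · rintro α I d h rfl
    exact parU_bU (zX_mem_homTensor α I) d
  · simp
  · intro u v hu hv
    rw [map_add, hu, hv, smul_add]
  · intro c u hu
    rw [map_smul, hu, smul_comm]

/-- Elements of `T` kill `1`, since each of their terms has a derivation on the right; they
supercommute with multiplication by `p`, so they kill `p` as well. -/
theorem actA_tAlg {k : ZMod 2} {x : Ubar m n} (hx : x ∈ (tAlg m n).gr k) : actA m n x = 0 := by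
  have h1 : actA m n x 1 = 0 := by
    refine tAlg_induction (P := fun x => actA m n x 1 = 0) hx ?_ ?_ ?_ ?_
    · rintro α I d h rfl
      exact actA_bU_one d _
    · simp
    · intro u v hu hv
      rw [map_add, LinearMap.add_apply, hu, hv, add_zero]
    · intro c u hu
      rw [map_smul, LinearMap.smul_apply, hu, smul_zero]
  refine LinearMap.ext fun p => ?_
  induction p using homogeneous_induction with
  | h l p hp =>
    have h2 : actA m n (x * iA p) 1 = actA m n x p := by
      rw [map_mul, Module.End.mul_apply, actA_iA, mul_one]
    rw [← h2, tAlg_mul_iA hx hp, map_smul, LinearMap.smul_apply, map_mul, Module.End.mul_apply, h1,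
      map_zero, smul_zero, LinearMap.zero_apply]
  | ha p q hp hq => rw [map_add, hp, hq, map_add]

theorem tAlg_gr_le_total (k : ZMod 2) : (tAlg m n).gr k ≤ (tAlg m n).total :=
  Submodule.span_mono fun _ ⟨α, I, d, h, _, hx⟩ => ⟨α, I, d, h, hx⟩

theorem exists_add_of_mem_tAlg {x : Ubar m n} (hx : x ∈ (tAlg m n).total) :
    ∃ x₀ ∈ (tAlg m n).gr 0, ∃ x₁ ∈ (tAlg m n).gr 1, x = x₀ + x₁ := by
  induction hx using Submodule.span_induction with
  | mem x hx =>
    obtain ⟨α, I, d, h, rfl⟩ := hx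
    rcases parity_cases ((I.card : ZMod 2) + pdPar d) with hk | hk
    · exact ⟨X α I d, Submodule.subset_span ⟨α, I, d, h, hk, rfl⟩, 0, Submodule.zero_mem _,
        (add_zero _).symm⟩
    · exact ⟨0, Submodule.zero_mem _, X α I d, Submodule.subset_span ⟨α, I, d, h, hk, rfl⟩,
        (zero_add _).symm⟩
  | zero => exact ⟨0, Submodule.zero_mem _, 0, Submodule.zero_mem _, (add_zero _).symm⟩
  | add x y _ _ hx hy =>
    obtain ⟨x₀, h₀, x₁, h₁, rfl⟩ := hx
    obtain ⟨y₀, h₂, y₁, h₃, rfl⟩ := hy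
    exact ⟨_, Submodule.add_mem _ h₀ h₂, _, Submodule.add_mem _ h₁ h₃, by abel⟩
  | smul c x _ hx =>
    obtain ⟨x₀, h₀, x₁, h₁, rfl⟩ := hx
    exact ⟨_, Submodule.smul_mem _ c h₀, _, Submodule.smul_mem _ c h₁, smul_add _ _ _⟩

/-! ### Graded `A`-spans -/

section ASpan

variable {E E' : Type*} [Ring E] [Algebra ℂ E] [Ring E'] [Algebra ℂ E']

/-- The part of parity `i` of the `A`-module generated by sets `S k` of elements of parity `k`. -/
def aSpan (ℓ : A m n →ₐ[ℂ] E) (S : ZMod 2 → Set E) (i : ZMod 2) : Submodule ℂ E :=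
  Submodule.span ℂ {z | ∃ j k p s, p ∈ aGr m n j ∧ s ∈ S k ∧ j + k = i ∧ z = ℓ p * s}

theorem mul_mem_aSpan {ℓ : A m n →ₐ[ℂ] E} {S : ZMod 2 → Set E} {i j : ZMod 2} {q : A m n}
    (hq : q ∈ aGr m n j) {z : E} (hz : z ∈ aSpan ℓ S i) : ℓ q * z ∈ aSpan ℓ S (j + i) := by
  induction hz using Submodule.span_induction with
  | mem z hz =>
    obtain ⟨k, l, p, s, hp, hs, rfl, rfl⟩ := hz
    rw [← mul_assoc, ← map_mul, ← add_assoc]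
    exact Submodule.subset_span ⟨_, _, _, _, aGr_mul hq hp, hs, rfl, rfl⟩
  | zero => rw [mul_zero]; exact Submodule.zero_mem _
  | add x y _ _ hx hy => rw [mul_add]; exact Submodule.add_mem _ hx hy
  | smul c x _ hx => rw [mul_smul_comm]; exact Submodule.smul_mem _ _ hx

theorem subset_aSpan {ℓ : A m n →ₐ[ℂ] E} {S : ZMod 2 → Set E} {i : ZMod 2} {s : E}
    (hs : s ∈ S i) : s ∈ aSpan ℓ S i :=
  Submodule.subset_span ⟨0, i, 1, s, one_mem_aGr, hs, zero_add i, by rw [map_one, one_mul]⟩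

theorem aSpan_le {ℓ : A m n →ₐ[ℂ] E} {S S' : ZMod 2 → Set E}
    (h : ∀ k, ∀ s ∈ S k, s ∈ aSpan ℓ S' k) (i : ZMod 2) : aSpan ℓ S i ≤ aSpan ℓ S' i := by
  refine Submodule.span_le.2 ?_
  rintro _ ⟨j, k, p, s, hp, hs, rfl, rfl⟩
  exact mul_mem_aSpan hp (h k s hs)

theorem exists_of_mem_aSpan {ℓ : A m n →ₐ[ℂ] E} {ℓ' : A m n →ₐ[ℂ] E'} {S : ZMod 2 → Set E}
    {S' : ZMod 2 → Set E'} (π : E →ₐ[ℂ] E') (hℓ : ∀ p, π (ℓ p) = ℓ' p)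
    (hS : ∀ k, ∀ s ∈ S' k, ∃ t ∈ S k, π t = s) {i : ZMod 2} {z : E'} (hz : z ∈ aSpan ℓ' S' i) :
    ∃ w ∈ aSpan ℓ S i, π w = z := by
  have : aSpan ℓ' S' i ≤ (aSpan ℓ S i).map π.toLinearMap := by
    refine Submodule.span_le.2 ?_
    rintro _ ⟨j, k, p, s, hp, hs, rfl, rfl⟩
    obtain ⟨t, ht, rfl⟩ := hS k s hs
    refine ⟨ℓ p * t, Submodule.subset_span ⟨j, k, p, t, hp, ht, rfl, rfl⟩, ?_⟩
    rw [AlgHom.toLinearMap_apply, map_mul, hℓ]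
  exact this hz

/-- The super Leibniz rule writes the bracket of `ℓ p * s` and `ℓ q * t` as an `A`-combination of
`s`, `t` and the bracket of `s` and `t`. So closure has to be checked only on the generating sets.
-/
theorem aSpan_bracket {ℓ : A m n →ₐ[ℂ] E} {S : ZMod 2 → Set E}
    (h1 : ∀ k l, ∀ s ∈ S k, ∀ q ∈ aGr m n l, ∃ q' ∈ aGr m n (k + l),
      s * ℓ q = ℓ q' + sgn k l • (ℓ q * s))
    (h2 : ∀ k l, ∀ s ∈ S k, ∀ t ∈ S l, s * t - sgn k l • (t * s) ∈ aSpan ℓ S (k + l))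
    {i j : ZMod 2} {z w : E} (hz : z ∈ aSpan ℓ S i) (hw : w ∈ aSpan ℓ S j) :
    z * w - sgn i j • (w * z) ∈ aSpan ℓ S (i + j) := by
  induction hz using Submodule.span_induction with
  | zero => simp
  | add x y _ _ hx hy =>
    have : (x + y) * w - sgn i j • (w * (x + y)) =
      (x * w - sgn i j • (w * x)) + (y * w - sgn i j • (w * y)) := by
      rw [add_mul, mul_add, smul_add]; abel
    rw [this]; exact Submodule.add_mem _ hx hy
  | smul c x _ hx =>
    rw [smul_mul_assoc, mul_smul_comm, smul_comm, ← smul_sub]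
    exact Submodule.smul_mem _ _ hx
  | mem z hz =>
    induction hw using Submodule.span_induction with
    | zero => simp
    | add x y _ _ hx hy =>
      have : z * (x + y) - sgn i j • ((x + y) * z) =
        (z * x - sgn i j • (x * z)) + (z * y - sgn i j • (y * z)) := by
        rw [add_mul, mul_add, smul_add]; abel
      rw [this]; exact Submodule.add_mem _ hx hy
    | smul c x _ hx =>
      rw [smul_mul_assoc, mul_smul_comm, smul_comm, ← smul_sub]
      exact Submodule.smul_mem _ _ hx
    | mem w hw =>
      obtain ⟨i, k, p, s, hp, hs, rfl, rfl⟩ := hz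
      obtain ⟨j, l, q, t, hq, ht, rfl, rfl⟩ := hw
      obtain ⟨q', hq', e1⟩ := h1 k j s hs q hq
      obtain ⟨p', hp', e2⟩ := h1 l i t ht p hp
      have e3 : ℓ p * s * (ℓ q * t) = ℓ (p * q') * t + sgn k j • (ℓ (p * q) * (s * t)) := by
        rw [mul_assoc, ← mul_assoc s, e1, map_mul, map_mul, add_mul, mul_add, smul_mul_assoc,
          mul_smul_comm]
        simp only [mul_assoc]
      have e4 : ℓ q * t * (ℓ p * s) =
          ℓ (q * p') * s + (sgn l i * sgn j i) • (ℓ (p * q) * (t * s)) := by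
        have e7 : ℓ q * ℓ p = sgn j i • ℓ (p * q) := by
          rw [← map_mul, aGr_mul_comm hq hp, map_smul]
        rw [mul_assoc, ← mul_assoc t, e2, add_mul, mul_add, smul_mul_assoc, mul_smul_comm,
          mul_assoc (ℓ p), ← mul_assoc, ← mul_assoc (ℓ q) (ℓ p), e7, smul_mul_assoc, smul_smul,
          map_mul ℓ q p']
      have e5 : ℓ p * s * (ℓ q * t) - sgn (i + k) (j + l) • (ℓ q * t * (ℓ p * s)) =
          ℓ (p * q') * t - sgn (i + k) (j + l) • (ℓ (q * p') * s) +
            sgn k j • (ℓ (p * q) * (s * t - sgn k l • (t * s))) := by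
        have e6 : sgn (i + k) (j + l) * (sgn l i * sgn j i) = sgn k j * sgn k l := by
          rw [sgn_add_left, sgn_add_right, sgn_add_right, sgn_comm l i, sgn_comm j i]
          have h3 := sgn_mul_self i j
          have h4 := sgn_mul_self i l
          linear_combination (sgn k j * sgn k l * sgn i l * sgn i l) * h3 +
            (sgn k j * sgn k l) * h4
        rw [e3, e4, smul_add, smul_smul, e6, mul_sub, mul_smul_comm, smul_sub, smul_smul]
        abel
      rw [e5]
      have f1 : i + k + (j + l) = i + (k + j) + l := by abel
      have f2 : i + k + (j + l) = j + (l + i) + k := by abel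
      have f3 : i + k + (j + l) = i + j + (k + l) := by abel
      refine Submodule.add_mem _ (Submodule.sub_mem _ ?_ (Submodule.smul_mem _ _ ?_))
        (Submodule.smul_mem _ _ ?_)
      · rw [f1]
        exact mul_mem_aSpan (aGr_mul hp hq') (subset_aSpan ht)
      · rw [f2]
        exact mul_mem_aSpan (aGr_mul hq hp') (subset_aSpan hs)
      · rw [f3]
        exact mul_mem_aSpan (aGr_mul hp hq) (h2 k l s hs t ht)

/-- Generators over `A` of a Lie superalgebra like `W̃`: the unit, the images of the partial
derivatives and the image of `T`. -/
def wSet (δ : Fin m ⊕ Fin n → E) (τ : ZMod 2 → (tAlg m n).total →ₗ[ℂ] E) (k : ZMod 2) : Set E :=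
  {s | (k = 0 ∧ s = 1) ∨ (∃ d, pdPar d = k ∧ s = δ d) ∨
    ∃ x : (tAlg m n).total, x.1 ∈ (tAlg m n).gr k ∧ s = τ k x}

/-- There is one element of `T` for each parity because `τ k` depends on `k`: on `A ⊗ V` it carries
the Koszul sign. -/
theorem exists_of_mem_span_wSet {δ : Fin m ⊕ Fin n → E}
    {τ : ZMod 2 → (tAlg m n).total →ₗ[ℂ] E} {v : E}
    (hv : v ∈ Submodule.span ℂ (⋃ k, wSet δ τ k)) :
    ∃ (c : ℂ) (c' : Fin m ⊕ Fin n → ℂ) (x : ZMod 2 → (tAlg m n).total),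
      (∀ k, (x k).1 ∈ (tAlg m n).gr k) ∧
      v = c • (1 : E) + ∑ d, c' d • δ d + ∑ k, τ k (x k) := by
  classical
  induction hv using Submodule.span_induction with
  | mem v hv =>
    obtain ⟨k, hk⟩ := Set.mem_iUnion.1 hv
    rcases hk with ⟨rfl, rfl⟩ | ⟨d, rfl, rfl⟩ | ⟨x, hx, rfl⟩
    · exact ⟨1, 0, 0, fun _ => Submodule.zero_mem _, by simp⟩
    · exact ⟨0, Pi.single d 1, 0, fun _ => Submodule.zero_mem _, by
        simp [Pi.single_apply, ite_smul]⟩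
    · refine ⟨0, 0, Pi.single k x, fun l => ?_, ?_⟩
      · by_cases h : l = k
        · subst h; rwa [Pi.single_eq_same]
        · rw [Pi.single_eq_of_ne h]; exact Submodule.zero_mem _
      · rw [Finset.sum_eq_single k]
        · simp
        · intro l _ h; rw [Pi.single_eq_of_ne h, map_zero]
        · simp
  | zero => exact ⟨0, 0, 0, fun _ => Submodule.zero_mem _, by simp⟩
  | add v w _ _ hv hw =>
    obtain ⟨c, c', x, hx, rfl⟩ := hv
    obtain ⟨e, e', y, hy, rfl⟩ := hw
    refine ⟨c + e, c' + e', x + y, fun k => Submodule.add_mem _ (hx k) (hy k), ?_⟩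
    simp only [Pi.add_apply, map_add, add_smul, Finset.sum_add_distrib]
    abel
  | smul r v _ hv =>
    obtain ⟨c, c', x, hx, rfl⟩ := hv
    refine ⟨r * c, r • c', r • x, fun k => Submodule.smul_mem _ _ (hx k), ?_⟩
    simp only [Pi.smul_apply, map_smul, smul_add, Finset.smul_sum, smul_smul, smul_eq_mul]

end ASpan

/-! ### `W̃` is contained in the `A`-span of `1`, the partial derivatives and `T` -/

/-- The generators of `W̃` over `A`, in `Ū`. -/
abbrev uSet (m n : ℕ) : ZMod 2 → Set (Ubar m n) :=
  wSet dU fun _ => (tAlg m n).total.subtype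

/-- Splitting off the summand with `β = 0`, `J = ∅` shows that `X_{α,I,∂}` is `t^α ξ_I ∂` up to
`A`-multiples of such elements with smaller `|α| + |I|`. -/
theorem X_eq_theta_add (α : Fin m →₀ ℕ) (I : Finset (Fin n)) (d : Fin m ⊕ Fin n) :
    X α I d = theta d (mono α I) + ∑ x ∈ (Finset.Iic α ×ˢ I.powerset).erase (0, ∅),
      ((-1 : ℂ) ^ ((∑ k, x.1 k) + x.2.card + tau x.2 (I \ x.2)) *
        ((∏ k, (α k).choose (x.1 k) : ℕ) : ℂ)) •
        (iA (mono x.1 x.2) * theta d (mono (α - x.1) (I \ x.2))) := by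
  have h0 : ((0 : Fin m →₀ ℕ), (∅ : Finset (Fin n))) ∈ Finset.Iic α ×ˢ I.powerset := by simp
  rw [X, ← Finset.sum_product', ← Finset.add_sum_erase _ _ h0]
  congr 1
  have h1 : iA (mono (0 : Fin m →₀ ℕ) (∅ : Finset (Fin n))) = 1 := by
    rw [mono_zero_empty, map_one]
  rw [iA_apply] at h1
  simp only [h1, tau, Finset.empty_product, Finset.filter_empty, Finset.card_empty, tsub_zero,
    Finset.sdiff_empty, one_mul, Finsupp.coe_zero, Pi.zero_apply, Nat.choose_zero_right,
    Finset.prod_const_one, Finset.sum_const_zero, pow_zero, Nat.cast_one, one_smul, add_zero]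
  rfl

theorem dU_mem_uSet (d : Fin m ⊕ Fin n) : dU d ∈ uSet m n (pdPar d) :=
  Or.inr (Or.inl ⟨d, rfl, rfl⟩)

/-- Induction on the degree `N` inverts the triangular relation `X_eq_theta_add`; in degree zero the
element is `∂_d` itself. -/
theorem theta_mono_mem (d : Fin m ⊕ Fin n) : ∀ (N : ℕ) (α : Fin m →₀ ℕ) (I : Finset (Fin n)),
    (∑ k, α k) + I.card = N →
    theta d (mono α I) ∈ aSpan iA (uSet m n) ((I.card : ZMod 2) + pdPar d) := by
  intro N
  induction N using Nat.strong_induction_on with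
  | _ N ih =>
    intro α I hN
    by_cases h : α ≠ 0 ∨ I ≠ ∅
    · have hX : X α I d ∈ aSpan iA (uSet m n) ((I.card : ZMod 2) + pdPar d) := by
        have : X α I d ∈ (tAlg m n).gr ((I.card : ZMod 2) + pdPar d) :=
          Submodule.subset_span ⟨α, I, d, h, rfl, rfl⟩
        exact subset_aSpan (Or.inr (Or.inr ⟨⟨_, tAlg_gr_le_total _ this⟩, this, rfl⟩))
      rw [eq_sub_of_add_eq (X_eq_theta_add α I d).symm]
      refine Submodule.sub_mem _ hX (Submodule.sum_mem _ ?_)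
      rintro ⟨β, J⟩ hx
      obtain ⟨hne, hx⟩ := Finset.mem_erase.1 hx
      obtain ⟨hβ, hJ⟩ := Finset.mem_product.1 hx
      have hβ' : β ≤ α := Finset.mem_Iic.1 hβ
      have hJ' := Finset.mem_powerset.1 hJ
      have c1 : (I \ J).card + J.card = I.card := Finset.card_sdiff_add_card_eq_card hJ'
      have c2 : (∑ k, (α - β) k) + ∑ k, β k = ∑ k, α k := by
        rw [← Finset.sum_add_distrib]
        exact Finset.sum_congr rfl fun k _ => by
          rw [Finsupp.coe_tsub, Pi.sub_apply]; exact Nat.sub_add_cancel (hβ' k)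
      have c3 : 0 < (∑ k, β k) + J.card := by
        by_contra h3
        have h4 : (∑ k, β k) = 0 ∧ J.card = 0 := by omega
        refine hne (Prod.ext (Finsupp.ext fun k => ?_) (Finset.card_eq_zero.1 h4.2))
        exact Finset.sum_eq_zero_iff.1 h4.1 k (Finset.mem_univ k)
      have := mul_mem_aSpan (mono_mem β J) (ih _ (by omega) (α - β) (I \ J) rfl)
      rw [← add_assoc, ← Nat.cast_add, add_comm J.card, c1] at this
      exact Submodule.smul_mem _ _ this
    · push Not at h
      obtain ⟨rfl, rfl⟩ := h
      rw [Finset.card_empty, Nat.cast_zero, zero_add]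
      have : theta d (mono 0 ∅) = dU d := by
        rw [theta_apply, dU]
        congr 2
        refine Subtype.ext (LinearMap.ext fun p => ?_)
        rw [wMul_apply, mono_zero_empty, one_mul]
        rfl
      rw [this]
      exact subset_aSpan (dU_mem_uSet d)

theorem theta_mem {k : ZMod 2} {q : A m n} (hq : q ∈ aGr m n k) (d : Fin m ⊕ Fin n) :
    theta d q ∈ aSpan iA (uSet m n) (k + pdPar d) := by
  rw [aGr_eq_span] at hq
  induction hq using Submodule.span_induction with
  | mem q hq =>
    obtain ⟨α, I, rfl, rfl⟩ := hq
    exact theta_mono_mem d _ α I rfl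
  | zero => rw [map_zero]; exact Submodule.zero_mem _
  | add x y _ _ hx hy => rw [map_add]; exact Submodule.add_mem _ hx hy
  | smul c x _ hx => rw [map_smul]; exact Submodule.smul_mem _ _ hx

theorem toUbar_mem_aSpan {i : ZMod 2} {x : (wTilde m n).total}
    (hx : (x : (wTilde m n).L) ∈ (wTilde m n).gr i) : toUbar x ∈ aSpan iA (uSet m n) i := by
  rw [eq_inW_add_inA x, map_add]
  refine Submodule.add_mem _ ?_ ?_
  · have e : (⟨x.1.1, x.2.1⟩ : wTotal m n) = ∑ d, wMul d (x.1.1 (gen d)) := by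
      refine Subtype.ext ?_
      rw [Submodule.coe_sum]
      exact wGr_eq_sum hx.1
    rw [e, map_sum, map_sum]
    refine Submodule.sum_mem _ fun d _ => ?_
    have := theta_mem (hx.1.1 _ _ (gen_mem d)) d
    rwa [add_assoc, CharTwo.add_self_eq_zero, add_zero] at this
  · exact Submodule.subset_span ⟨i, 0, x.1.2, 1, hx.2, Or.inl ⟨rfl, rfl⟩, add_zero i,
      (mul_one _).symm⟩

/-! ### The superderivation `[∂_d, -]` of `Ū` -/

/-- The automorphism of `Ū` that multiplies elements of parity `j` by `sgn i j`. -/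
def parPow (i : ZMod 2) : Ubar m n →ₐ[ℂ] Ubar m n :=
  if i = 0 then AlgHom.id ℂ _ else parU m n

theorem parPow_apply {i j : ZMod 2} {u : Ubar m n} (hu : parU m n u = sgn 1 j • u) :
    parPow i u = sgn i j • u := by
  rcases parity_cases i with rfl | rfl
  · simp [parPow, sgn_zero_left]
  · simpa [parPow] using hu

theorem parPow_iA (i : ZMod 2) (p : A m n) : parPow i (iA p) = iA (sigma i p) := by
  induction p using homogeneous_induction with
  | h j p hp =>
    rw [sigma_apply hp, map_smul]
    exact parPow_apply (by rw [parU_iA, sigma_apply hp, map_smul])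
  | ha p q hp hq => simp only [map_add, hp, hq]

/-- The supercommutator with `∂_d`. -/
def sad (d : Fin m ⊕ Fin n) : Ubar m n →ₗ[ℂ] Ubar m n :=
  LinearMap.mulLeft ℂ (dU d) - LinearMap.mulRight ℂ (dU d) ∘ₗ (parPow (pdPar d)).toLinearMap

theorem sad_apply (d : Fin m ⊕ Fin n) (u : Ubar m n) :
    sad d u = dU d * u - parPow (pdPar d) u * dU d := rfl

theorem sad_iA_mul (d : Fin m ⊕ Fin n) (p : A m n) {u : Ubar m n} (hu : sad d u = 0) :
    sad d (iA p * u) = iA (pd d p) * u := by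
  rw [sad_apply, sub_eq_zero] at hu
  rw [sad_apply, map_mul, ← mul_assoc, dU_mul_iA, add_mul, mul_assoc _ (dU d), hu, parPow_iA,
    ← mul_assoc, add_sub_cancel_right]

theorem sad_eq_zero {d : Fin m ⊕ Fin n} {j : ZMod 2} {u : Ubar m n}
    (hu : parU m n u = sgn 1 j • u) (h : dU d * u = sgn (pdPar d) j • (u * dU d)) :
    sad d u = 0 := by
  rw [sad_apply, parPow_apply hu, h, smul_mul_assoc, sub_self]

theorem parU_dU (d : Fin m ⊕ Fin n) : parU m n (dU d) = sgn 1 (pdPar d) • dU d :=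
  parU_toUbar (inW_mem_gr (D := wPd d) (pd_mem d))

theorem dU_mul_dU (d e : Fin m ⊕ Fin n) :
    dU d * dU e = sgn (pdPar d) (pdPar e) • (dU e * dU d : Ubar m n) := by
  have h := toUbar_inW_lie (F := 0) (D := wPd d) (E := wPd e) (pd_mem d) (pd_mem e) ?_
  · rw [map_zero, map_zero, eq_comm, sub_eq_zero] at h
    exact h
  · refine LinearMap.ext fun p => ?_
    have := sub_eq_zero.2 (pd_pd d e p)
    exact this.symm

theorem sad_wSet (d : Fin m ⊕ Fin n) {u : Ubar m n}
    (hu : u ∈ Submodule.span ℂ (⋃ k, uSet m n k)) : sad d u = 0 := by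
  have : Submodule.span ℂ (⋃ k, uSet m n k) ≤ LinearMap.ker (sad d) := by
    refine Submodule.span_le.2 (Set.iUnion_subset fun k => ?_)
    rintro _ (⟨rfl, rfl⟩ | ⟨e, rfl, rfl⟩ | ⟨x, hx, rfl⟩)
    · exact sad_eq_zero (j := 0) (by rw [map_one, sgn_zero_right, one_smul])
        (by rw [sgn_zero_right, one_smul, one_mul, mul_one])
    · exact sad_eq_zero (parU_dU e) (dU_mul_dU d e)
    · exact sad_eq_zero (parU_tAlg hx) (dU_mul_tAlg hx d)
  exact this hu

/-! ### Independence of `1`, the partial derivatives and `T` over `A` -/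

/-- Applied to `1`, the operator gives `c`; applied to a generator `x_e` and evaluated at the
origin, it gives `c' e`. -/
theorem eq_zero_of_actA_eq_zero {c : ℂ} {c' : Fin m ⊕ Fin n → ℂ} {u : Ubar m n}
    (hu : actA m n u = 0) (h : actA m n (c • (1 : Ubar m n) + ∑ d, c' d • dU d + u) = 0) :
    c = 0 ∧ c' = 0 := by
  have key : ∀ p : A m n, c • p + ∑ d, c' d • pd d p = 0 := by
    intro p
    have h1 := LinearMap.congr_fun h p
    rw [map_add, hu, map_add, map_smul, map_one, map_sum, LinearMap.add_apply,
      LinearMap.add_apply, LinearMap.smul_apply, LinearMap.sum_apply] at h1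
    have h2 : ∀ d, (actA m n (c' d • dU d)) p = c' d • pd d p := by
      intro d
      rw [map_smul, LinearMap.smul_apply, dU, actA_inW]
      rfl
    simp only [h2] at h1
    exact (add_zero _).symm.trans h1
  have hc : c = 0 := by
    have h1 := congrArg (aug (m := m) (n := n)) (key 1)
    simpa [pd_one] using h1
  refine ⟨hc, funext fun e => ?_⟩
  have h1 := congrArg (aug (m := m) (n := n)) (key (gen e))
  simpa [hc, pd_gen, apply_ite] using h1

theorem eq_zero_of_signs {N : Type*} [AddCommGroup N] [Module ℂ N] {k : ZMod 2} {u w : N}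
    (h : w = sgn 1 k • u) (h' : w = sgn 1 (k + 1) • u) : u = 0 := by
  rw [h, sgn_add_right, sgn_one_one, mul_neg_one, neg_smul] at h'
  have h2 := eq_zero_of_eq_neg h'
  rw [← sgn_smul_smul 1 k u, h2, smul_zero]

theorem eq_zero_of_parU {k : ZMod 2} {u : Ubar m n} (h : parU m n u = sgn 1 k • u)
    (h' : parU m n u = sgn 1 (k + 1) • u) : u = 0 :=
  eq_zero_of_signs h h'

theorem sum_parity {N : Type*} [AddCommMonoid N] (f : ZMod 2 → N) (k : ZMod 2) :
    ∑ j, f j = f k + f (k + 1) := by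
  have : ∑ j, f j = f 0 + f 1 := Fin.sum_univ_two f
  rcases parity_cases k with rfl | rfl
  · rw [this, zero_add]
  · rw [this, add_comm, CharTwo.add_self_eq_zero]

/-! ### Freeness over `A` and elements with constant coefficients -/

section Total

variable {E : Type*} [Ring E] [Algebra ℂ E]

/-- The `A`-module generated by sets `S k`. -/
def aTotal (ℓ : A m n →ₐ[ℂ] E) (S : ZMod 2 → Set E) : Submodule ℂ E :=
  LinearMap.range (actMap ((Algebra.lmul ℂ E).comp ℓ) (Submodule.span ℂ (⋃ k, S k)).subtype)

theorem aSpan_le_aTotal {ℓ : A m n →ₐ[ℂ] E} {S : ZMod 2 → Set E} (i : ZMod 2) :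
    aSpan ℓ S i ≤ aTotal ℓ S := by
  refine Submodule.span_le.2 ?_
  rintro _ ⟨j, k, p, s, hp, hs, rfl, rfl⟩
  exact ⟨p ⊗ₜ ⟨s, Submodule.subset_span (Set.mem_iUnion.2 ⟨k, hs⟩)⟩, rfl⟩

/-- The projection of the `A`-span in `E` to `Ū` factors through `A ⊗ span(1, ∂_d, T)`, which embeds
in `Ū` by `actMap_injective` with the supercommutators `sad`. For `E = Ū × B` this makes the
`A`-span the graph of a map on its image in `Ū`. -/
theorem eq_zero_of_mem_aTotal {ℓ : A m n →ₐ[ℂ] E} {δ : Fin m ⊕ Fin n → E}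
    {τ : ZMod 2 → (tAlg m n).total →ₗ[ℂ] E} (π : E →ₐ[ℂ] Ubar m n) (hℓ : ∀ p, π (ℓ p) = iA p)
    (hδ : ∀ d, π (δ d) = dU d) (hτ : ∀ k x, x.1 ∈ (tAlg m n).gr k → π (τ k x) = x.1) {z : E}
    (hz : z ∈ aTotal ℓ (wSet δ τ)) (hz0 : π z = 0) : z = 0 := by
  obtain ⟨w, rfl⟩ := hz
  set f := π.toLinearMap ∘ₗ (Submodule.span ℂ (⋃ k, wSet δ τ k)).subtype with hf
  have h1 : ∀ w, π (actMap ((Algebra.lmul ℂ E).comp ℓ)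
      (Submodule.span ℂ (⋃ k, wSet δ τ k)).subtype w) =
      actMap ((Algebra.lmul ℂ (Ubar m n)).comp iA) f w := by
    intro w
    induction w using TensorProduct.induction_on with
    | zero => simp
    | add x y hx hy => simp only [map_add, hx, hy]
    | tmul p v => exact (map_mul π _ _).trans (congrArg (· * π v.1) (hℓ p))
  have hfmem : ∀ v, f v ∈ Submodule.span ℂ (⋃ k, uSet m n k) := by
    rintro ⟨v, hv⟩
    have : Submodule.span ℂ (⋃ k, wSet δ τ k) ≤
        (Submodule.span ℂ (⋃ k, uSet m n k)).comap π.toLinearMap := by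
      refine Submodule.span_le.2 (Set.iUnion_subset fun k s hs => Submodule.subset_span
        (Set.mem_iUnion.2 ⟨k, ?_⟩))
      rcases hs with ⟨rfl, rfl⟩ | ⟨d, rfl, rfl⟩ | ⟨x, hx, rfl⟩
      · exact Or.inl ⟨rfl, map_one π⟩
      · exact Or.inr (Or.inl ⟨d, rfl, hδ d⟩)
      · exact Or.inr (Or.inr ⟨x, hx, hτ k x hx⟩)
    exact this hv
  have hinj : Function.Injective f := by
    -- The action on `A` eliminates the coefficients of `1` and the `∂_d`; the parity automorphism
    -- of `Ū` then separates the even and the odd element of `T`.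
    refine (injective_iff_map_eq_zero f).2 ?_
    rintro ⟨v, hv⟩ hfv
    obtain ⟨c, c', x, hx, rfl⟩ := exists_of_mem_span_wSet hv
    refine Subtype.ext ?_
    have h2 : c • (1 : Ubar m n) + ∑ d, c' d • dU d + ∑ k, (x k).1 = 0 := by
      have : π (c • (1 : E) + ∑ d, c' d • δ d + ∑ k, τ k (x k)) = 0 := hfv
      simpa only [map_add, map_sum, map_smul, map_one, hδ, hτ _ _ (hx _)] using this
    have h3 : actA m n (∑ k, (x k).1) = 0 := by
      rw [map_sum]
      exact Finset.sum_eq_zero fun k _ => actA_tAlg (hx k)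
    obtain ⟨rfl, rfl⟩ := eq_zero_of_actA_eq_zero h3 (by rw [h2, map_zero])
    have h4 : ∀ k, x k = 0 := by
      intro k
      have h5 : (x k).1 + (x (k + 1)).1 = 0 := by
        rw [← sum_parity fun k => (x k).1]
        simpa using h2
      refine Subtype.ext (eq_zero_of_parU (parU_tAlg (hx k)) ?_)
      rw [eq_neg_of_add_eq_zero_left h5, map_neg, parU_tAlg (hx (k + 1)), smul_neg]
    simp [h4]
  have hact := actMap_injective (L := (Algebra.lmul ℂ (Ubar m n)).comp iA) (D := sad) hinj
    fun d p v => sad_iA_mul d p (sad_wSet d (hfmem v))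
  rw [h1] at hz0
  rw [hact (hz0.trans (map_zero _).symm), map_zero]

/-- By injectivity of `actMap`, vanishing under all `D d` passes to the coefficients in `A ⊗ span`,
which are therefore constant. -/
theorem mem_span_of_killed {ℓ : A m n →ₐ[ℂ] E} {S : ZMod 2 → Set E}
    {D : Fin m ⊕ Fin n → Module.End ℂ E}
    (hD : ∀ d p, ∀ v ∈ Submodule.span ℂ (⋃ k, S k), D d (ℓ p * v) = ℓ (pd d p) * v) {z : E}
    (hz : z ∈ aTotal ℓ S) (h : ∀ d, D d z = 0) : z ∈ Submodule.span ℂ (⋃ k, S k) := by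
  obtain ⟨w, rfl⟩ := hz
  have hsub : Function.Injective (Submodule.span ℂ (⋃ k, S k)).subtype :=
    Submodule.subtype_injective _
  have hinj := actMap_injective (L := (Algebra.lmul ℂ E).comp ℓ) (D := D) hsub
    fun d p v => hD d p v v.2
  have h1 : ∀ d w, actMap ((Algebra.lmul ℂ E).comp ℓ)
      (Submodule.span ℂ (⋃ k, S k)).subtype ((pd d).rTensor _ w) =
      D d (actMap ((Algebra.lmul ℂ E).comp ℓ) (Submodule.span ℂ (⋃ k, S k)).subtype w) := by
    intro d w
    induction w using TensorProduct.induction_on with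
    | zero => simp
    | add x y hx hy => simp only [map_add, hx, hy]
    | tmul p v => exact (hD d p v v.2).symm
  obtain ⟨v, rfl⟩ := exists_one_tmul (z := w) fun d =>
    hinj ((h1 d w).trans ((h d).trans (map_zero _).symm))
  rw [actMap_tmul, map_one]
  exact v.2

end Total

/-- The elements of the `A`-span of `1`, the partial derivatives and `T` that supercommute with the
partial derivatives. -/
theorem mem_span_of_sad_eq_zero {z : Ubar m n} (hz : z ∈ aTotal iA (uSet m n))
    (h : ∀ d, sad d z = 0) : z ∈ Submodule.span ℂ (⋃ k, uSet m n k) :=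
  mem_span_of_killed (D := sad) (fun d p _ hv => sad_iA_mul d p (sad_wSet d hv)) hz h

/-! ### `T` is closed under the supercommutator -/

/-- The image of `W̃` in `Ū`. -/
def wImage (m n : ℕ) (k : ZMod 2) : Set (Ubar m n) :=
  {s | ∃ x : (wTilde m n).total, (x : (wTilde m n).L) ∈ (wTilde m n).gr k ∧ s = toUbar x}

theorem toUbar_mul_iA {k l : ZMod 2} {x : (wTilde m n).total}
    (hx : (x : (wTilde m n).L) ∈ (wTilde m n).gr k) {q : A m n} (hq : q ∈ aGr m n l) :
    toUbar x * iA q = iA (x.1.1 q) + sgn k l • (iA q * toUbar x) := by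
  rw [eq_inW_add_inA x, map_add, add_mul, toUbar_inW_mul_iA hx.1 hq, ← iA_apply, ← map_mul,
    aGr_mul_comm hx.2 hq, map_smul, map_mul, mul_add, smul_add, add_assoc]
  simp [inW, inA]

theorem wTilde_gr_le_total (k : ZMod 2) : (wTilde m n).gr k ≤ (wTilde m n).total :=
  fun _ hx => ⟨wGr_le m n k hx.1, trivial⟩

/-- Brackets are first located in the `A`-span of the image of `W̃`, where closure is known; a
direct argument with the generators `uSet` would presuppose that `T` is closed. -/
theorem wImage_bracket {i j : ZMod 2} {z w : Ubar m n} (hz : z ∈ aSpan iA (wImage m n) i)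
    (hw : w ∈ aSpan iA (wImage m n) j) :
    z * w - sgn i j • (w * z) ∈ aSpan iA (wImage m n) (i + j) := by
  refine aSpan_bracket ?_ ?_ hz hw
  · rintro k l _ ⟨x, hx, rfl⟩ q hq
    exact ⟨_, hx.1.1 _ _ hq, toUbar_mul_iA hx hq⟩
  · rintro k l _ ⟨x, hx, rfl⟩ _ ⟨y, hy, rfl⟩
    have hz := wTilde_closed k l _ hx _ hy
    exact subset_aSpan ⟨⟨_, wTilde_gr_le_total _ hz⟩, hz, (toUbar_lie hx hy rfl).symm⟩

theorem tAlg_le_aSpan {k : ZMod 2} {x : Ubar m n} (hx : x ∈ (tAlg m n).gr k) :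
    x ∈ aSpan iA (wImage m n) k := by
  have : (tAlg m n).gr k ≤ aSpan iA (wImage m n) k := by
    refine Submodule.span_le.2 ?_
    rintro _ ⟨α, I, d, -, rfl, rfl⟩
    refine Submodule.sum_mem _ fun β _ => Submodule.sum_mem _ fun J hJ =>
      Submodule.smul_mem _ _ (Submodule.subset_span ⟨_, _, _, _, mono_mem β J,
        ⟨_, inW_mem_gr (D := wMono (α - β) (I \ J) d) (monoPd_mem _ _ _), rfl⟩, ?_, rfl⟩)
    rw [← add_assoc, ← Nat.cast_add, add_comm J.card,
      Finset.card_sdiff_add_card_eq_card (Finset.mem_powerset.1 hJ)]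
  exact this hx

/-- This identifies `T` within the span of `1`, the `∂_d` and `T`: zero action on `A` removes the
first two, and the parity removes the component of `T` of the wrong parity. -/
theorem mem_tAlg_gr {k : ZMod 2} {z : Ubar m n} (hz : z ∈ Submodule.span ℂ (⋃ k, uSet m n k))
    (h : actA m n z = 0) (hk : parU m n z = sgn 1 k • z) : z ∈ (tAlg m n).gr k := by
  obtain ⟨c, c', x, hx, hz⟩ := exists_of_mem_span_wSet hz
  have h3 : actA m n (∑ k, (x k).1) = 0 := by
    rw [map_sum]
    exact Finset.sum_eq_zero fun k _ => actA_tAlg (hx k)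
  obtain ⟨rfl, rfl⟩ := eq_zero_of_actA_eq_zero h3 (hz ▸ h)
  have hz' : z = (x k).1 + (x (k + 1)).1 := by
    rw [← sum_parity fun k => (x k).1]
    simpa using hz
  have h0 : z - (x k).1 = 0 := by
    refine eq_zero_of_parU (k := k) ?_ ?_
    · rw [map_sub, hk, parU_tAlg (hx k), smul_sub]
    · rw [hz', add_sub_cancel_left, parU_tAlg (hx (k + 1))]
  rw [sub_eq_zero.1 h0]
  exact hx k

/-- The bracket lies in the `A`-span of `1`, the `∂_d` and `T`, because that span contains the image
of `W̃`. It supercommutes with the `∂_d`, so its coefficients are constant, and it acts by zero on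
`A`, so only `T` contributes. -/
theorem tAlg_closed : (tAlg m n).Closed := by
  intro i j x hx y hy
  change x * y - sgn i j • (y * x) ∈ (tAlg m n).gr (i + j)
  have hpar : parU m n (x * y - sgn i j • (y * x)) =
      sgn 1 (i + j) • (x * y - sgn i j • (y * x)) := by
    rw [map_sub, map_smul, map_mul, map_mul, parU_tAlg hx, parU_tAlg hy, sgn_add_right]
    simp only [smul_mul_assoc, mul_smul_comm, smul_sub]
    module
  refine mem_tAlg_gr (mem_span_of_sad_eq_zero ?_ fun d => sad_eq_zero hpar ?_) ?_ hpar
  · refine aSpan_le_aTotal (i + j) (aSpan_le ?_ _ (wImage_bracket (tAlg_le_aSpan hx)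
      (tAlg_le_aSpan hy)))
    rintro k _ ⟨x, hx, rfl⟩
    exact toUbar_mem_aSpan hx
  · have e1 := dU_mul_tAlg hx d
    have e2 := dU_mul_tAlg hy d
    have e3 : dU d * (x * y) = (sgn (pdPar d) i * sgn (pdPar d) j) • (x * y * dU d) := by
      rw [← mul_assoc, e1, smul_mul_assoc, mul_assoc, e2, mul_smul_comm, smul_smul, mul_assoc]
    have e4 : dU d * (y * x) = (sgn (pdPar d) i * sgn (pdPar d) j) • (y * x * dU d) := by
      rw [← mul_assoc, e2, smul_mul_assoc, mul_assoc, e1, mul_smul_comm, smul_smul, mul_assoc,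
        mul_comm (sgn _ j)]
    rw [mul_sub, mul_smul_comm, e3, e4, sub_mul, smul_mul_assoc, sgn_add_right, smul_sub,
      smul_comm (sgn i j)]
  · rw [map_sub, map_smul, map_mul, map_mul, actA_tAlg hx, actA_tAlg hy, mul_zero, smul_zero]
    exact sub_self _

/-! ### Homomorphisms from `Ū` -/

theorem exists_add_of_mem_wTilde (x : (wTilde m n).total) :
    ∃ x₀ x₁ : (wTilde m n).total, (x₀ : (wTilde m n).L) ∈ (wTilde m n).gr 0 ∧
      (x₁ : (wTilde m n).L) ∈ (wTilde m n).gr 1 ∧ x = x₀ + x₁ := by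
  obtain ⟨D₀, h₀, D₁, h₁, h⟩ := Submodule.mem_sup.1 x.2.1
  obtain ⟨p₀, g₀, p₁, g₁, g⟩ := exists_add_homogeneous x.1.2
  have e0 : (D₀, p₀) ∈ (wTilde m n).gr 0 := ⟨h₀, g₀⟩
  have e1 : (D₁, p₁) ∈ (wTilde m n).gr 1 := ⟨h₁, g₁⟩
  exact ⟨⟨_, wTilde_gr_le_total 0 e0⟩, ⟨_, wTilde_gr_le_total 1 e1⟩, e0, e1,
    Subtype.ext (Prod.ext h.symm g)⟩

theorem ubar_generation {P : Ubar m n → Prop} (hA : ∀ p, P (iA p)) (hd : ∀ d, P (dU d))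
    (hT : ∀ k, ∀ x ∈ (tAlg m n).gr k, P x) (ha : ∀ u v, P u → P v → P (u + v))
    (hm : ∀ u v, P u → P v → P (u * v)) (u : Ubar m n) : P u := by
  have h1 : ∀ c : ℂ, P (algebraMap ℂ _ c) := fun c => by
    rw [← iA.commutes c]; exact hA _
  have h2 : ∀ i, ∀ u ∈ aSpan iA (uSet m n) i, P u := by
    intro i u hu
    induction hu using Submodule.span_induction with
    | mem z hz =>
      obtain ⟨j, k, p, s, hp, hs, rfl, rfl⟩ := hz
      refine hm _ _ (hA p) ?_
      rcases hs with ⟨-, rfl⟩ | ⟨d, -, rfl⟩ | ⟨x, hx, rfl⟩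
      · rw [← map_one iA]; exact hA 1
      · exact hd d
      · exact hT k _ hx
    | zero => rw [← map_zero iA]; exact hA 0
    | add x y _ _ hx hy => exact ha _ _ hx hy
    | smul c x _ hx => rw [Algebra.smul_def]; exact hm _ _ (h1 c) hx
  refine ubar_induction h1 (fun x => ?_) ha hm u
  obtain ⟨x₀, x₁, h₀, h₁, rfl⟩ := exists_add_of_mem_wTilde x
  rw [map_add]
  exact ha _ _ (h2 0 _ (toUbar_mem_aSpan h₀)) (h2 1 _ (toUbar_mem_aSpan h₁))

section UbarHom

variable {B : Type*} [Ring B] [Algebra ℂ B]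

theorem mul_mem_aTotal {ℓ : A m n →ₐ[ℂ] B} {S : ZMod 2 → Set B} (p : A m n) {z : B}
    (hz : z ∈ aTotal ℓ S) : ℓ p * z ∈ aTotal ℓ S := by
  obtain ⟨w, rfl⟩ := hz
  refine ⟨(LinearMap.mulLeft ℂ p).rTensor _ w, ?_⟩
  induction w using TensorProduct.induction_on with
  | zero => simp
  | add x y hx hy => simp only [map_add, hx, hy, mul_add]
  | tmul q v =>
    rw [LinearMap.rTensor_tmul, actMap_tmul, actMap_tmul, LinearMap.mulLeft_apply, map_mul]
    rfl

/-- Operators `ℓ p` for `p ∈ A`, `δ d` for the partial derivatives and `τ k x` for `x ∈ T` of parity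
`k` that satisfy the relations of `Ū`. -/
structure UbarRep (ℓ : A m n →ₐ[ℂ] B) (δ : Fin m ⊕ Fin n → B)
    (τ : ZMod 2 → (tAlg m n).total →ₗ[ℂ] B) : Prop where
  pd_A : ∀ d p, δ d * ℓ p = ℓ (pd d p) + ℓ (sigma (pdPar d) p) * δ d
  pd_pd : ∀ d e, δ d * δ e = sgn (pdPar d) (pdPar e) • (δ e * δ d)
  T_A : ∀ k l x, x.1 ∈ (tAlg m n).gr k → ∀ q ∈ aGr m n l, τ k x * ℓ q = sgn k l • (ℓ q * τ k x)
  pd_T : ∀ d k x, x.1 ∈ (tAlg m n).gr k → δ d * τ k x = sgn (pdPar d) k • (τ k x * δ d)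
  T_T : ∀ k l x y z, x.1 ∈ (tAlg m n).gr k → y.1 ∈ (tAlg m n).gr l →
    z.1 = x.1 * y.1 - sgn k l • (y.1 * x.1) →
    τ k x * τ l y - sgn k l • (τ l y * τ k x) = τ (k + l) z

variable {ℓ : A m n →ₐ[ℂ] B} {δ : Fin m ⊕ Fin n → B} {τ : ZMod 2 → (tAlg m n).total →ₗ[ℂ] B}

/-- All brackets of generators vanish except those of two elements of `T`, which stay in `T` by
`tAlg_closed`. -/
theorem UbarRep.bracket_mem (h : UbarRep ℓ δ τ) {i j : ZMod 2} {z w : B}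
    (hz : z ∈ aSpan ℓ (wSet δ τ) i) (hw : w ∈ aSpan ℓ (wSet δ τ) j) :
    z * w - sgn i j • (w * z) ∈ aSpan ℓ (wSet δ τ) (i + j) := by
  have hzero : ∀ (k l : ZMod 2) (s t : B), s * t = sgn k l • (t * s) →
      s * t - sgn k l • (t * s) ∈ aSpan ℓ (wSet δ τ) (k + l) := by
    intro k l s t h
    rw [h, sub_self]; exact Submodule.zero_mem _
  have hswap : ∀ (k l : ZMod 2) (s t : B), s * t = sgn k l • (t * s) →
      t * s = sgn l k • (s * t) := by
    intro k l s t h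
    rw [h, sgn_comm, sgn_smul_smul]
  refine aSpan_bracket ?_ ?_ hz hw
  · rintro k l _ (⟨rfl, rfl⟩ | ⟨d, rfl, rfl⟩ | ⟨x, hx, rfl⟩) q hq
    · exact ⟨0, Submodule.zero_mem _, by simp [sgn_zero_left]⟩
    · exact ⟨_, (pd_mem d).1 _ _ hq, by
        rw [h.pd_A, sigma_apply hq, map_smul, smul_mul_assoc]⟩
    · exact ⟨0, Submodule.zero_mem _, by rw [h.T_A _ _ x hx q hq, map_zero, zero_add]⟩
  · rintro k l _ (⟨rfl, rfl⟩ | ⟨d, rfl, rfl⟩ | ⟨x, hx, rfl⟩) _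
      (⟨rfl, rfl⟩ | ⟨e, rfl, rfl⟩ | ⟨y, hy, rfl⟩)
    · exact hzero _ _ _ _ (by simp [sgn_zero_left])
    · exact hzero _ _ _ _ (by simp [sgn_zero_left])
    · exact hzero _ _ _ _ (by simp [sgn_zero_left])
    · exact hzero _ _ _ _ (by simp [sgn_zero_right])
    · exact hzero _ _ _ _ (h.pd_pd d e)
    · exact hzero _ _ _ _ (h.pd_T d l y hy)
    · exact hzero _ _ _ _ (by simp [sgn_zero_right])
    · exact hzero _ _ _ _ (hswap _ _ _ _ (h.pd_T e k x hx))
    · have hc : x.1 * y.1 - sgn k l • (y.1 * x.1) ∈ (tAlg m n).gr (k + l) :=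
        tAlg_closed k l _ hx _ hy
      rw [h.T_T k l x y ⟨_, tAlg_gr_le_total _ hc⟩ hx hy rfl]
      exact subset_aSpan (Or.inr (Or.inr ⟨_, hc, rfl⟩))

/-- The operators on `Ū × B`. -/
theorem UbarRep.prod (h : UbarRep ℓ δ τ) :
    UbarRep (B := Ubar m n × B) (iA.prod ℓ) (fun d => (dU d, δ d))
      (fun k => ((tAlg m n).total.subtype).prod (τ k)) where
  pd_A d p := Prod.ext (dU_mul_iA d p) (h.pd_A d p)
  pd_pd d e := Prod.ext (dU_mul_dU d e) (h.pd_pd d e)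
  T_A k l x hx q hq := Prod.ext (tAlg_mul_iA hx hq) (h.T_A k l x hx q hq)
  pd_T d k x hx := Prod.ext (dU_mul_tAlg hx d) (h.pd_T d k x hx)
  T_T k l x y z hx hy hz := Prod.ext hz.symm (h.T_T k l x y z hx hy hz)

/-- The `A`-span of the pairs (generator, operator) in `Ū × B` is the graph of a linear map on a
subspace of `Ū` that contains the image of `W̃`. Its closure under the bracket turns the restriction
to `W̃` into a map satisfying the relations of `Ū`. -/
theorem UbarRep.exists_hom (h : UbarRep ℓ δ τ) :
    ∃ Φ : Ubar m n →ₐ[ℂ] B, (∀ p, Φ (iA p) = ℓ p) ∧ (∀ d, Φ (dU d) = δ d) ∧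
      ∀ k x, x.1 ∈ (tAlg m n).gr k → Φ x.1 = τ k x := by
  set L : A m n →ₐ[ℂ] Ubar m n × B := iA.prod ℓ with hL
  set S : ZMod 2 → Set (Ubar m n × B) := wSet (fun d => (dU d, δ d))
    (fun k => ((tAlg m n).total.subtype).prod (τ k)) with hS
  -- Single-valuedness of the graph: a difference of two points over `u` has first coordinate zero
  -- and lies in the `A`-span.
  have huniq : ∀ u b b', (u, b) ∈ aTotal L S → (u, b') ∈ aTotal L S → b = b' := by
    intro u b b' hb hb'
    have h0 : (u, b) - (u, b') = 0 :=
      eq_zero_of_mem_aTotal (AlgHom.fst ℂ _ _) (fun _ => rfl) (fun _ => rfl) (fun _ _ _ => rfl)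
        (Submodule.sub_mem _ hb hb') (sub_self u)
    exact sub_eq_zero.1 (congrArg Prod.snd h0)
  have hex : ∀ i (x : (wTilde m n).total), (x : (wTilde m n).L) ∈ (wTilde m n).gr i →
      ∃ b, (toUbar x, b) ∈ aSpan L S i := by
    intro i x hx
    have hS' : ∀ k, ∀ s ∈ uSet m n k, ∃ t ∈ S k, AlgHom.fst ℂ (Ubar m n) B t = s := by
      rintro k _ (⟨rfl, rfl⟩ | ⟨d, rfl, rfl⟩ | ⟨x, hx, rfl⟩)
      · exact ⟨1, Or.inl ⟨rfl, rfl⟩, rfl⟩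
      · exact ⟨_, Or.inr (Or.inl ⟨d, rfl, rfl⟩), rfl⟩
      · exact ⟨_, Or.inr (Or.inr ⟨x, hx, rfl⟩), rfl⟩
    obtain ⟨⟨u, b⟩, hb, rfl⟩ := exists_of_mem_aSpan (ℓ := L) (S := S) (AlgHom.fst ℂ _ _)
      (fun _ => rfl) hS' (toUbar_mem_aSpan hx)
    exact ⟨b, hb⟩
  have hex' : ∀ x : (wTilde m n).total, ∃ b, (toUbar x, b) ∈ aTotal L S := by
    intro x
    obtain ⟨x₀, x₁, h₀, h₁, rfl⟩ := exists_add_of_mem_wTilde x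
    obtain ⟨b₀, hb₀⟩ := hex 0 x₀ h₀
    obtain ⟨b₁, hb₁⟩ := hex 1 x₁ h₁
    refine ⟨b₀ + b₁, ?_⟩
    rw [map_add]
    exact Submodule.add_mem _ (aSpan_le_aTotal 0 hb₀) (aSpan_le_aTotal 1 hb₁)
  choose f hf using hex'
  let F : (wTilde m n).total →ₗ[ℂ] B :=
    { toFun := f
      map_add' := fun x y => huniq _ _ _ (hf (x + y)) (by
        rw [map_add]; exact Submodule.add_mem _ (hf x) (hf y))
      map_smul' := fun c x => huniq _ _ _ (hf (c • x)) (by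
        rw [map_smul]; exact Submodule.smul_mem _ c (hf x)) }
  have hF : ∀ x, (toUbar x, F x) ∈ aTotal L S := hf
  have hFgr : ∀ i (x : (wTilde m n).total), (x : (wTilde m n).L) ∈ (wTilde m n).gr i →
      (toUbar x, F x) ∈ aSpan L S i := by
    intro i x hx
    obtain ⟨b, hb⟩ := hex i x hx
    rwa [huniq _ _ _ (hF x) (aSpan_le_aTotal i hb)]
  have hLmem : ∀ p, L p ∈ aTotal L S := by
    intro p
    rw [← mul_one (L p)]
    exact mul_mem_aTotal p (aSpan_le_aTotal 0 (subset_aSpan (Or.inl ⟨rfl, rfl⟩)))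
  have hFA : ∀ p, F (inA p) = ℓ p := fun p => huniq _ _ _ (hF (inA p)) (hLmem p)
  refine ⟨ubarLift F ?_ ?_ ?_, ?_, ?_, ?_⟩
  · intro i j x y z hx hy hz
    refine huniq (toUbar z) _ _ (hF z) ?_
    have := h.prod.bracket_mem (hFgr i x hx) (hFgr j y hy)
    rw [toUbar_lie hx hy hz]
    exact aSpan_le_aTotal _ this
  · rw [hFA, map_one]
  · intro p q
    rw [hFA, hFA, hFA, map_mul]
  · intro p
    rw [iA_apply, ubarLift_toUbar, hFA]
  · intro d
    rw [dU, ubarLift_toUbar]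
    exact huniq _ _ _ (hF _)
      (aSpan_le_aTotal (pdPar d) (subset_aSpan (Or.inr (Or.inl ⟨d, rfl, rfl⟩))))
  · intro k x hx
    set Φ := ubarLift F _ _ _ with hΦ
    have hΦA : ∀ p, Φ (iA p) = ℓ p := fun p => by rw [iA_apply, hΦ, ubarLift_toUbar, hFA]
    -- Elements of `T` are not in `W̃` but are `A`-combinations of its image, so the value of `Φ` on
    -- them is found by showing that the graph of `Φ` over such combinations lies in the `A`-span.
    have hgr : ∀ u ∈ aSpan iA (wImage m n) k, (u, Φ u) ∈ aTotal L S := by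
      intro u hu
      induction hu using Submodule.span_induction with
      | mem z hz =>
        obtain ⟨i, j, p, _, hp, ⟨y, hy, rfl⟩, -, rfl⟩ := hz
        rw [map_mul, hΦA, hΦ, ubarLift_toUbar]
        exact mul_mem_aTotal p (hF y)
      | zero => rw [map_zero]; exact Submodule.zero_mem _
      | add x y _ _ hx hy => rw [map_add]; exact Submodule.add_mem _ hx hy
      | smul c x _ hx => rw [map_smul]; exact Submodule.smul_mem _ c hx
    exact huniq _ _ _ (hgr _ (tAlg_le_aSpan hx))
      (aSpan_le_aTotal k (subset_aSpan (Or.inr (Or.inr ⟨x, hx, rfl⟩))))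

end UbarHom

/-! ### Gradings and parity operators -/

theorem SuperModule.isCompl_gr {S : LieSuperData} (M : SuperModule.{u} S) :
    IsCompl (M.gr 0) (M.gr 1) := by
  refine (DirectSum.isInternal_submodule_iff_isCompl M.gr zero_ne_one ?_).1 M.isInternal
  exact (Set.eq_univ_of_forall fun i => parity_cases i).symm

theorem SuperModule.exists_add_gr {S : LieSuperData} (M : SuperModule.{u} S) (v : M.carrier) :
    ∃ v₀ ∈ M.gr 0, ∃ v₁ ∈ M.gr 1, v = v₀ + v₁ := by
  obtain ⟨v₀, h₀, v₁, h₁, h⟩ := Submodule.mem_sup.1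
    (M.isCompl_gr.sup_eq_top ▸ Submodule.mem_top (x := v))
  exact ⟨v₀, h₀, v₁, h₁, h.symm⟩

theorem SuperModule.exists_parity {S : LieSuperData} (M : SuperModule.{u} S) :
    ∃ s : Module.End ℂ M.carrier, (∀ v, s (s v) = v) ∧
      ∀ i v, v ∈ M.gr i ↔ s v = sgn 1 i • v := by
  set s : Module.End ℂ M.carrier :=
    LinearMap.ofIsCompl M.isCompl_gr (M.gr 0).subtype (-(M.gr 1).subtype) with hs
  have h0 : ∀ v ∈ M.gr 0, s v = v := fun v hv =>
    LinearMap.ofIsCompl_apply_left M.isCompl_gr ⟨v, hv⟩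
  have h1 : ∀ v ∈ M.gr 1, s v = -v := fun v hv =>
    LinearMap.ofIsCompl_apply_right M.isCompl_gr ⟨v, hv⟩
  refine ⟨s, fun v => ?_, fun i v => ?_⟩
  · obtain ⟨v₀, g₀, v₁, g₁, rfl⟩ := M.exists_add_gr v
    rw [map_add, h0 _ g₀, h1 _ g₁, map_add, map_neg, h0 _ g₀, h1 _ g₁, neg_neg]
  · obtain ⟨v₀, g₀, v₁, g₁, rfl⟩ := M.exists_add_gr v
    rw [map_add, h0 _ g₀, h1 _ g₁]
    rcases parity_cases i with rfl | rfl
    · rw [sgn_zero_right, one_smul]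
      constructor
      · intro h
        have h2 : v₁ = 0 := Submodule.disjoint_def.1 M.isCompl_gr.disjoint v₁
          (by simpa using Submodule.sub_mem _ h g₀) g₁
        simp [h2]
      · intro h
        rw [eq_zero_of_eq_neg (add_left_cancel h).symm, add_zero]
        exact g₀
    · rw [sgn_one_one, neg_smul, one_smul, neg_add]
      constructor
      · intro h
        have h2 : v₀ = 0 := Submodule.disjoint_def.1 M.isCompl_gr.disjoint v₀ g₀
          (by simpa using Submodule.sub_mem _ h g₁)
        simp [h2]
      · intro h
        rw [eq_zero_of_eq_neg (add_right_cancel h), zero_add]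
        exact g₁

/-- The parity operator of a module, which is `1` on the even and `-1` on the odd part. -/
def SuperModule.parity {S : LieSuperData} (M : SuperModule.{u} S) : Module.End ℂ M.carrier :=
  M.exists_parity.choose

theorem SuperModule.parity_parity {S : LieSuperData} (M : SuperModule.{u} S) (v : M.carrier) :
    M.parity (M.parity v) = v := M.exists_parity.choose_spec.1 v

theorem SuperModule.mem_gr_iff {S : LieSuperData} (M : SuperModule.{u} S) {i : ZMod 2}
    {v : M.carrier} : v ∈ M.gr i ↔ M.parity v = sgn 1 i • v :=
  M.exists_parity.choose_spec.2 i v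

theorem SuperModule.parity_ρ {S : LieSuperData} (M : SuperModule.{u} S) {k : ZMod 2}
    {x : S.total} (hx : (x : S.L) ∈ S.gr k) (v : M.carrier) :
    M.parity (M.ρ x v) = sgn 1 k • M.ρ x (M.parity v) := by
  have h1 : ∀ j, ∀ v ∈ M.gr j, M.parity (M.ρ x v) = sgn 1 k • M.ρ x (M.parity v) := by
    intro j v hv
    rw [M.mem_gr_iff.1 (M.ρ_mem k j x hx v hv), M.mem_gr_iff.1 hv, map_smul, smul_smul,
      sgn_add_right]
  obtain ⟨v₀, h₀, v₁, h₁, rfl⟩ := M.exists_add_gr v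
  simp only [map_add, smul_add, h1 0 v₀ h₀, h1 1 v₁ h₁]

/-- The part of parity `i` of a space with parity operator `s`. -/
def eigGr {N : Type*} [AddCommGroup N] [Module ℂ N] (s : Module.End ℂ N) (i : ZMod 2) :
    Submodule ℂ N := LinearMap.ker (s - sgn 1 i • (1 : Module.End ℂ N))

theorem mem_eigGr {N : Type*} [AddCommGroup N] [Module ℂ N] {s : Module.End ℂ N} {i : ZMod 2}
    {v : N} : v ∈ eigGr s i ↔ s v = sgn 1 i • v := by
  rw [eigGr, LinearMap.mem_ker, LinearMap.sub_apply, LinearMap.smul_apply, Module.End.one_apply,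
    sub_eq_zero]

theorem eigGr_isInternal {N : Type*} [AddCommGroup N] [Module ℂ N] {s : Module.End ℂ N}
    (hs : ∀ v, s (s v) = v) : DirectSum.IsInternal (eigGr s) := by
  refine (DirectSum.isInternal_submodule_iff_isCompl (eigGr s) zero_ne_one
    (Set.eq_univ_of_forall fun i => parity_cases i).symm).2 ⟨?_, ?_⟩
  · refine Submodule.disjoint_def.2 fun v h0 h1 => ?_
    exact eq_zero_of_signs (k := 0) (mem_eigGr.1 h0) (mem_eigGr.1 h1)
  · refine codisjoint_iff.2 (eq_top_iff.2 fun v _ => Submodule.mem_sup.2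
      ⟨(2 : ℂ)⁻¹ • (v + s v), ?_, (2 : ℂ)⁻¹ • (v - s v), ?_, ?_⟩)
    · rw [mem_eigGr, map_smul, map_add, hs, sgn_zero_right, one_smul, add_comm]
    · rw [mem_eigGr, map_smul, map_sub, hs, sgn_one_one]
      module
    · module

/-! ### Operators on `A ⊗ V` -/

/-- The negation of `A ⊗ V` that comes with its structure of a vector space. -/
instance tensorAddCommGroup (V : Type*) [AddCommGroup V] [Module ℂ V] :
    AddCommGroup (A m n ⊗[ℂ] V) := Module.addCommMonoidToAddCommGroup ℂ

theorem twistedPd_apply (a : Fin m → ℂ) (d : Fin m ⊕ Fin n) (p : A m n) :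
    twistedPd a d p = pd d p + (Sum.elim a 0 d) • p := rfl

/-- The twist is a scalar, which is nonzero only for even `d`, where `sigma (pdPar d)` is the
identity; so it produces no sign. -/
theorem twistedPd_mul (a : Fin m → ℂ) (d : Fin m ⊕ Fin n) (p q : A m n) :
    twistedPd a d (p * q) = pd d p * q + sigma (pdPar d) p * twistedPd a d q := by
  rw [twistedPd_apply, twistedPd_apply, pd_mul, mul_add, mul_smul_comm, add_assoc]
  rcases d with i | j
  · have : pdPar (Sum.inl i : Fin m ⊕ Fin n) = 0 := rfl
    rw [this, sigma_zero]; rfl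
  · simp

theorem sigma_twistedPd (a : Fin m → ℂ) (k : ZMod 2) (d : Fin m ⊕ Fin n) (p : A m n) :
    sigma k (twistedPd a d p) = sgn k (pdPar d) • twistedPd a d (sigma k p) := by
  rw [twistedPd_apply, twistedPd_apply, map_add, map_smul, sigma_pd, smul_add]
  rcases d with i | j
  · have : pdPar (Sum.inl i : Fin m ⊕ Fin n) = 0 := rfl
    rw [this, sgn_zero_right, one_smul, one_smul]
  · simp

theorem twistedPd_twistedPd (a : Fin m → ℂ) (d e : Fin m ⊕ Fin n) (p : A m n) :
    twistedPd a d (twistedPd a e p) =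
      sgn (pdPar d) (pdPar e) • twistedPd a e (twistedPd a d p) := by
  simp only [twistedPd_apply, map_add, map_smul]
  rw [pd_pd d e]
  rcases d with i | j <;> rcases e with i' | j'
  · have : pdPar (Sum.inl i : Fin m ⊕ Fin n) = 0 := rfl
    rw [this, sgn_zero_left]; module
  · have : pdPar (Sum.inl i : Fin m ⊕ Fin n) = 0 := rfl
    rw [this, sgn_zero_left]; module
  · have : pdPar (Sum.inl i' : Fin m ⊕ Fin n) = 0 := rfl
    rw [this, sgn_zero_right]; module
  · simp

section TensorModule

variable (a : Fin m → ℂ) (V : SuperModule.{u} (tAlg m n))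

/-- The action of `A` on `A ⊗ V`. -/
def opA : A m n →ₐ[ℂ] Module.End ℂ (A m n ⊗[ℂ] V.carrier) :=
  (Module.End.rTensorAlgHom ℂ (A m n) V.carrier).comp (Algebra.lmul ℂ (A m n))

theorem opA_tmul (p q : A m n) (v : V.carrier) : opA V p (q ⊗ₜ v) = (p * q) ⊗ₜ v := rfl

/-- The action of the partial derivatives on `A ⊗ V`. -/
def opPd (d : Fin m ⊕ Fin n) : Module.End ℂ (A m n ⊗[ℂ] V.carrier) :=
  (twistedPd a d).rTensor V.carrier

theorem opPd_tmul (d : Fin m ⊕ Fin n) (q : A m n) (v : V.carrier) :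
    opPd a V d (q ⊗ₜ v) = twistedPd a d q ⊗ₜ v := rfl

/-- The action of the elements of parity `k` of `T` on `A ⊗ V`. -/
def opT (k : ZMod 2) : (tAlg m n).total →ₗ[ℂ] Module.End ℂ (A m n ⊗[ℂ] V.carrier) where
  toFun x := TensorProduct.map (sigma k).toLinearMap (V.ρ x)
  map_add' x y := by rw [map_add, TensorProduct.map_add_right]
  map_smul' c x := by rw [map_smul, TensorProduct.map_smul_right]; rfl

theorem opT_tmul (k : ZMod 2) (x : (tAlg m n).total) (q : A m n) (v : V.carrier) :
    opT V k x (q ⊗ₜ v) = sigma k q ⊗ₜ V.ρ x v := rfl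

/-- `A` and the `∂_d` act on the first factor as on `A^a`, and `sigma k` in `opT` is the Koszul sign
that makes an element of `T` of parity `k` supercommute with them. The brackets within `T` come from
`V`. -/
theorem ubarRep_tensor : UbarRep (opA V) (opPd a V) (opT V) where
  pd_A d p := by
    refine TensorProduct.ext' fun q v => ?_
    rw [Module.End.mul_apply, LinearMap.add_apply, Module.End.mul_apply, opA_tmul, opPd_tmul,
      opPd_tmul, opA_tmul, opA_tmul, twistedPd_mul, TensorProduct.add_tmul]
  pd_pd d e := by
    refine TensorProduct.ext' fun q v => ?_
    rw [LinearMap.smul_apply, Module.End.mul_apply, Module.End.mul_apply, opPd_tmul, opPd_tmul,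
      opPd_tmul, opPd_tmul, twistedPd_twistedPd, TensorProduct.smul_tmul']
  T_A k l x _ q hq := by
    refine TensorProduct.ext' fun p v => ?_
    rw [LinearMap.smul_apply, Module.End.mul_apply, Module.End.mul_apply, opA_tmul, opT_tmul,
      opT_tmul, opA_tmul, map_mul, sigma_apply hq, smul_mul_assoc, TensorProduct.smul_tmul']
  pd_T d k x _ := by
    refine TensorProduct.ext' fun p v => ?_
    rw [LinearMap.smul_apply, Module.End.mul_apply, Module.End.mul_apply, opPd_tmul, opT_tmul,
      opT_tmul, opPd_tmul, sigma_twistedPd, TensorProduct.smul_tmul', smul_smul, sgn_comm k,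
      sgn_mul_self, one_smul]
  T_T k l x y z hx hy hz := by
    refine TensorProduct.ext' fun p v => ?_
    rw [LinearMap.sub_apply, LinearMap.smul_apply, Module.End.mul_apply, Module.End.mul_apply,
      opT_tmul, opT_tmul, opT_tmul, opT_tmul, opT_tmul, V.ρ_br k l x y z hx hy hz,
      ← sigma_add, ← sigma_add, add_comm l k, ← TensorProduct.tmul_smul, sub_eq_iff_eq_add,
      ← TensorProduct.tmul_add, LinearMap.sub_apply, LinearMap.smul_apply, Module.End.mul_apply,
      Module.End.mul_apply, sub_add_cancel]

/-- The action of `Ū` on `A ⊗ V`. -/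
def tensorHom : Ubar m n →ₐ[ℂ] Module.End ℂ (A m n ⊗[ℂ] V.carrier) :=
  (ubarRep_tensor a V).exists_hom.choose

theorem tensorHom_iA (p : A m n) : tensorHom a V (iA p) = opA V p :=
  (ubarRep_tensor a V).exists_hom.choose_spec.1 p

theorem tensorHom_dU (d : Fin m ⊕ Fin n) : tensorHom a V (dU d) = opPd a V d :=
  (ubarRep_tensor a V).exists_hom.choose_spec.2.1 d

theorem tensorHom_tAlg {k : ZMod 2} {x : (tAlg m n).total} (hx : x.1 ∈ (tAlg m n).gr k) :
    tensorHom a V x.1 = opT V k x :=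
  (ubarRep_tensor a V).exists_hom.choose_spec.2.2 k x hx

/-- The parity operator of `A ⊗ V`. -/
def opPar : Module.End ℂ (A m n ⊗[ℂ] V.carrier) :=
  TensorProduct.map (sigma 1).toLinearMap V.parity

theorem opPar_tmul (q : A m n) (v : V.carrier) :
    opPar V (q ⊗ₜ v) = sigma 1 q ⊗ₜ V.parity v := rfl

theorem opPar_opPar (z : A m n ⊗[ℂ] V.carrier) : opPar V (opPar V z) = z := by
  induction z using TensorProduct.induction_on with
  | zero => rw [map_zero, map_zero]
  | add x y hx hy => rw [map_add, map_add, hx, hy]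
  | tmul q v =>
    rw [opPar_tmul, opPar_tmul, sigma_sigma, V.parity_parity]

theorem opPar_mul_tensorHom {i : ZMod 2} {u : Ubar m n} (hu : u ∈ aSpan iA (uSet m n) i) :
    opPar V * tensorHom a V u = sgn 1 i • (tensorHom a V u * opPar V) := by
  induction hu using Submodule.span_induction with
  | zero => simp
  | add x y _ _ hx hy => rw [map_add, mul_add, hx, hy, add_mul, smul_add]
  | smul c x _ hx => rw [map_smul, mul_smul_comm, hx, smul_mul_assoc, smul_comm]
  | mem z hz =>
    obtain ⟨j, k, p, s, hp, hs, rfl, rfl⟩ := hz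
    have hA : opPar V * opA V p = sgn 1 j • (opA V p * opPar V) := by
      refine TensorProduct.ext' fun q v => ?_
      rw [LinearMap.smul_apply, Module.End.mul_apply, Module.End.mul_apply, opA_tmul, opPar_tmul,
        opPar_tmul, opA_tmul, map_mul, sigma_apply hp, smul_mul_assoc, TensorProduct.smul_tmul']
    have hS : opPar V * tensorHom a V s = sgn 1 k • (tensorHom a V s * opPar V) := by
      rcases hs with ⟨rfl, rfl⟩ | ⟨d, rfl, rfl⟩ | ⟨x, hx, rfl⟩
      · rw [map_one, sgn_zero_right, one_smul, one_mul, mul_one]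
      · rw [tensorHom_dU]
        refine TensorProduct.ext' fun q v => ?_
        rw [LinearMap.smul_apply, Module.End.mul_apply, Module.End.mul_apply, opPd_tmul,
          opPar_tmul, opPar_tmul, opPd_tmul, sigma_twistedPd, TensorProduct.smul_tmul']
      · have h := tensorHom_tAlg a V hx
        rw [Submodule.subtype_apply, h]
        refine TensorProduct.ext' fun q v => ?_
        rw [LinearMap.smul_apply, Module.End.mul_apply, Module.End.mul_apply, opT_tmul,
          opPar_tmul, opPar_tmul, opT_tmul, V.parity_ρ hx, ← sigma_add, ← sigma_add,
          add_comm k 1, TensorProduct.tmul_smul]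
    rw [map_mul, tensorHom_iA, ← mul_assoc, hA, smul_mul_assoc, mul_assoc, hS, mul_smul_comm,
      smul_smul, sgn_add_right, mul_assoc]

/-- The `W̃`-module `T(A^a, V)`. -/
abbrev tensorModule : SuperModule.{u} (wTilde m n) where
  carrier := A m n ⊗[ℂ] V.carrier
  gr := eigGr (opPar V)
  isInternal := eigGr_isInternal (opPar_opPar V)
  ρ := (tensorHom a V).toLinearMap ∘ₗ toUbar
  ρ_mem i j x hx v hv := by
    rw [mem_eigGr] at hv ⊢
    have h := LinearMap.congr_fun (opPar_mul_tensorHom a V (toUbar_mem_aSpan hx)) v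
    rw [LinearMap.smul_apply, Module.End.mul_apply, Module.End.mul_apply, hv, map_smul,
      smul_smul, ← sgn_add_right] at h
    exact h
  ρ_br i j x y z hx hy hz := by
    simp only [LinearMap.comp_apply, AlgHom.toLinearMap_apply]
    rw [toUbar_lie hx hy hz, map_sub, map_smul, map_mul, map_mul]

theorem tensorModule_ρ (x : (wTilde m n).total) :
    (tensorModule a V).ρ x = tensorHom a V (toUbar x) := rfl

theorem tensorModule_isAW : IsAW (tensorModule a V) := by
  refine ⟨?_, fun p q => ?_⟩
  · rw [tensorModule_ρ, toUbar_inA_one, map_one]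
  · rw [tensorModule_ρ, toUbar_inA_mul, map_mul]; rfl

theorem ubarAct_eq (M : SuperModule.{u} (wTilde m n)) (hM : IsAW M)
    (Φ : Ubar m n →ₐ[ℂ] Module.End ℂ M.carrier) (h : ∀ x, Φ (toUbar x) = M.ρ x) (u : Ubar m n) :
    ubarAct M hM u = Φ u := by
  induction u using ubar_induction with
  | h1 c => rw [AlgHom.commutes, AlgHom.commutes]
  | hι x => rw [ubarAct_toUbar, h]
  | ha u v hu hv => rw [map_add, map_add, hu, hv]
  | hm u v hu hv => rw [map_mul, map_mul, hu, hv]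

theorem ubarAct_tensorModule (u : Ubar m n) :
    ubarAct (tensorModule a V) (tensorModule_isAW a V) u = tensorHom a V u :=
  ubarAct_eq (tensorModule a V) (tensorModule_isAW a V) (tensorHom a V) (fun _ => rfl) u

theorem tensorModule_isTensorModule : IsTensorModule a V (tensorModule a V)
    (tensorModule_isAW a V) (LinearEquiv.refl ℂ _) where
  gr_mem i j p hp v hv := by
    refine mem_eigGr.2 ?_
    have h := V.mem_gr_iff.1 hv
    rw [LinearEquiv.refl_apply, opPar_tmul, sigma_apply hp, h, TensorProduct.smul_tmul_smul,
      sgn_add_right]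
  act_A b p v := congrArg (fun f => f (p ⊗ₜ v)) (tensorHom_iA a V b)
  act_pd d p v := congrArg (fun f => f (p ⊗ₜ v)) (tensorHom_dU a V d)
  act_T i j x hx p hp v := by
    have h : ubarAct (tensorModule a V) (tensorModule_isAW a V) (tVal x) = opT V i x :=
      (ubarAct_tensorModule a V _).trans (tensorHom_tAlg a V hx)
    rw [h]
    exact (congrArg (fun q => q ⊗ₜ[ℂ] V.ρ x v) (sigma_apply hp)).trans
      (TensorProduct.smul_tmul' _ _ _).symm

end TensorModule

section TensorOmega

variable (a : Fin m → ℂ) (V : SuperModule.{u} (tAlg m n))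

/-! ### `T(A^a, V)` is in `Ω_a` -/

theorem delta_single (d : Fin m ⊕ Fin n) : delta (Pi.single d 1) = inW (wPd d) := by
  classical
  rw [delta, Finset.sum_eq_single d]
  · rw [Pi.single_eq_same, one_smul]
  · intro e _ h
    rw [Pi.single_eq_of_ne h, zero_smul]
  · exact fun h => absurd (Finset.mem_univ d) h

theorem phi_eq_sum (c : Fin m ⊕ Fin n → ℂ) : phi a c = ∑ d, c d * Sum.elim a 0 d := by
  rw [Fintype.sum_sum_type]
  simp [phi]

theorem phi_single (d : Fin m ⊕ Fin n) : phi (n := n) a (Pi.single d 1) = Sum.elim a 0 d := by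
  classical
  simp [phi_eq_sum, Pi.single_apply]

theorem opPd_apply (d : Fin m ⊕ Fin n) (z : A m n ⊗[ℂ] V.carrier) :
    opPd a V d z = (pd d).rTensor V.carrier z + Sum.elim a 0 d • z := by
  induction z using TensorProduct.induction_on with
  | zero => rw [map_zero, map_zero, smul_zero, add_zero]
  | add x y hx hy => rw [map_add, map_add, hx, hy, smul_add]; abel
  | tmul q v =>
    rw [opPd_tmul, LinearMap.rTensor_tmul, twistedPd_apply, TensorProduct.add_tmul,
      TensorProduct.smul_tmul']

theorem tensorModule_ρ_pd (d : Fin m ⊕ Fin n) (z : A m n ⊗[ℂ] V.carrier) :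
    (tensorModule a V).ρ (inW (wPd d)) z =
      (pd d).rTensor V.carrier z + Sum.elim a 0 d • z :=
  (congrArg (fun f => f z) (tensorHom_dU a V d)).trans (opPd_apply a V d z)

theorem tensorModule_ρ_delta (c : Fin m ⊕ Fin n → ℂ) (z : A m n ⊗[ℂ] V.carrier) :
    (tensorModule a V).ρ (delta c) z =
      ∑ d, c d • (pd d).rTensor V.carrier z + phi a c • z := by
  have : ∀ d, c d • (tensorModule a V).ρ (inW (wPd d)) z =
      c d • (pd d).rTensor V.carrier z + (c d * Sum.elim a 0 d) • z := fun d => by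
    rw [tensorModule_ρ_pd, smul_add, smul_smul]
  rw [delta, map_sum, LinearMap.sum_apply, phi_eq_sum, Finset.sum_smul,
    ← Finset.sum_add_distrib]
  refine Finset.sum_congr rfl fun d _ => ?_
  rw [map_smul, LinearMap.smul_apply, this]

theorem tensorModule_ρ_delta_sub (c : Fin m ⊕ Fin n → ℂ) (z : A m n ⊗[ℂ] V.carrier) :
    ((tensorModule a V).ρ (delta c) - phi a c • 1) z =
      ∑ d, c d • (pd d).rTensor V.carrier z := by
  rw [LinearMap.sub_apply, tensorModule_ρ_delta, LinearMap.smul_apply, Module.End.one_apply,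
    add_sub_cancel_right]

theorem degTensor_mono (V : Type*) [AddCommGroup V] [Module ℂ V] {k l : ℕ} (h : k ≤ l) :
    degTensor m n V k ≤ degTensor m n V l :=
  Submodule.map₂_le_map₂ (degLE_mono h) le_rfl

theorem tensorModule_isWhittaker [FiniteDimensional ℂ V.carrier] :
    IsWhittaker (tensorModule a V) := by
  intro v
  obtain ⟨k, hk⟩ := exists_mem_degTensor (V := V.carrier) v
  refine ⟨degTensor m n V.carrier k, Module.Finite.iff_fg.2 (degTensor_fg k), hk,
    fun c w hw => ?_⟩
  rw [tensorModule_ρ_delta]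
  refine Submodule.add_mem _ (Submodule.sum_mem _ fun d _ => Submodule.smul_mem _ _ ?_)
    (Submodule.smul_mem _ _ hw)
  rcases k with _ | k
  · rw [pd_degTensor_zero d hw]
    exact Submodule.zero_mem _
  · exact degTensor_mono _ (Nat.le_succ k) (pd_degTensor_succ d hw)

/-- Every combination of the partial derivatives lowers the degree, so one more than the degree of
`v` is an exponent that works for all `c` at once. -/
theorem tensorModule_isOfType : IsOfType a (tensorModule a V) := by
  intro v
  obtain ⟨k, hk⟩ := exists_mem_degTensor (V := V.carrier) v
  refine ⟨k + 1, fun c => ?_⟩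
  induction k generalizing v with
  | zero =>
    rw [zero_add, pow_one, tensorModule_ρ_delta_sub]
    exact Finset.sum_eq_zero fun d _ => by rw [pd_degTensor_zero d hk, smul_zero]
  | succ k ih =>
    rw [pow_succ, Module.End.mul_apply]
    refine ih _ ?_
    rw [tensorModule_ρ_delta_sub]
    exact Submodule.sum_mem _ fun d _ => Submodule.smul_mem _ _ (pd_degTensor_succ d hk)

theorem exists_one_tmul_of_pd {z : A m n ⊗[ℂ] V.carrier}
    (h : ∀ d, (tensorModule a V).ρ (inW (wPd d)) z = Sum.elim a 0 d • z) :
    ∃ v, z = 1 ⊗ₜ v := by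
  refine exists_one_tmul fun d => ?_
  have := h d
  rw [tensorModule_ρ_pd] at this
  exact add_eq_right.1 this

theorem mem_Wh {M : SuperModule.{u} (wTilde m n)} {v : M.carrier} :
    v ∈ Wh a M ↔ ∀ d, M.ρ (inW (wPd d)) v = Sum.elim a 0 d • v := by
  rw [Wh, Submodule.mem_iInf]
  constructor
  · intro h d
    have := h (Pi.single d 1)
    rw [delta_single, phi_single, LinearMap.mem_ker, LinearMap.sub_apply, LinearMap.smul_apply,
      Module.End.one_apply, sub_eq_zero] at this
    exact this
  · intro h c
    rw [LinearMap.mem_ker, LinearMap.sub_apply, LinearMap.smul_apply, Module.End.one_apply,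
      sub_eq_zero, delta, map_sum, LinearMap.sum_apply, phi_eq_sum, Finset.sum_smul]
    refine Finset.sum_congr rfl fun d _ => ?_
    rw [map_smul, LinearMap.smul_apply, h, smul_smul]

theorem tensorModule_finite [FiniteDimensional ℂ V.carrier] :
    FiniteDimensional ℂ (Wh a (tensorModule a V)) := by
  have h : Wh a (tensorModule a V) ≤
      LinearMap.range (TensorProduct.mk ℂ (A m n) V.carrier 1) := by
    intro z hz
    obtain ⟨v, rfl⟩ := exists_one_tmul_of_pd a V ((mem_Wh a).1 hz)
    exact ⟨v, rfl⟩
  exact Submodule.finiteDimensional_of_le h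

theorem tensorModule_isOmega [FiniteDimensional ℂ V.carrier] : IsOmega a (tensorModule a V) :=
  ⟨tensorModule_isAW a V, tensorModule_isWhittaker a V, tensorModule_isOfType a V,
    tensorModule_finite a V⟩

/-! ### Maps out of `T(A^a, V)` -/

/-- An intertwiner has to be checked only on `A`, the `∂_d` and `T`, which generate `Ū`. -/
theorem comp_tensorHom {B : Type*} [AddCommGroup B] [Module ℂ B]
    {Ψ : Ubar m n →ₐ[ℂ] Module.End ℂ B} {g : A m n ⊗[ℂ] V.carrier →ₗ[ℂ] B}
    (hA : ∀ p z, g (opA V p z) = Ψ (iA p) (g z)) (hd : ∀ d z, g (opPd a V d z) = Ψ (dU d) (g z))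
    (hT : ∀ k (x : (tAlg m n).total), x.1 ∈ (tAlg m n).gr k → ∀ z,
      g (opT V k x z) = Ψ x.1 (g z)) (u : Ubar m n) :
    ∀ z, g (tensorHom a V u z) = Ψ u (g z) := by
  induction u using ubar_generation with
  | hA p => rw [tensorHom_iA]; exact hA p
  | hd d => rw [tensorHom_dU]; exact hd d
  | hT k x hx =>
    have := tensorHom_tAlg a V (x := ⟨x, tAlg_gr_le_total k hx⟩) hx
    intro z
    rw [this]
    exact hT k _ hx z
  | ha u v hu hv =>
    intro z
    rw [map_add, map_add, LinearMap.add_apply, LinearMap.add_apply, map_add, hu, hv]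
  | hm u v hu hv =>
    intro z
    rw [map_mul, map_mul, Module.End.mul_apply, Module.End.mul_apply, hu, hv]

theorem lTensor_comm_ρ {V V' : SuperModule.{u} (tAlg m n)} (f : V.carrier →ₗ[ℂ] V'.carrier)
    (hf : ∀ x v, f (V.ρ x v) = V'.ρ x (f v)) (x : (wTilde m n).total)
    (z : A m n ⊗[ℂ] V.carrier) :
    f.lTensor (A m n) ((tensorModule a V).ρ x z) =
      (tensorModule a V').ρ x (f.lTensor (A m n) z) := by
  refine comp_tensorHom a V (Ψ := tensorHom a V') ?_ ?_ ?_ (toUbar x) z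
  · intro p z
    rw [tensorHom_iA]
    induction z using TensorProduct.induction_on with
    | zero => simp only [map_zero]
    | add x y hx hy => simp only [map_add, hx, hy]
    | tmul q v => rfl
  · intro d z
    rw [tensorHom_dU]
    induction z using TensorProduct.induction_on with
    | zero => simp only [map_zero]
    | add x y hx hy => simp only [map_add, hx, hy]
    | tmul q v => rfl
  · intro k x hx z
    rw [tensorHom_tAlg a V' hx]
    induction z using TensorProduct.induction_on with
    | zero => simp only [map_zero]
    | add x y hx hy => simp only [map_add, hx, hy]
    | tmul q v =>
      rw [opT_tmul, LinearMap.lTensor_tmul, LinearMap.lTensor_tmul, opT_tmul, hf]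

/-- `g` preserves Whittaker vectors, and those of `A^a ⊗ V'` are `1 ⊗ V'`; this defines `f`, and
`A`-linearity recovers `g` from it. No parity of `g` enters, so the lemma serves both for fullness
and for the last clause of the theorem. -/
theorem exists_lTensor_eq {V V' : SuperModule.{u} (tAlg m n)}
    {g : A m n ⊗[ℂ] V.carrier →ₗ[ℂ] A m n ⊗[ℂ] V'.carrier}
    (hg : ∀ x z, g ((tensorModule a V).ρ x z) = (tensorModule a V').ρ x (g z)) :
    ∃ f : V.carrier →ₗ[ℂ] V'.carrier, (∀ x v, f (V.ρ x v) = V'.ρ x (f v)) ∧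
      g = f.lTensor (A m n) := by
  have hU : ∀ (u : Ubar m n) z, g (tensorHom a V u z) = tensorHom a V' u (g z) := by
    intro u
    induction u using ubar_induction with
    | h1 c =>
      intro z
      rw [AlgHom.commutes, AlgHom.commutes, Module.algebraMap_end_apply,
        Module.algebraMap_end_apply, map_smul]
    | hι x => exact hg x
    | ha u v hu hv =>
      intro z
      rw [map_add, map_add, LinearMap.add_apply, LinearMap.add_apply, map_add, hu, hv]
    | hm u v hu hv =>
      intro z
      rw [map_mul, map_mul, Module.End.mul_apply, Module.End.mul_apply, hu, hv]
  have h1 : ∀ v : V.carrier, ∃ w : V'.carrier, g (1 ⊗ₜ v) = 1 ⊗ₜ w := by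
    intro v
    refine exists_one_tmul_of_pd a V' fun d => ?_
    rw [← hg, tensorModule_ρ_pd, LinearMap.rTensor_tmul, pd_one, TensorProduct.zero_tmul,
      zero_add, map_smul]
  choose f hf using h1
  let F : V.carrier →ₗ[ℂ] V'.carrier :=
    { toFun := f
      map_add' := fun v w => one_tmul_injective (m := m) (n := n) (by
        change (1 : A m n) ⊗ₜ[ℂ] f (v + w) = 1 ⊗ₜ (f v + f w)
        rw [TensorProduct.tmul_add, ← hf, ← hf, ← hf, ← map_add, TensorProduct.tmul_add])
      map_smul' := fun c v => one_tmul_injective (m := m) (n := n) (by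
        change (1 : A m n) ⊗ₜ[ℂ] f (c • v) = 1 ⊗ₜ (c • f v)
        rw [TensorProduct.tmul_smul, ← hf, ← hf, ← map_smul, TensorProduct.tmul_smul]) }
  have hF : ∀ v, g (1 ⊗ₜ v) = 1 ⊗ₜ F v := hf
  refine ⟨F, fun x v => ?_, TensorProduct.ext' fun p v => ?_⟩
  -- On `1 ⊗ v` the Koszul sign is trivial because `sigma k` fixes `1`.
  · have h2 : ∀ k (x : (tAlg m n).total), x.1 ∈ (tAlg m n).gr k → F (V.ρ x v) = V'.ρ x (F v) := by
      intro k x hx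
      refine one_tmul_injective (m := m) (n := n) ?_
      have h3 := hU x.1 (1 ⊗ₜ v)
      rw [tensorHom_tAlg a V hx, tensorHom_tAlg a V' hx, hF, opT_tmul, opT_tmul, map_one, hF] at h3
      exact h3
    obtain ⟨x₀, h₀, x₁, h₁, hx⟩ := exists_add_of_mem_tAlg x.2
    have e : x = ⟨x₀, tAlg_gr_le_total 0 h₀⟩ + ⟨x₁, tAlg_gr_le_total 1 h₁⟩ := Subtype.ext hx
    rw [e, map_add, map_add, LinearMap.add_apply, LinearMap.add_apply, map_add, h2 0 _ h₀,
      h2 1 _ h₁]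
  · have h3 := hU (iA p) (1 ⊗ₜ v)
    rw [tensorHom_iA, tensorHom_iA, hF, opA_tmul, opA_tmul, mul_one] at h3
    rw [h3, LinearMap.lTensor_tmul]

end TensorOmega

/-! ### The functor `V ↦ T(A^a, V)` -/

section Functor

variable (a : Fin m → ℂ)

theorem SuperModule.parity_comm {S : LieSuperData} {M N : SuperModule.{u} S}
    {f : M.carrier →ₗ[ℂ] N.carrier} (hf : ∀ i, ∀ v ∈ M.gr i, f v ∈ N.gr i) (v : M.carrier) :
    N.parity (f v) = f (M.parity v) := by
  have h1 : ∀ i, ∀ v ∈ M.gr i, N.parity (f v) = f (M.parity v) := by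
    intro i v hv
    rw [N.mem_gr_iff.1 (hf i v hv), M.mem_gr_iff.1 hv, map_smul]
  obtain ⟨v₀, h₀, v₁, h₁, rfl⟩ := M.exists_add_gr v
  simp only [map_add, h1 0 v₀ h₀, h1 1 v₁ h₁]

theorem opPar_lTensor {V V' : SuperModule.{u} (tAlg m n)} {f : V.carrier →ₗ[ℂ] V'.carrier}
    (hf : ∀ i, ∀ v ∈ V.gr i, f v ∈ V'.gr i) (z : A m n ⊗[ℂ] V.carrier) :
    opPar V' (f.lTensor (A m n) z) = f.lTensor (A m n) (opPar V z) := by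
  induction z using TensorProduct.induction_on with
  | zero => simp only [map_zero]
  | add x y hx hy => simp only [map_add, hx, hy]
  | tmul p v =>
    rw [LinearMap.lTensor_tmul, opPar_tmul, opPar_tmul, LinearMap.lTensor_tmul,
      SuperModule.parity_comm hf]

/-- The morphism `id ⊗ f`. -/
def tensorMap {V V' : SuperModule.{u} (tAlg m n)} (f : V ⟶ V') :
    tensorModule a V ⟶ tensorModule a V' where
  toLin := f.toLin.lTensor (A m n)
  map_gr i z hz := by
    rw [mem_eigGr] at hz ⊢
    rw [opPar_lTensor f.map_gr, hz, map_smul]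
  map_ρ := lTensor_comm_ρ a f.toLin f.map_ρ

/-- The functor `V ↦ T(A^a, V)`. -/
def tensorFunctor (m n : ℕ) (a : Fin m → ℂ) :
    CategoryTheory.Functor (TMod.{u} m n) (Omega.{u} m n a) where
  obj V := ⟨tensorModule a V.obj, by
    have := V.property
    exact tensorModule_isOmega a V.obj⟩
  map f := CategoryTheory.ObjectProperty.homMk (tensorMap a f.hom)
  map_id V := by
    refine CategoryTheory.ObjectProperty.hom_ext _ (SuperModule.Hom.ext ?_)
    exact LinearMap.lTensor_id _ _
  map_comp f g := by
    refine CategoryTheory.ObjectProperty.hom_ext _ (SuperModule.Hom.ext ?_)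
    exact LinearMap.lTensor_comp _ _ _

theorem lTensor_injective {V V' : SuperModule.{u} (tAlg m n)} {f g : V.carrier →ₗ[ℂ] V'.carrier}
    (h : f.lTensor (A m n) = g.lTensor (A m n)) : f = g :=
  LinearMap.ext fun v => one_tmul_injective (m := m) (n := n)
    (LinearMap.congr_fun h ((1 : A m n) ⊗ₜ v))

instance tensorFunctor_faithful : (tensorFunctor.{u} m n a).Faithful where
  map_injective {V V'} f g h := by
    refine CategoryTheory.ObjectProperty.hom_ext _ (SuperModule.Hom.ext ?_)
    exact lTensor_injective (congrArg (fun k => k.hom.toLin) h)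

instance tensorFunctor_full : (tensorFunctor.{u} m n a).Full where
  map_surjective {V V'} g := by
    obtain ⟨f, hf, hg⟩ := exists_lTensor_eq a (g := g.hom.toLin) g.hom.map_ρ
    -- `1` is even, so `1 ⊗ v` has the parity of `v`, and the parity of `f v` can be read off from
    -- the even map `g`.
    have hgr : ∀ i, ∀ v ∈ V.obj.gr i, f v ∈ V'.obj.gr i := by
      intro i v hv
      have h1 : (1 : A m n) ⊗ₜ[ℂ] v ∈ (tensorModule a V.obj).gr i := by
        have := (tensorModule_isTensorModule a V.obj).gr_mem 0 i 1 one_mem_aGr v hv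
        rwa [zero_add] at this
      have h2 : opPar V'.obj ((1 : A m n) ⊗ₜ f v) = sgn 1 i • ((1 : A m n) ⊗ₜ f v) := by
        have := mem_eigGr.1 (g.hom.map_gr i _ h1)
        rw [hg] at this
        exact this
      rw [opPar_tmul, map_one, ← TensorProduct.tmul_smul] at h2
      exact V'.obj.mem_gr_iff.2 (one_tmul_injective (m := m) (n := n) h2)
    refine ⟨CategoryTheory.ObjectProperty.homMk ⟨f, hgr, hf⟩, ?_⟩
    exact CategoryTheory.ObjectProperty.hom_ext _ (SuperModule.Hom.ext hg.symm)

end Functor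

/-! ### The `T`-module of Whittaker vectors -/

section Whittaker

variable {a : Fin m → ℂ} {M : SuperModule.{u} (wTilde m n)} (hM : IsAW M)

theorem ubarAct_dU (d : Fin m ⊕ Fin n) : ubarAct M hM (dU d) = M.ρ (inW (wPd d)) :=
  ubarAct_toUbar M hM _

/-- `φ_a` vanishes on odd derivatives, so a Koszul sign in front of `φ_a(∂_d)` has no effect. -/
theorem sgn_smul_elim {N : Type*} [AddCommGroup N] [Module ℂ N] (d : Fin m ⊕ Fin n)
    (k : ZMod 2) (v : N) :
    sgn (pdPar d) k • (Sum.elim a 0 d : ℂ) • v = (Sum.elim a 0 d : ℂ) • v := by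
  rcases d with i | j
  · have : pdPar (Sum.inl i : Fin m ⊕ Fin n) = 0 := rfl
    rw [this, sgn_zero_left, one_smul]
  · simp

theorem parity_ubarAct (u : Ubar m n) (v : M.carrier) :
    M.parity (ubarAct M hM u v) = ubarAct M hM (parU m n u) (M.parity v) := by
  induction u using ubar_induction generalizing v with
  | h1 c =>
    rw [AlgHom.commutes, AlgHom.commutes, Module.algebraMap_end_apply,
      AlgHom.commutes, Module.algebraMap_end_apply, map_smul]
  | hι x =>
    obtain ⟨x₀, x₁, h₀, h₁, rfl⟩ := exists_add_of_mem_wTilde x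
    rw [map_add, map_add, map_add, map_add, parU_toUbar h₀, parU_toUbar h₁, map_smul, map_smul,
      ubarAct_toUbar, ubarAct_toUbar, LinearMap.add_apply, map_add, M.parity_ρ h₀,
      M.parity_ρ h₁]
    rfl
  | ha u w hu hw =>
    rw [map_add, map_add, map_add, LinearMap.add_apply, LinearMap.add_apply, map_add, hu, hw]
  | hm u w hu hw =>
    rw [map_mul, map_mul, map_mul, Module.End.mul_apply, Module.End.mul_apply, hu, hw]

theorem parity_mem_Wh {v : M.carrier} (hv : v ∈ Wh a M) : M.parity v ∈ Wh a M := by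
  rw [mem_Wh] at hv ⊢
  intro d
  have h := M.parity_ρ (inW_mem_gr (D := wPd d) (pd_mem d)) v
  rw [hv, map_smul] at h
  have h2 := congrArg (fun w => sgn 1 (pdPar d) • w) h
  simp only [sgn_smul_smul] at h2
  rw [← h2, sgn_comm, sgn_smul_elim]

/-- `T` supercommutes with the `∂_d`, and the resulting sign is harmless since `φ_a` is zero on the
odd ones. -/
theorem ubarAct_mem_Wh {x : Ubar m n} (hx : x ∈ (tAlg m n).total) {v : M.carrier}
    (hv : v ∈ Wh a M) : ubarAct M hM x v ∈ Wh a M := by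
  have h1 : ∀ k, ∀ x ∈ (tAlg m n).gr k, ubarAct M hM x v ∈ Wh a M := by
    intro k x hx
    rw [mem_Wh] at hv ⊢
    intro d
    rw [← ubarAct_dU hM, ← Module.End.mul_apply, ← map_mul, dU_mul_tAlg hx, map_smul, map_mul,
      LinearMap.smul_apply, Module.End.mul_apply, ubarAct_dU, hv, map_smul, sgn_smul_elim]
  obtain ⟨x₀, h₀, x₁, h₁, rfl⟩ := exists_add_of_mem_tAlg hx
  rw [map_add]
  exact Submodule.add_mem _ (h1 0 x₀ h₀) (h1 1 x₁ h₁)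

/-- The parity operator of the space of Whittaker vectors. -/
def whPar (a : Fin m → ℂ) (M : SuperModule.{u} (wTilde m n)) : Module.End ℂ (Wh a M) :=
  M.parity.restrict fun _ hv => parity_mem_Wh hv

theorem mem_whPar {i : ZMod 2} {v : Wh a M} :
    v ∈ eigGr (whPar a M) i ↔ M.parity v = sgn 1 i • v.1 := by
  rw [mem_eigGr]
  exact Subtype.ext_iff

/-- The `T`-module of Whittaker vectors. -/
abbrev whModule (a : Fin m → ℂ) {M : SuperModule.{u} (wTilde m n)} (hM : IsAW M) :
    SuperModule.{u} (tAlg m n) where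
  carrier := Wh a M
  gr := eigGr (whPar a M)
  isInternal := eigGr_isInternal fun v => Subtype.ext (M.parity_parity v)
  ρ :=
    { toFun := fun x => (ubarAct M hM x.1).restrict fun _ hv => ubarAct_mem_Wh hM x.2 hv
      map_add' := fun x y => LinearMap.ext fun v => Subtype.ext
        (LinearMap.congr_fun (map_add (ubarAct M hM) x.1 y.1) v.1)
      map_smul' := fun c x => LinearMap.ext fun v => Subtype.ext
        (LinearMap.congr_fun (map_smul (ubarAct M hM) c x.1) v.1) }
  ρ_mem i j x hx v hv := by
    rw [mem_whPar] at hv ⊢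
    refine (parity_ubarAct hM x.1 v.1).trans ?_
    rw [parU_tAlg hx, hv, map_smul, map_smul, LinearMap.smul_apply, smul_smul, sgn_add_right]
    exact congrArg (· • _) (mul_comm _ _)
  ρ_br i j x y z hx hy hz := by
    refine LinearMap.ext fun v => Subtype.ext ?_
    change ubarAct M hM z.1 v.1 = ubarAct M hM x.1 (ubarAct M hM y.1 v.1) -
      sgn i j • ubarAct M hM y.1 (ubarAct M hM x.1 v.1)
    have h : z.1 = x.1 * y.1 - sgn i j • (y.1 * x.1) := hz
    rw [h, map_sub, map_smul, map_mul, map_mul]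
    rfl

end Whittaker

/-! ### Modules in `Ω_a` are generated by Whittaker vectors -/

section EssSurj

variable {a : Fin m → ℂ} {M : SuperModule.{u} (wTilde m n)} (hM : IsAW M)

theorem tAlg_mul_iA_eq {k : ZMod 2} {x : Ubar m n} (hx : x ∈ (tAlg m n).gr k) (p : A m n) :
    x * iA p = iA (sigma k p) * x := by
  induction p using homogeneous_induction with
  | h l p hp => rw [tAlg_mul_iA hx hp, sigma_apply hp, map_smul, smul_mul_assoc]
  | ha p q hp hq => simp only [map_add, mul_add, add_mul, hp, hq]

/-- The operator by which `∂_d - φ_a(∂_d)` acts. -/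
def shiftPd (a : Fin m → ℂ) (M : SuperModule.{u} (wTilde m n)) (d : Fin m ⊕ Fin n) :
    Module.End ℂ M.carrier := M.ρ (inW (wPd d)) + (-(Sum.elim a 0 d : ℂ)) • 1

theorem shiftPd_apply (d : Fin m ⊕ Fin n) (v : M.carrier) :
    shiftPd a M d v = M.ρ (inW (wPd d)) v + (-(Sum.elim a 0 d : ℂ)) • v := rfl

theorem mem_Wh_iff_shiftPd {v : M.carrier} : v ∈ Wh a M ↔ ∀ d, shiftPd a M d v = 0 := by
  rw [mem_Wh]
  refine forall_congr' fun d => ?_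
  rw [shiftPd_apply, neg_smul, ← sub_eq_add_neg, sub_eq_zero]

theorem shiftPd_ubarAct_iA (d : Fin m ⊕ Fin n) (p : A m n) (v : M.carrier) :
    shiftPd a M d (ubarAct M hM (iA p) v) = ubarAct M hM (iA (pd d p)) v +
      ubarAct M hM (iA (sigma (pdPar d) p)) (shiftPd a M d v) := by
  have h : (Sum.elim a 0 d : ℂ) • iA (sigma (pdPar d) p) = (Sum.elim a 0 d : ℂ) • iA p := by
    rcases d with i | j
    · have : pdPar (Sum.inl i : Fin m ⊕ Fin n) = 0 := rfl
      rw [this, sigma_zero, AlgHom.id_apply]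
    · simp
  have h2 := congrArg (fun u => ubarAct M hM u v) h
  simp only [map_smul, LinearMap.smul_apply] at h2
  have h3 := congrArg (fun u => ubarAct M hM u v) (dU_mul_iA d p)
  simp only [map_add, map_mul, LinearMap.add_apply, Module.End.mul_apply, ubarAct_dU] at h3
  rw [shiftPd_apply, shiftPd_apply, h3, map_add, map_smul, neg_smul, neg_smul, ← h2]
  abel

theorem shiftPd_shiftPd (hM : IsAW M) (d e : Fin m ⊕ Fin n) (v : M.carrier) :
    shiftPd a M d (shiftPd a M e v) =
      sgn (pdPar d) (pdPar e) • shiftPd a M e (shiftPd a M d v) := by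
  have h3 := congrArg (fun u => ubarAct M hM u v) (dU_mul_dU d e)
  simp only [map_smul, map_mul, LinearMap.smul_apply, Module.End.mul_apply, ubarAct_dU] at h3
  simp only [shiftPd_apply, map_add, map_smul, h3]
  rcases d with i | j <;> rcases e with i' | j'
  · have : pdPar (Sum.inl i : Fin m ⊕ Fin n) = 0 := rfl
    rw [this, sgn_zero_left]; module
  · have : pdPar (Sum.inl i : Fin m ⊕ Fin n) = 0 := rfl
    rw [this, sgn_zero_left]; module
  · have : pdPar (Sum.inl i' : Fin m ⊕ Fin n) = 0 := rfl
    rw [this, sgn_zero_right]; module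
  · simp

/-- The map `p ⊗ v ↦ p v` from `A ⊗ Wh_a(M)` to `M`. -/
def whMap (a : Fin m → ℂ) {M : SuperModule.{u} (wTilde m n)} (hM : IsAW M) :
    A m n ⊗[ℂ] (whModule a hM).carrier →ₗ[ℂ] M.carrier :=
  actMap ((ubarAct M hM).comp iA) (Wh a M).subtype

theorem whMap_tmul (p : A m n) (v : Wh a M) :
    whMap a hM (p ⊗ₜ v) = ubarAct M hM (iA p) v.1 := rfl

/-- Whittaker vectors are the common kernel of the operators `shiftPd`, which satisfy the same
relations with `A` as the partial derivatives. Injectivity is `actMap_injective`; surjectivity is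
`mem_span_of_locally_nilpotent`. -/
theorem whMap_bijective (hM' : IsOfType a M) : Function.Bijective (whMap a hM) := by
  have hinj : Function.Injective (Wh a M).subtype := Submodule.subtype_injective _
  refine ⟨actMap_injective (D := shiftPd a M) hinj fun d p v => ?_, fun v => ?_⟩
  · refine (shiftPd_ubarAct_iA hM d p v.1).trans ?_
    rw [mem_Wh_iff_shiftPd.1 v.2 d, map_zero, add_zero]
    rfl
  -- Local nilpotency is the condition of type `a` at the basis vectors of `△`.
  · have hnil : ∀ d (v : M.carrier), ∃ k, (shiftPd a M d ^ k) v = 0 := by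
      intro d v
      obtain ⟨k, hk⟩ := hM' v
      refine ⟨k, ?_⟩
      have := hk (Pi.single d 1)
      rw [delta_single, phi_single, sub_eq_add_neg, ← neg_smul] at this
      exact this
    have h := mem_span_of_locally_nilpotent (L := (ubarAct M hM).comp iA) (D := shiftPd a M)
      (shiftPd_ubarAct_iA hM) (shiftPd_shiftPd hM) hnil v
    have hle : Submodule.span ℂ {w : M.carrier | ∃ p u, (∀ d, shiftPd a M d u = 0) ∧
        w = (ubarAct M hM).comp iA p u} ≤ LinearMap.range (whMap a hM) := by
      refine Submodule.span_le.2 ?_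
      rintro _ ⟨p, u, hu, rfl⟩
      exact ⟨p ⊗ₜ ⟨u, mem_Wh_iff_shiftPd.2 hu⟩, rfl⟩
    exact hle h

theorem whMap_opPar (z : A m n ⊗[ℂ] (whModule a hM).carrier) :
    M.parity (whMap a hM z) = whMap a hM (opPar (whModule a hM) z) := by
  induction z using TensorProduct.induction_on with
  | zero => simp only [map_zero]
  | add x y hx hy => simp only [map_add, hx, hy]
  | tmul p v =>
    have h : ((whModule a hM).parity v : Wh a M).1 = M.parity v.1 := by
      obtain ⟨v₀, h₀, v₁, h₁, rfl⟩ := (whModule a hM).exists_add_gr v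
      have e0 := mem_whPar.1 h₀
      have e1 := mem_whPar.1 h₁
      rw [map_add, (whModule a hM).mem_gr_iff.1 h₀, (whModule a hM).mem_gr_iff.1 h₁]
      refine Eq.trans ?_ (map_add M.parity (v₀ : Wh a M).1 (v₁ : Wh a M).1).symm
      rw [e0, e1]
      rfl
    rw [whMap_tmul, parity_ubarAct, parU_iA, ← h]
    rfl

theorem whMap_ρ (x : (wTilde m n).total) (z : A m n ⊗[ℂ] (whModule a hM).carrier) :
    whMap a hM ((tensorModule a (whModule a hM)).ρ x z) = M.ρ x (whMap a hM z) := by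
  rw [← ubarAct_toUbar M hM]
  refine comp_tensorHom a (whModule a hM) (Ψ := ubarAct M hM) ?_ ?_ ?_ (toUbar x) z
  · intro p z
    induction z using TensorProduct.induction_on with
    | zero => simp only [map_zero]
    | add x y hx hy => simp only [map_add, hx, hy]
    | tmul q v =>
      refine (whMap_tmul hM (p * q) v).trans ?_
      rw [map_mul, map_mul]
      rfl
  · intro d z
    induction z using TensorProduct.induction_on with
    | zero => simp only [map_zero]
    | add x y hx hy => simp only [map_add, hx, hy]
    | tmul q v =>
      have h := shiftPd_ubarAct_iA (a := a) hM d q v.1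
      rw [mem_Wh_iff_shiftPd.1 v.2 d, map_zero, add_zero, shiftPd_apply, neg_smul,
        ← sub_eq_add_neg, sub_eq_iff_eq_add] at h
      rw [ubarAct_dU]
      refine Eq.trans ?_ h.symm
      refine (whMap_tmul hM (twistedPd a d q) v).trans ?_
      rw [twistedPd_apply, map_add, map_smul, map_add, map_smul]
      rfl
  · intro k x hx z
    induction z using TensorProduct.induction_on with
    | zero => simp only [map_zero]
    | add x y hx hy => simp only [map_add, hx, hy]
    | tmul q v =>
      have h := congrArg (fun u => ubarAct M hM u v.1) (tAlg_mul_iA_eq hx q)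
      simp only [map_mul] at h
      exact h.symm

/-- The isomorphism `A ⊗ Wh_a(M) ≅ M`. -/
def whIso (hM' : IsOfType a M) : tensorModule a (whModule a hM) ≅ M :=
  let g := LinearEquiv.ofBijective (whMap a hM) (whMap_bijective hM hM')
  { hom := ⟨g.toLinearMap, fun i z hz => by
      rw [mem_eigGr] at hz
      rw [M.mem_gr_iff]
      change M.parity (whMap a hM z) = sgn 1 i • whMap a hM z
      rw [whMap_opPar, hz, map_smul], whMap_ρ hM⟩
    inv := ⟨g.symm.toLinearMap, fun i v hv => by
      obtain ⟨z, rfl⟩ := g.surjective v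
      rw [M.mem_gr_iff] at hv
      rw [mem_eigGr]
      refine g.injective ?_
      change whMap a hM (opPar _ (g.symm (g z))) = g (sgn 1 i • g.symm (g z))
      rw [map_smul, g.symm_apply_apply, ← whMap_opPar]
      exact hv, fun x v => by
      obtain ⟨z, rfl⟩ := g.surjective v
      refine g.injective ?_
      refine (g.apply_symm_apply _).trans ((whMap_ρ hM x z).symm.trans ?_)
      exact congrArg (fun w => g ((tensorModule a (whModule a hM)).ρ x w))
        (g.symm_apply_apply z).symm⟩
    hom_inv_id := SuperModule.Hom.ext (LinearMap.ext fun z => g.symm_apply_apply z)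
    inv_hom_id := SuperModule.Hom.ext (LinearMap.ext fun v => g.apply_symm_apply v) }

end EssSurj

/-! ### Essential surjectivity and the main theorem -/

instance tensorFunctor_essSurj (a : Fin m → ℂ) : (tensorFunctor.{u} m n a).EssSurj where
  mem_essImage M :=
    ⟨⟨whModule a M.property.isAW, M.property.finite⟩,
      ⟨CategoryTheory.ObjectProperty.isoMk _ (whIso M.property.isAW M.property.isOfType)⟩⟩

theorem tensorFunctor_isEquivalence (a : Fin m → ℂ) :
    (tensorFunctor.{u} m n a).IsEquivalence where

end

end SuperWitt

theorem theorem4p4 (m n : ℕ) (a : Fin m → ℂ) :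
    (SuperWitt.tAlg m n).Closed ∧
    ∃ (F : CategoryTheory.Functor (SuperWitt.TMod.{u} m n) (SuperWitt.Omega.{u} m n a))
      (e : ∀ V : SuperWitt.TMod.{u} m n,
        SuperWitt.A m n ⊗[ℂ] V.obj.carrier ≃ₗ[ℂ] (F.obj V).obj.carrier),
      (∀ V, SuperWitt.IsTensorModule a V.obj (F.obj V).obj (F.obj V).property.isAW (e V)) ∧
      (∀ (V V' : SuperWitt.TMod.{u} m n) (f : V ⟶ V') (p : SuperWitt.A m n) (v : V.obj.carrier),
        (F.map f).hom.toLin (e V (p ⊗ₜ v)) = e V' (p ⊗ₜ f.hom.toLin v)) ∧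
      F.IsEquivalence ∧
      (∀ V V' : SuperWitt.TMod.{u} m n,
        Set.BijOn
          (fun f : V.obj.carrier →ₗ[ℂ] V'.obj.carrier =>
            (e V').toLinearMap ∘ₗ f.lTensor (SuperWitt.A m n) ∘ₗ (e V).symm.toLinearMap)
          {f | ∀ x v, f (V.obj.ρ x v) = V'.obj.ρ x (f v)}
          {g | ∀ x w, g ((F.obj V).obj.ρ x w) = (F.obj V').obj.ρ x (g w)}) := by
  -- The underlying space of `F V` is `A ⊗ V` itself, so `e` is the identity and the conjugated map
  -- in the last clause is just `f.lTensor`.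
  refine ⟨SuperWitt.tAlg_closed, SuperWitt.tensorFunctor m n a,
    fun V => LinearEquiv.refl ℂ (SuperWitt.A m n ⊗[ℂ] V.obj.carrier),
    fun V => SuperWitt.tensorModule_isTensorModule a V.obj, fun V V' f p v => rfl,
    SuperWitt.tensorFunctor_isEquivalence a, fun V V' => ⟨fun f hf => ?_, fun f _ g _ h => ?_,
    fun g hg => ?_⟩⟩
  · exact SuperWitt.lTensor_comm_ρ a f hf
  · exact SuperWitt.lTensor_injective h
  · obtain ⟨f, hf, hfg⟩ := SuperWitt.exists_lTensor_eq a hg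
    exact ⟨f, hf, hfg.symm⟩
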